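/- Let $\lambda>0$ and $R>0$. For $\ell\in\mathbb N_0$ let $$i_\ell(x)=x^\ell\sum_{s\ge0}\frac{(x^2/2)^s}{s!\,(2\ell+2s+1)!!},\qquad k_\ell(x)=\frac{e^{-x}}{x}\sum_{j=0}^{\ell}\frac{(\ell+j)!}{j!\,(\ell-j)!\,(2x)^j}$$ be the modified spherical Bessel functions, normalised so that $i_\ell k_\ell'-i_\ell'k_\ell=-1/x^2$. Let $Y_L$, $L=(\ell,m)$, $|m|\le\ell$, be the orthonormal complex spherical harmonics, and let $\Delta_r-\lambda^2=\frac{d^2}{dr^2}+\frac2r\frac{d}{dr}-\big(\frac{\ell(\ell+1)}{r^2}+\lambda^2\big)$. For a centre $\tau\in\mathbb R^3$ let $B$ be the open ball of radius $R$ about $\tau$, and for a complex-valued function $f$ put $f_L(r)=\int_{S^2}f(\tau+r n)\,\overline{Y_L(n)}\,dn$. Put $r_<=\min(r,r')$, $r_>=\max(r,r')$ and $$G_\ell(r,r')=4\pi\lambda\Big[i_\ell(\lambda r_<)k_\ell(\lambda r_>)-i_\ell(\lambda r)\,i_\ell(\lambda r')\,\frac{k_\ell(\lambda R)}{i_\ell(\lambda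 R)}\Big].$$ (1) For every $\ell$, $G_\ell$ is the unique function on $[0,R]^2\setminus\{(0,0)\}$ that is continuous there, is twice continuously differentiable on $[0,R]^2$ off the diagonal, vanishes on $[0,R]^2\setminus\{(0,0)\}$ whenever $r=R$ or $r'=R$, and satisfies, for each $r'\in(0,R)$, $(\Delta_r-\lambda^2)G_\ell(r,r')=-\frac{4\pi}{r^2}\delta(r-r')$ on $0<r<R$ in the sense of distributions; that is, $G_\ell$ is the radial Dirichlet Green function. (2) Let $\rho$ be a complex-valued integrable function on $B$, let $V_{\mathrm I}$ be a function on $\partial B$, and let $V$ be continuous on $\overline B$ with $(\Delta-\lambda^2)V=-4\pi\rho$ in $B$ in the sense of distributions and $V=V_{\mathrm I}$ on $\partial B$. Write $V^{\mathrm I}_L(R)=\int_{S^2}V_{\mathrm I}(\tau+Rn)\,\overline{Y_L(n)}\,dn$. Then for every $L$ and every $0<r\le R$ the functions $r'\mapsto G_\ell(r,r')\rho_L(r')r'^2$ and $r'\mapsto\rho_L(r')i_\ell(\lambda r')r'^2$ are integrable on $(0,R)$, the function $r'\mapsto\rho_L(r')k_\ell(\lambda r')r'^2$ is integrable on $(r,R)$,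 and $$V_L(r)=\int_0^R G_\ell(r,r')\,\rho_L(r')\,r'^2\,dr'+V^{\mathrm I}_L(R)\,\frac{i_\ell(\lambda r)}{i_\ell(\lambda R)},$$ equivalently $$\begin{aligned}V_L(r)=4\pi\lambda\Big(&\Big[\int_0^r\rho_L(r')i_\ell(\lambda r')r'^2dr'\Big]k_\ell(\lambda r)+\Big[\int_r^R\rho_L(r')k_\ell(\lambda r')r'^2dr'\Big]i_\ell(\lambda r)\\&-\Big[\int_0^R\rho_L(r')i_\ell(\lambda r')r'^2dr'\Big]i_\ell(\lambda r)\frac{k_\ell(\lambda R)}{i_\ell(\lambda R)}\Big)+V^{\mathrm I}_L(R)\frac{i_\ell(\lambda r)}{i_\ell(\lambda R)}.\end{aligned}$$ (3) Let $\rho$ be continuous on $\overline B$ and suppose that, for some $N$, $\rho$ on $B$ and $V_{\mathrm I}$ on $\partial B$ equal their spherical-harmonics expansions about $\tau$ truncated at degree $N$, i.e. $\rho(\tau+rn)=\sum_{\ell\le N}\sum_{|m|\le\ell}\rho_L(r)Y_L(n)$ and $V_{\mathrm I}(\tau+Rn)=\sum_{\ell\le N}\sum_{|m|\le\ell}V^{\mathrm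 I}_L(R)Y_L(n)$. Then the boundary value problem in (2) has exactly one solution, namely $V(\tau+rn)=\sum_{\ell\le N}\sum_{|m|\le\ell}V_L(r)Y_L(n)$ for $0\le r\le R$, $n\in S^2$, with $V_L$ given by the first formula in (2). -/

import Mathlib

open MeasureTheory Set Metric
open scoped Laplacian ContDiff ComplexConjugate Nat

namespace MuffinTin

noncomputable section

/-- Euclidean three-space. -/
abbrev E3 : Type := EuclideanSpace ℝ (Fin 3)

/-- Modified spherical Bessel function of the first kind,
`i_ℓ(x) = x^ℓ ∑_s (x²/2)^s / (s! (2ℓ+2s+1)!!)`; for instance `i_0(x) = sinh x / x`. -/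
def besselI (l : ℕ) (x : ℝ) : ℝ :=
  x ^ l * ∑' s : ℕ, (x ^ 2 / 2) ^ s / ((s ! : ℝ) * ((2 * l + 2 * s + 1)‼ : ℝ))

/-- Modified spherical Bessel function of the second kind (for `x > 0`),
`k_ℓ(x) = (e^{-x}/x) ∑_{j ≤ ℓ} (ℓ+j)! / (j! (ℓ-j)! (2x)^j)`; for instance `k_0(x) = e^{-x}/x`.
In this normalisation `i_ℓ k_ℓ' - i_ℓ' k_ℓ = -1/x²`. -/
def besselK (l : ℕ) (x : ℝ) : ℝ :=
  Real.exp (-x) / x *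
    ∑ j ∈ Finset.range (l + 1), ((l + j)! : ℝ) / ((j ! : ℝ) * ((l - j)! : ℝ) * (2 * x) ^ j)

/-- The Legendre polynomial `P_ℓ` (Rodrigues' formula). -/
def legendreP (l : ℕ) : Polynomial ℝ :=
  Polynomial.C (1 / (2 ^ l * (l ! : ℝ))) *
    Polynomial.derivative^[l] ((Polynomial.X ^ 2 - 1) ^ l)

/-- `Y_{ℓm}` for `0 ≤ m ≤ ℓ`. On the unit sphere
`(v₀ + i v₁)^m P_ℓ^{(m)}(v₂) = (sin θ)^m e^{imφ} P_ℓ^{(m)}(cos θ)`. -/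
def sphericalHarmonicNonneg (l m : ℕ) (v : E3) : ℂ :=
  (-1) ^ m *
    (Real.sqrt ((2 * l + 1) / (4 * Real.pi) * (((l - m)! : ℝ) / ((l + m)! : ℝ))) : ℂ) *
    ((v 0 : ℂ) + (v 1 : ℂ) * Complex.I) ^ m *
    (((Polynomial.derivative^[m] (legendreP l)).eval (v 2) : ℝ) : ℂ)

/-- The orthonormal complex spherical harmonic `Y_{ℓm}`, `-ℓ ≤ m ≤ ℓ`, as a function of the unit
vector `v`, with `Y_{ℓ,-m} = (-1)^m conj Y_{ℓm}`. -/
def sphericalHarmonic (l : ℕ) (m : ℤ) (v : E3) : ℂ :=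
  if 0 ≤ m then sphericalHarmonicNonneg l m.natAbs v
  else (-1) ^ m.natAbs * conj (sphericalHarmonicNonneg l m.natAbs v)

/-- The radial component `f_L(r) = ∫_{S²} f(τ + r n) conj (Y_L(n)) dn`, `L = (ℓ, m)`, of `f` in
spherical coordinates centred at `τ` (`dn` the surface measure, of total mass `4π`). -/
def radialComponent (f : E3 → ℂ) (τ : E3) (l : ℕ) (m : ℤ) (r : ℝ) : ℂ :=
  ∫ n : sphere (0 : E3) 1, f (τ + r • (n : E3)) * conj (sphericalHarmonic l m (n : E3))
    ∂((volume : Measure E3).toSphere)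

/-- The finite sum `∑_{ℓ ≤ N} ∑_{|m| ≤ ℓ} a_L(r) Y_L(n)` at the point `x = τ + r n`.
(At `x = τ` the direction is `0`, and `a_L(0) = 0` for `ℓ ≥ 1` wherever this is used.) -/
def harmonicSum (a : ℕ → ℤ → ℝ → ℂ) (N : ℕ) (τ x : E3) : ℂ :=
  ∑ l ∈ Finset.range (N + 1), ∑ m ∈ Finset.Icc (-(l : ℤ)) l,
    a l m ‖x - τ‖ * sphericalHarmonic l m (‖x - τ‖⁻¹ • (x - τ))

/-- The radial operator `Δ_r - λ² = d²/dr² + (2/r) d/dr - (ℓ(ℓ+1)/r² + λ²)`. -/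
def radialOp (lam : ℝ) (l : ℕ) (u : ℝ → ℝ) (r : ℝ) : ℝ :=
  deriv (deriv u) r + 2 / r * deriv u r - ((l : ℝ) * (l + 1) / r ^ 2 + lam ^ 2) * u r

/-- `G` is a radial Dirichlet Green function of `Δ_r - λ²` on `[0, R]`: it is continuous away from
the corner `(0,0)`, twice continuously differentiable off the diagonal, vanishes if `r = R` or
`r' = R`, and solves `(Δ_r - λ²) G(·, r') = -(4π/r²) δ(r - r')` in the sense of distributions.
(The operator `Δ_r - λ²` is symmetric with respect to `r² dr`.) -/
structure IsRadialDirichletGreen (lam R : ℝ) (l : ℕ) (G : ℝ → ℝ → ℝ) : Prop where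
  continuousOn : ContinuousOn (fun p : ℝ × ℝ => G p.1 p.2) ((Icc 0 R ×ˢ Icc 0 R) \ {(0, 0)})
  contDiffOn : ContDiffOn ℝ 2 (fun p : ℝ × ℝ => G p.1 p.2)
    ((Icc 0 R ×ˢ Icc 0 R) \ {p | p.1 = p.2})
  boundary : ∀ r ∈ Icc 0 R, ∀ r' ∈ Icc 0 R, r = R ∨ r' = R → G r r' = 0
  equation : ∀ r' ∈ Ioo 0 R, ∀ η : ℝ → ℝ, ContDiff ℝ ∞ η → HasCompactSupport η →
    tsupport η ⊆ Ioo 0 R →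
      ∫ r in (0 : ℝ)..R, G r r' * radialOp lam l η r * r ^ 2 = -(4 * Real.pi) * η r'

/-- `4πλ [i_ℓ(λ r_<) k_ℓ(λ r_>) - i_ℓ(λ r) i_ℓ(λ r') k_ℓ(λ R) / i_ℓ(λ R)]`. -/
def greenFun (lam R : ℝ) (l : ℕ) (r r' : ℝ) : ℝ :=
  4 * Real.pi * lam * (besselI l (lam * min r r') * besselK l (lam * max r r')
    - besselI l (lam * r) * besselI l (lam * r') * (besselK l (lam * R) / besselI l (lam * R)))

/-- `∫₀^R G_ℓ(r,r') g(r') r'² dr' + b i_ℓ(λ r) / i_ℓ(λ R)`. -/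
def radialPotential (lam R : ℝ) (l : ℕ) (g : ℝ → ℂ) (b : ℂ) (r : ℝ) : ℂ :=
  (∫ r' in (0 : ℝ)..R, (greenFun lam R l r r' : ℂ) * g r' * (r' : ℂ) ^ 2)
    + b * ((besselI l (lam * r) / besselI l (lam * R) : ℝ) : ℂ)

/-- `V` is a solution of `(Δ - λ²) V = -4πρ` in the open ball of radius `R` about `τ` (in the sense
of distributions), continuous up to the boundary, where it takes the values `VI`. -/
structure IsDirichletSolution (lam : ℝ) (τ : E3) (R : ℝ) (ρ VI V : E3 → ℂ) : Prop where
  continuousOn : ContinuousOn V (closedBall τ R)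
  equation : ∀ η : E3 → ℝ, ContDiff ℝ ∞ η → HasCompactSupport η → tsupport η ⊆ ball τ R →
    ∫ x in ball τ R, V x * (((Δ η) x - lam ^ 2 * η x : ℝ) : ℂ)
      = -(4 * Real.pi) * ∫ x in ball τ R, ρ x * (η x : ℂ)
  boundary : ∀ x ∈ sphere τ R, V x = VI x

end

end MuffinTin

namespace MuffinTin

/-! ### Modified spherical Bessel functions -/

/-! For each `ℓ` the homogeneous radial equation has two explicit solutions: `i_ℓ(λr)`, which is
bounded at the origin, and `k_ℓ(λr)`, which blows up there. Their Wronskian is exactly `-1/x²`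
(`bessel_wronskian`). All the rest is built on this pair, and every equation is kept in weak form,
so that an integrable density suffices.

Green function. On each side of the diagonal `G_ℓ(·, r')` is a combination of the pair, so Green's
identity leaves only boundary terms at `r'`, and these add up to the Wronskian
(`integral_greenFun_mul_radialOp`). For uniqueness, the difference of two candidates is a weak
homogeneous solution. A radial test function orthogonal to both `i_ℓ` and `k_ℓ` is `Δ_r - λ²` of
another test function, by variation of parameters; by duality a weak solution is therefore `a i_ℓ +
b k_ℓ` (`exists_eq_besselI_add_besselK`). Growth slower than `k_ℓ` at `0` forces `b = 0`, and the
value zero at `R` forces `a = 0` (`eq_zero_of_weak_homogeneous`).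

Radial components. By the Legendre equation, `χ(‖x - τ‖) conj Y_L` is mapped by `Δ - λ²` to `((Δ_r -
λ²)χ) conj Y_L`. If `χ` vanishes near `0` and near `R` this is an admissible test function, and
polar coordinates turn the equation for `V` into the weak radial equation for `V_L`. The Green
integral of `ρ_L` solves the same equation by Fubini and is `o(k_ℓ)` at `0`, so the uniqueness
statement above identifies `V_L` (`IsWeakRadialSolution.eq_radialPotential`).

Finite expansions. Uniqueness holds because the components determine `V` on every sphere about `τ`:
the spherical harmonics are complete, by Stone–Weierstrass. Existence is shown by duality, without
differentiating the candidate at the centre. A test function `η` is itself a solution, with density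
`-(Δη - λ²η)/(4π)` and boundary values zero, so its components are Green integrals. The symmetry of
`G_ℓ` then moves the Green operator from `ρ` to `η` (`integral_radialPotential_mul_testDensity`). -/

/-- The power series `∑_s y^s / (s! (2ℓ+2s+1)!!)`, so that `i_ℓ(x) = x^ℓ T_ℓ(x²/2)`. -/
noncomputable def besselISeries (l : ℕ) (y : ℝ) : ℝ :=
  ∑' s : ℕ, y ^ s / ((s ! : ℝ) * ((2 * l + 2 * s + 1)‼ : ℝ))

lemma besselISeries_term_le (l s : ℕ) (y : ℝ) :
    ‖y ^ s / ((s ! : ℝ) * ((2 * l + 2 * s + 1)‼ : ℝ))‖ ≤ |y| ^ s / (s ! : ℝ) := by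
  have h1 : (1 : ℝ) ≤ ((2 * l + 2 * s + 1)‼ : ℝ) := by
    exact_mod_cast Nat.doubleFactorial_pos _
  have h2 : (0 : ℝ) < (s ! : ℝ) := by positivity
  rw [norm_div, norm_pow, Real.norm_eq_abs, Real.norm_eq_abs,
    abs_of_pos (show (0 : ℝ) < (s ! : ℝ) * ((2 * l + 2 * s + 1)‼ : ℝ) by positivity)]
  gcongr
  nlinarith

lemma summable_besselISeries (l : ℕ) (y : ℝ) :
    Summable fun s : ℕ => y ^ s / ((s ! : ℝ) * ((2 * l + 2 * s + 1)‼ : ℝ)) :=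
  .of_norm_bounded (Real.summable_pow_div_factorial |y|) fun s => besselISeries_term_le l s y

/-- Differentiating termwise and shifting `s` cancels a factor of `s!` and turns `(2ℓ+2s+1)!!` into
the double factorial belonging to `ℓ + 1`. The majorant `s (|y|+1)^(s-1) / s!` on the ball of radius
`|y| + 1` justifies the interchange. -/
lemma hasDerivAt_besselISeries (l : ℕ) (y : ℝ) :
    HasDerivAt (besselISeries l) (besselISeries (l + 1) y) y := by
  have hu : Summable fun n : ℕ => (n : ℝ) * (|y| + 1) ^ (n - 1) / (n ! : ℝ) := by
    rw [← summable_nat_add_iff 1]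
    refine (Real.summable_pow_div_factorial (|y| + 1)).congr fun n => ?_
    rw [Nat.factorial_succ]
    push_cast
    field_simp
  have hd := hasDerivAt_tsum_of_isPreconnected (𝕜 := ℝ)
    (g := fun (s : ℕ) (z : ℝ) => z ^ s / ((s ! : ℝ) * ((2 * l + 2 * s + 1)‼ : ℝ)))
    (g' := fun (s : ℕ) (z : ℝ) => (s : ℝ) * z ^ (s - 1) / ((s ! : ℝ) * ((2 * l + 2 * s + 1)‼ : ℝ)))
    hu (isOpen_ball (x := (0 : ℝ)) (ε := |y| + 1)) (convex_ball _ _).isPreconnected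
    (fun n z _ => (hasDerivAt_pow n z).div_const _) (fun n z hz => ?_)
    (y₀ := y) (by simp) (summable_besselISeries l y) (y := y) (by simp)
  · refine hd.congr_deriv (Eq.symm ?_)
    have hs : Summable fun s : ℕ =>
        (s : ℝ) * y ^ (s - 1) / ((s ! : ℝ) * ((2 * l + 2 * s + 1)‼ : ℝ)) := by
      rw [← summable_nat_add_iff 1]
      refine (summable_besselISeries (l + 1) y).congr fun n => ?_
      rw [Nat.factorial_succ, show 2 * (l + 1) + 2 * n + 1 = 2 * l + 2 * (n + 1) + 1 by ring]
      push_cast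
      field_simp
    rw [hs.tsum_eq_zero_add, besselISeries]
    simp only [Nat.cast_zero, zero_mul, zero_div, zero_add]
    refine tsum_congr fun n => ?_
    rw [Nat.factorial_succ, show 2 * (l + 1) + 2 * n + 1 = 2 * l + 2 * (n + 1) + 1 by ring]
    push_cast
    field_simp
  · have h1 : (1 : ℝ) ≤ ((2 * l + 2 * n + 1)‼ : ℝ) := by
      exact_mod_cast Nat.doubleFactorial_pos _
    have h2 : (0 : ℝ) < (n ! : ℝ) := by positivity
    have h3 : |z| ≤ |y| + 1 := by simpa using (mem_ball.1 hz).le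
    rw [norm_div, norm_mul, norm_pow, Real.norm_eq_abs, Real.norm_eq_abs, Real.norm_eq_abs,
      abs_of_pos (show (0 : ℝ) < (n ! : ℝ) * ((2 * l + 2 * n + 1)‼ : ℝ) by positivity),
      abs_of_nonneg (Nat.cast_nonneg n)]
    gcongr
    nlinarith

/-- Since `(2ℓ+2s+3)!! = (2ℓ+2s+3)(2ℓ+2s+1)!!`, the `s`-th coefficient of `T_ℓ - (2ℓ+3) T_{ℓ+1}` is
`2s / (s! (2ℓ+2s+3)!!)`. It vanishes at `s = 0`, and a shift of `s` gives `2y T_{ℓ+2}`. As `T_ℓ' =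
T_{ℓ+1}`, this is the differential equation of the series. -/
lemma besselISeries_recurrence (l : ℕ) (y : ℝ) :
    besselISeries l y =
      (2 * l + 3) * besselISeries (l + 1) y + 2 * y * besselISeries (l + 2) y := by
  have h1 := summable_besselISeries (l + 1) y
  have h2 := summable_besselISeries (l + 2) y
  have h0 := summable_besselISeries l y
  have e : ∀ s : ℕ, ((2 * (l + 1) + 2 * s + 1)‼ : ℝ) =
      (2 * l + 2 * s + 3) * ((2 * l + 2 * s + 1)‼ : ℝ) := fun s => by
    rw [show 2 * (l + 1) + 2 * s + 1 = (2 * l + 2 * s + 1) + 2 by ring, Nat.doubleFactorial_add_two]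
    push_cast; ring
  have hz : ∀ k, ((k : ℕ)‼ : ℝ) ≠ 0 := fun k => by
    exact_mod_cast (Nat.doubleFactorial_pos k).ne'
  have h3 : ∑' s : ℕ, (y ^ s / ((s ! : ℝ) * ((2 * l + 2 * s + 1)‼ : ℝ)) -
      (2 * l + 3) * (y ^ s / ((s ! : ℝ) * ((2 * (l + 1) + 2 * s + 1)‼ : ℝ)))) =
      2 * y * besselISeries (l + 2) y := by
    rw [(h0.sub (h1.mul_left _)).tsum_eq_zero_add, besselISeries, ← tsum_mul_left, e 0]
    have : (2 * (l : ℝ) + 3) ≠ 0 := by positivity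
    have := hz (2 * l + 1)
    rw [show ((y ^ 0 / (((0 : ℕ)! : ℝ) * ((2 * l + 2 * 0 + 1)‼ : ℝ)) -
      (2 * l + 3) * (y ^ 0 / (((0 : ℕ)! : ℝ) * ((2 * l + 2 * (0 : ℕ) + 3) *
        ((2 * l + 2 * 0 + 1)‼ : ℝ))))) : ℝ) = 0 by
      simp only [pow_zero, Nat.factorial_zero, Nat.cast_one, one_mul, mul_zero, add_zero,
        Nat.cast_zero]
      field_simp
      simp, zero_add]
    refine tsum_congr fun s => ?_
    rw [show 2 * (l + 2) + 2 * s + 1 = 2 * (l + 1) + 2 * (s + 1) + 1 by ring, e (s + 1),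
      Nat.factorial_succ]
    have := hz (2 * l + 2 * (s + 1) + 1)
    have h4 : (2 * (l : ℝ) + 2 * ((s + 1 : ℕ) : ℝ) + 3) ≠ 0 := by positivity
    push_cast at h4 ⊢
    field_simp
    ring
  rw [← h3, (h0.tsum_sub (h1.mul_left _)), tsum_mul_left]
  simp only [besselISeries]
  ring

lemma contDiff_besselISeries (l : ℕ) : ContDiff ℝ ∞ (besselISeries l) := by
  rw [contDiff_infty]
  intro n
  induction n generalizing l with
  | zero =>
    exact contDiff_zero.2 <| continuous_iff_continuousAt.2 fun y =>
      (hasDerivAt_besselISeries l y).continuousAt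
  | succ n ih =>
    rw [Nat.cast_add, Nat.cast_one, contDiff_succ_iff_deriv]
    refine ⟨fun y => (hasDerivAt_besselISeries l y).differentiableAt, by simp, ?_⟩
    rw [show deriv (besselISeries l) = besselISeries (l + 1) from
      funext fun y => (hasDerivAt_besselISeries l y).deriv]
    exact ih (l + 1)

lemma besselISeries_pos (l : ℕ) {y : ℝ} (hy : 0 ≤ y) : 0 < besselISeries l y := by
  refine (summable_besselISeries l y).tsum_pos (fun s => by positivity) 0 ?_
  have := Nat.doubleFactorial_pos (2 * l + 1)
  simpa using this

lemma besselI_eq (l : ℕ) (x : ℝ) : besselI l x = x ^ l * besselISeries l (x ^ 2 / 2) := rfl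

/-! ### Coefficients and recurrences of the second-kind functions -/

/-- The coefficient of `x^{-j}` in `x e^x k_ℓ(x)`; it vanishes for `j > ℓ`. -/
noncomputable def besselKCoeff (l j : ℕ) : ℝ :=
  ((l + j).choose (2 * j) : ℝ) * (((2 * j)! : ℝ) / ((j ! : ℝ) * 2 ^ j))

lemma besselKCoeff_zero (l : ℕ) : besselKCoeff l 0 = 1 := by simp [besselKCoeff]

lemma besselKCoeff_of_lt {l j : ℕ} (h : l < j) : besselKCoeff l j = 0 := by
  rw [besselKCoeff, Nat.choose_eq_zero_of_lt (by omega)]; simp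

lemma besselKCoeff_factor_succ (j : ℕ) :
    ((2 * (j + 1))! : ℝ) / (((j + 1)! : ℝ) * 2 ^ (j + 1)) =
      (2 * j + 1) * (((2 * j)! : ℝ) / ((j ! : ℝ) * 2 ^ j)) := by
  rw [show 2 * (j + 1) = (2 * j + 1) + 1 by ring, Nat.factorial_succ, Nat.factorial_succ,
    Nat.factorial_succ]
  push_cast
  field_simp
  ring

/-- Pascal's rule together with the absorption identity `(n+1) C(n,k) = C(n+1,k+1) (k+1)`. It is the
coefficient form of `(x^{-ℓ} k_ℓ)' = -x^{-ℓ} k_{ℓ+1}`. -/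
lemma besselKCoeff_succ_succ (l j : ℕ) :
    besselKCoeff (l + 1) (j + 1) = besselKCoeff l (j + 1) + (j + 1 + l) * besselKCoeff l j := by
  have h1 : ((l + 1 + (j + 1)).choose (2 * (j + 1)) : ℝ) =
      (l + j + 1).choose (2 * j + 1) + (l + (j + 1)).choose (2 * (j + 1)) := by
    rw [show l + 1 + (j + 1) = (l + j + 1) + 1 by ring, show 2 * (j + 1) = (2 * j + 1) + 1 by ring,
      Nat.choose_succ_succ]
    push_cast; rfl
  have h2 : ((l + j + 1 : ℝ)) * ((l + j).choose (2 * j) : ℝ) =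
      ((l + j + 1).choose (2 * j + 1) : ℝ) * (2 * j + 1) := by
    exact_mod_cast Nat.add_one_mul_choose_eq (l + j) (2 * j)
  simp only [besselKCoeff, h1, besselKCoeff_factor_succ]
  linear_combination -(((2 * j)! : ℝ) / ((j ! : ℝ) * 2 ^ j)) * h2

/-- The coefficient form of `k_{ℓ+2} = k_ℓ + ((2ℓ+3)/x) k_{ℓ+1}`; Pascal's rule is applied twice. -/
lemma besselKCoeff_add_two_succ (l j : ℕ) :
    besselKCoeff (l + 2) (j + 1) =
      besselKCoeff l (j + 1) + (2 * l + 3) * besselKCoeff (l + 1) j := by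
  have h1 : ((l + 2 + (j + 1)).choose (2 * (j + 1)) : ℝ) =
      (l + 1 + j + 1).choose (2 * j + 1) + ((l + 1 + j).choose (2 * j + 1) +
        (l + (j + 1)).choose (2 * (j + 1))) := by
    rw [show l + 2 + (j + 1) = (l + 1 + j + 1) + 1 by ring,
      show 2 * (j + 1) = (2 * j + 1) + 1 by ring, Nat.choose_succ_succ,
      show l + 1 + j = (l + (j + 1)) by ring, Nat.choose_succ_succ (l + (j + 1)) (2 * j + 1)]
    push_cast; rfl
  have h2 : ((l + 1 + j + 1 : ℝ)) * ((l + 1 + j).choose (2 * j) : ℝ) =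
      ((l + 1 + j + 1).choose (2 * j + 1) : ℝ) * (2 * j + 1) := by
    exact_mod_cast Nat.add_one_mul_choose_eq (l + 1 + j) (2 * j)
  have h3 : ((l + 1 + j + 1).choose (2 * j + 1) : ℝ) =
      (l + 1 + j).choose (2 * j) + (l + 1 + j).choose (2 * j + 1) := by
    rw [Nat.choose_succ_succ]; push_cast; rfl
  simp only [besselKCoeff, h1, besselKCoeff_factor_succ]
  linear_combination (((2 * j)! : ℝ) / ((j ! : ℝ) * 2 ^ j)) * (-2 * h2 - (2 * j + 1) * h3)

/-- The function `x^{-ℓ} k_ℓ(x)`. -/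
noncomputable def besselKReduced (l : ℕ) (x : ℝ) : ℝ :=
  Real.exp (-x) * ∑ j ∈ Finset.range (l + 1), besselKCoeff l j * x⁻¹ ^ (j + l + 1)

lemma besselK_eq (l : ℕ) {x : ℝ} (hx : x ≠ 0) : besselK l x = x ^ l * besselKReduced l x := by
  rw [besselK, besselKReduced, Finset.mul_sum, Finset.mul_sum, Finset.mul_sum]
  refine Finset.sum_congr rfl fun j hj => ?_
  have hj : j ≤ l := Nat.lt_succ_iff.1 (Finset.mem_range.1 hj)
  rw [besselKCoeff, Nat.cast_choose ℝ (show 2 * j ≤ l + j by omega),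
    show l + j - 2 * j = l - j by omega]
  simp only [inv_pow, mul_pow]
  field_simp
  ring

lemma sum_besselKCoeff_eq (l n : ℕ) (h : l + 1 ≤ n) (f : ℕ → ℝ) :
    ∑ j ∈ Finset.range (l + 1), besselKCoeff l j * f j =
      ∑ j ∈ Finset.range n, besselKCoeff l j * f j := by
  refine Finset.sum_subset (Finset.range_mono h) fun j _ hj => ?_
  rw [besselKCoeff_of_lt (by simpa using hj), zero_mul]

lemma hasDerivAt_besselKReduced (l : ℕ) {x : ℝ} (hx : x ≠ 0) :
    HasDerivAt (besselKReduced l) (-(x * besselKReduced (l + 1) x)) x := by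
  have h1 : HasDerivAt (fun x : ℝ => Real.exp (-x)) (-Real.exp (-x)) x := by
    simpa using (hasDerivAt_neg x).exp
  have h2 : ∀ j ∈ Finset.range (l + 1), HasDerivAt
      (fun x : ℝ => besselKCoeff l j * x⁻¹ ^ (j + l + 1))
      (besselKCoeff l j * (-((j + 1 + l) * x⁻¹ ^ (j + l + 2)))) x := fun j _ => by
    have := ((hasDerivAt_inv hx).pow (j + l + 1)).const_mul (besselKCoeff l j)
    refine this.congr_deriv ?_
    rw [Nat.add_sub_cancel, pow_succ x⁻¹ (j + l + 1), pow_succ x⁻¹ (j + l)]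
    push_cast
    field_simp
    ring
  refine (h1.mul (HasDerivAt.fun_sum h2)).congr_deriv ?_
  -- The extra factor `x` brings the sum for `ℓ + 1` to the powers of `x⁻¹` that occur for `ℓ`. Both
  -- sums then run over the same range, the added coefficient being zero, and the `j = 0` terms are
  -- split off.
  have h3 : x * ∑ j ∈ Finset.range (l + 2), besselKCoeff (l + 1) j * x⁻¹ ^ (j + (l + 1) + 1) =
      ∑ j ∈ Finset.range (l + 2), besselKCoeff (l + 1) j * x⁻¹ ^ (j + l + 1) := by
    rw [Finset.mul_sum]
    refine Finset.sum_congr rfl fun j _ => ?_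
    simp only [inv_pow]
    field_simp
    ring
  rw [besselKReduced, show l + 1 + 1 = l + 2 by ring, ← mul_assoc, mul_comm x, mul_assoc, h3,
    sum_besselKCoeff_eq l (l + 2) (by omega), Finset.sum_range_succ', Finset.sum_range_succ' _ (l + 1),
    besselKCoeff_zero, besselKCoeff_zero]
  simp only [besselKCoeff_succ_succ, add_mul, Finset.sum_add_distrib, mul_neg,
    Finset.sum_neg_distrib]
  have h4 : ∀ j : ℕ, besselKCoeff l j * (↑j * x⁻¹ ^ (j + l + 2) + 1 * x⁻¹ ^ (j + l + 2)
      + ↑l * x⁻¹ ^ (j + l + 2)) = ↑j * besselKCoeff l j * x⁻¹ ^ (j + 1 + l + 1) +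
      1 * besselKCoeff l j * x⁻¹ ^ (j + 1 + l + 1) + ↑l * besselKCoeff l j * x⁻¹ ^ (j + 1 + l + 1) :=
    fun j => by ring
  simp only [h4, Finset.sum_add_distrib]
  ring

lemma besselKReduced_recurrence (l : ℕ) {x : ℝ} (hx : x ≠ 0) :
    x ^ 2 * besselKReduced (l + 2) x =
      besselKReduced l x + (2 * l + 3) * besselKReduced (l + 1) x := by
  have h3 : x ^ 2 * ∑ j ∈ Finset.range (l + 2 + 1),
        besselKCoeff (l + 2) j * x⁻¹ ^ (j + (l + 2) + 1) =
      ∑ j ∈ Finset.range (l + 2 + 1), besselKCoeff (l + 2) j * x⁻¹ ^ (j + l + 1) := by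
    rw [Finset.mul_sum]
    refine Finset.sum_congr rfl fun j _ => ?_
    simp only [inv_pow]
    field_simp
    ring
  rw [besselKReduced, besselKReduced, besselKReduced, ← mul_assoc, mul_comm (x ^ 2), mul_assoc, h3,
    sum_besselKCoeff_eq l (l + 2 + 1) (by omega), Finset.sum_range_succ',
    Finset.sum_range_succ' _ (l + 2), besselKCoeff_zero, besselKCoeff_zero]
  simp only [besselKCoeff_add_two_succ, add_mul, Finset.sum_add_distrib]
  have : ∑ j ∈ Finset.range (l + 2), (2 * l + 3) * besselKCoeff (l + 1) j * x⁻¹ ^ (j + 1 + l + 1) =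
      (2 * l + 3) * ∑ j ∈ Finset.range (l + 1 + 1),
        besselKCoeff (l + 1) j * x⁻¹ ^ (j + (l + 1) + 1) := by
    rw [Finset.mul_sum]
    refine Finset.sum_congr rfl fun j _ => by ring
  simp only [add_mul, Finset.sum_add_distrib] at this
  rw [this]
  ring

/-! ### Derivatives, differential equations and the Wronskian -/

/-- The derivative of `i_ℓ`. -/
noncomputable def besselIDeriv (l : ℕ) (x : ℝ) : ℝ :=
  l * x ^ (l - 1) * besselISeries l (x ^ 2 / 2) + x ^ (l + 1) * besselISeries (l + 1) (x ^ 2 / 2)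

/-- The derivative of `k_ℓ`, away from `0`. -/
noncomputable def besselKDeriv (l : ℕ) (x : ℝ) : ℝ :=
  l * x ^ (l - 1) * besselKReduced l x - x ^ (l + 1) * besselKReduced (l + 1) x

lemma hasDerivAt_besselISeries_sq (l : ℕ) (x : ℝ) :
    HasDerivAt (fun x : ℝ => besselISeries l (x ^ 2 / 2))
      (x * besselISeries (l + 1) (x ^ 2 / 2)) x := by
  have h := (hasDerivAt_besselISeries l (x ^ 2 / 2)).comp x ((hasDerivAt_pow 2 x).div_const 2)
  refine h.congr_deriv ?_
  norm_num
  ring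

lemma hasDerivAt_besselI (l : ℕ) (x : ℝ) : HasDerivAt (besselI l) (besselIDeriv l x) x := by
  refine ((hasDerivAt_pow l x).mul (hasDerivAt_besselISeries_sq l x)).congr_deriv ?_
  rw [besselIDeriv]; ring

lemma besselK_eventuallyEq (l : ℕ) {x : ℝ} (hx : x ≠ 0) :
    besselK l =ᶠ[nhds x] fun y => y ^ l * besselKReduced l y := by
  filter_upwards [isOpen_ne.mem_nhds hx] with y hy using besselK_eq l hy

lemma hasDerivAt_besselK (l : ℕ) {x : ℝ} (hx : x ≠ 0) :
    HasDerivAt (besselK l) (besselKDeriv l x) x := by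
  refine (((hasDerivAt_pow l x).mul (hasDerivAt_besselKReduced l hx)).congr_deriv
    ?_).congr_of_eventuallyEq (besselK_eventuallyEq l hx)
  rw [besselKDeriv]; ring

/-- The modified spherical Bessel equation solved for the second derivative. Eliminating `T_ℓ` by
`besselISeries_recurrence` leaves a polynomial identity in `T_{ℓ+1}` and `T_{ℓ+2}`. -/
lemma hasDerivAt_besselIDeriv (l : ℕ) {x : ℝ} (hx : x ≠ 0) :
    HasDerivAt (besselIDeriv l)
      (-(2 / x * besselIDeriv l x) + ((l : ℝ) * (l + 1) / x ^ 2 + 1) * besselI l x) x := by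
  have h := (((hasDerivAt_pow (l - 1) x).const_mul (l : ℝ)).mul
    (hasDerivAt_besselISeries_sq l x)).add
    ((hasDerivAt_pow (l + 1) x).mul (hasDerivAt_besselISeries_sq (l + 1) x))
  refine h.congr_deriv ?_
  rw [besselI_eq, besselIDeriv, besselISeries_recurrence l]
  -- The exponents `ℓ - 1` and `ℓ - 1 - 1` are truncated subtractions, so `ℓ = 0` and `ℓ = 1` are
  -- separate cases.
  rcases l with _ | _ | l
  · field_simp; simp; ring
  · field_simp; simp; ring
  · simp only [Nat.add_sub_cancel, show l + 1 + 1 - 1 = l + 1 by omega]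
    push_cast
    field_simp
    ring

/-- The same equation for `k_ℓ`; here the recurrence eliminates the function of index `ℓ + 2`. -/
lemma hasDerivAt_besselKDeriv (l : ℕ) {x : ℝ} (hx : x ≠ 0) :
    HasDerivAt (besselKDeriv l)
      (-(2 / x * besselKDeriv l x) + ((l : ℝ) * (l + 1) / x ^ 2 + 1) * besselK l x) x := by
  have h := (((hasDerivAt_pow (l - 1) x).const_mul (l : ℝ)).mul
    (hasDerivAt_besselKReduced l hx)).sub
    ((hasDerivAt_pow (l + 1) x).mul (hasDerivAt_besselKReduced (l + 1) hx))
  refine h.congr_deriv ?_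
  have hr := besselKReduced_recurrence l hx
  have hr : besselKReduced (l + 2) x =
      (besselKReduced l x + (2 * l + 3) * besselKReduced (l + 1) x) / x ^ 2 := by
    rw [← hr]; field_simp
  rw [besselK_eq l hx, besselKDeriv, show l + 1 + 1 = l + 2 by ring, hr]
  rcases l with _ | _ | l
  · field_simp; simp; ring
  · field_simp; simp; ring
  · simp only [Nat.add_sub_cancel, show l + 1 + 1 - 1 = l + 1 by omega]
    push_cast
    field_simp
    ring

lemma besselISeries_zero_sq {x : ℝ} (hx : x ≠ 0) :
    besselISeries 0 (x ^ 2 / 2) = Real.sinh x / x := by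
  rw [eq_div_iff hx, besselISeries, ← tsum_mul_right, ← (Real.hasSum_sinh x).tsum_eq]
  refine tsum_congr fun s => ?_
  have : ((2 * s + 1)! : ℝ) = (2 * s + 1)‼ * (2 ^ s * s !) := by
    rw [← Nat.cast_ofNat (R := ℝ), ← Nat.cast_pow, ← Nat.cast_mul,
      ← Nat.doubleFactorial_two_mul, Nat.factorial_eq_mul_doubleFactorial]
    push_cast; rfl
  rw [this, div_pow]
  have := Nat.doubleFactorial_pos (2 * s + 1)
  simp only [mul_zero, zero_add]
  field_simp
  ring

/-- The derivative of `besselISeries 0 (x²/2)` is computed twice, from the series and from `sinh x /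
x`; derivatives are unique. -/
lemma besselISeries_one_sq {x : ℝ} (hx : x ≠ 0) :
    besselISeries 1 (x ^ 2 / 2) = (x * Real.cosh x - Real.sinh x) / x ^ 3 := by
  have h1 := hasDerivAt_besselISeries_sq 0 x
  have h2 : HasDerivAt (fun x : ℝ => besselISeries 0 (x ^ 2 / 2))
      ((Real.cosh x * x - Real.sinh x * 1) / x ^ 2) x := by
    refine ((Real.hasDerivAt_sinh x).div (hasDerivAt_id x) hx).congr_of_eventuallyEq ?_
    filter_upwards [isOpen_ne.mem_nhds hx] with y hy using besselISeries_zero_sq hy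
  have h3 := h1.unique h2
  rw [zero_add] at h3
  field_simp at h3 ⊢
  linarith

/-- The two three-term recurrences show that the expression does not depend on `ℓ`, since the terms
with factor `2ℓ+3` cancel. For `ℓ = 0` everything is elementary in `exp`, `sinh` and `cosh`. -/
lemma bessel_wronskian_reduced (l : ℕ) {x : ℝ} (hx : x ≠ 0) :
    x ^ (2 * l + 3) * (besselISeries l (x ^ 2 / 2) * besselKReduced (l + 1) x
      + besselISeries (l + 1) (x ^ 2 / 2) * besselKReduced l x) = 1 := by
  induction l with
  | zero =>
    rw [besselISeries_zero_sq hx, zero_add, besselISeries_one_sq hx, besselKReduced, besselKReduced]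
    simp only [Finset.sum_range_succ, Finset.sum_range_zero, besselKCoeff_zero, zero_add]
    have : besselKCoeff 1 1 = 1 := by simp [besselKCoeff]
    rw [this]
    have h := Real.exp_ne_zero x
    rw [Real.sinh_eq, Real.cosh_eq, Real.exp_neg]
    simp only [inv_pow]
    field_simp
    ring
  | succ l ih =>
    have hr := besselKReduced_recurrence l hx
    have hs := besselISeries_recurrence l (x ^ 2 / 2)
    rw [← ih]
    have e : x ^ (2 * (l + 1) + 3) = x ^ (2 * l + 3) * x ^ 2 := by ring
    rw [e]
    simp only [add_assoc, one_add_one_eq_two]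
    linear_combination x ^ (2 * l + 3) * besselISeries (l + 1) (x ^ 2 / 2) * hr
      - x ^ (2 * l + 3) * besselKReduced (l + 1) x * hs

/-- `i_ℓ k_ℓ' - i_ℓ' k_ℓ = -1/x²`. -/
lemma bessel_wronskian (l : ℕ) {x : ℝ} (hx : x ≠ 0) :
    besselI l x * besselKDeriv l x - besselIDeriv l x * besselK l x = -(1 / x ^ 2) := by
  have h := bessel_wronskian_reduced l hx
  rw [besselI_eq, besselK_eq l hx, besselIDeriv, besselKDeriv]
  have h' : 1 / x ^ 2 = x ^ (2 * l + 1) * (besselISeries l (x ^ 2 / 2) * besselKReduced (l + 1) x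
      + besselISeries (l + 1) (x ^ 2 / 2) * besselKReduced l x) := by
    rw [← h]
    field_simp
    ring
  rw [h']
  ring

lemma contDiff_besselI (l : ℕ) : ContDiff ℝ ∞ (besselI l) :=
  (contDiff_id.pow l).mul ((contDiff_besselISeries l).comp ((contDiff_id.pow 2).div_const 2))

lemma contDiffAt_besselK (l : ℕ) {x : ℝ} (hx : x ≠ 0) : ContDiffAt ℝ ∞ (besselK l) x := by
  unfold besselK
  refine ((Real.contDiff_exp.comp contDiff_neg).contDiffAt.div contDiffAt_id hx).mul ?_
  refine ContDiffAt.sum fun j hj => contDiffAt_const.div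
    (contDiffAt_const.mul ((contDiffAt_const.mul contDiffAt_id).pow j)) ?_
  have := pow_ne_zero j (mul_ne_zero two_ne_zero hx)
  positivity

/-! ### Signs, monotonicity and behaviour at the origin -/

lemma measurable_besselK (l : ℕ) : Measurable (besselK l) := by
  unfold besselK; fun_prop

lemma besselI_pos (l : ℕ) {x : ℝ} (hx : 0 < x) : 0 < besselI l x :=
  mul_pos (pow_pos hx l) (besselISeries_pos l (by positivity))

lemma besselI_nonneg (l : ℕ) {x : ℝ} (hx : 0 ≤ x) : 0 ≤ besselI l x :=
  mul_nonneg (pow_nonneg hx l) (besselISeries_pos l (by positivity)).le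

lemma besselI_strictMonoOn (l : ℕ) : StrictMonoOn (besselI l) (Ici 0) := by
  refine strictMonoOn_of_deriv_pos (convex_Ici 0) (contDiff_besselI l).continuous.continuousOn ?_
  intro x hx
  rw [interior_Ici, mem_Ioi] at hx
  rw [(hasDerivAt_besselI l x).deriv, besselIDeriv]
  have h1 := besselISeries_pos l (show 0 ≤ x ^ 2 / 2 by positivity)
  have h2 := besselISeries_pos (l + 1) (show 0 ≤ x ^ 2 / 2 by positivity)
  positivity

lemma besselK_pos (l : ℕ) {x : ℝ} (hx : 0 < x) : 0 < besselK l x := by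
  unfold besselK
  refine mul_pos (by positivity) (Finset.sum_pos (fun j _ => by positivity) ⟨0, by simp⟩)

lemma besselK_antitoneOn (l : ℕ) : AntitoneOn (besselK l) (Ioi 0) := by
  intro x hx y hy hxy
  rw [mem_Ioi] at hx hy
  unfold besselK
  gcongr

/-- All terms of the sum are nonnegative and the one with `j = 0` equals `1`. This gives the blow-up
of `k_ℓ` at `0`. -/
lemma exp_div_le_besselK (l : ℕ) {x : ℝ} (hx : 0 < x) : Real.exp (-x) / x ≤ besselK l x := by
  unfold besselK
  refine le_mul_of_one_le_right (by positivity) ?_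
  refine le_trans ?_ (Finset.single_le_sum (f := fun j => ((l + j)! : ℝ) /
    ((j ! : ℝ) * ((l - j)! : ℝ) * (2 * x) ^ j)) (fun j _ => by positivity)
    (Finset.mem_range.2 (Nat.succ_pos l)))
  simp [div_self (show (l ! : ℝ) ≠ 0 by positivity)]

lemma tendsto_besselK_nhdsGT_zero (l : ℕ) :
    Filter.Tendsto (besselK l) (nhdsWithin 0 (Ioi 0)) Filter.atTop := by
  have h1 : Filter.Tendsto (fun x : ℝ => Real.exp (-x) * x⁻¹) (nhdsWithin 0 (Ioi 0))
      Filter.atTop := by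
    refine Filter.Tendsto.pos_mul_atTop one_pos ?_ tendsto_inv_nhdsGT_zero
    have : Filter.Tendsto (fun x : ℝ => Real.exp (-x)) (nhds 0) (nhds (Real.exp (-0))) :=
      (Real.continuous_exp.comp continuous_neg).tendsto 0
    simpa using this.mono_left nhdsWithin_le_nhds
  refine Filter.tendsto_atTop_mono' _ ?_ h1
  filter_upwards [self_mem_nhdsWithin] with x hx
  exact exp_div_le_besselK l hx

/-- The zero of order `ℓ` of `i_ℓ` cancels the pole of order `ℓ + 1` of `k_ℓ` up to one power of
`x`, so `x i_ℓ(x) k_ℓ(x)` extends to the continuous function `f` below, which is bounded on `[0,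
X]`. -/
lemma exists_besselI_mul_besselK_mul_le (l : ℕ) (X : ℝ) :
    ∃ C, ∀ x ∈ Ioc 0 X, besselI l x * besselK l x * x ≤ C := by
  let f : ℝ → ℝ := fun x => besselISeries l (x ^ 2 / 2) *
    (Real.exp (-x) * ∑ j ∈ Finset.range (l + 1), besselKCoeff l j * x ^ (l - j))
  have hf : Continuous f := by
    have := (contDiff_besselISeries l).continuous
    fun_prop
  obtain ⟨C, hC⟩ := (isCompact_Icc (a := (0 : ℝ)) (b := X)).exists_bound_of_continuousOn
    hf.continuousOn
  refine ⟨C, fun x hx => le_trans (le_of_eq ?_) ((le_abs_self _).trans (hC x ⟨hx.1.le, hx.2⟩))⟩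
  have hx0 := hx.1.ne'
  rw [besselI_eq, besselK_eq l hx0, besselKReduced]
  have : x ^ l * x ^ l * x * ∑ j ∈ Finset.range (l + 1), besselKCoeff l j * x⁻¹ ^ (j + l + 1) =
      ∑ j ∈ Finset.range (l + 1), besselKCoeff l j * x ^ (l - j) := by
    rw [Finset.mul_sum]
    refine Finset.sum_congr rfl fun j hj => ?_
    have hj : j ≤ l := Nat.lt_succ_iff.1 (Finset.mem_range.1 hj)
    obtain ⟨d, rfl⟩ := Nat.exists_eq_add_of_le hj
    simp only [Nat.add_sub_cancel_left, pow_add, inv_pow]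
    field_simp
  simp only [f]
  rw [← this]
  ring

/-! ### Radial test functions and the radial operator -/

/-- Smooth functions on the line which vanish outside a compact part of `(0, R)`. -/
def IsRadialTest (R : ℝ) (η : ℝ → ℝ) : Prop :=
  ContDiff ℝ ∞ η ∧ ∃ c d, 0 < c ∧ c < d ∧ d < R ∧ ∀ r, r ∉ Ioo c d → η r = 0

lemma IsCompact.exists_subset_Ioo {K : Set ℝ} (hK : IsCompact K) {R : ℝ} (hR : 0 < R)
    (h : K ⊆ Ioo 0 R) : ∃ c d, 0 < c ∧ c < d ∧ d < R ∧ K ⊆ Ioo c d := by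
  rcases K.eq_empty_or_nonempty with rfl | hne
  · exact ⟨R / 3, R / 2, by positivity, by linarith, by linarith, empty_subset _⟩
  · obtain ⟨x, hx, hx'⟩ := hK.exists_isLeast hne
    obtain ⟨y, hy, hy'⟩ := hK.exists_isGreatest hne
    have h1 := h hx
    have h2 := h hy
    have h3 := hx' hy
    rw [mem_Ioo] at h1 h2
    exact ⟨x / 2, (y + R) / 2, by linarith, by linarith, by linarith, fun z hz =>
      ⟨by linarith [hx' hz], by linarith [hy' hz]⟩⟩

lemma isRadialTest_of_tsupport {R : ℝ} (hR : 0 < R) {η : ℝ → ℝ} (h1 : ContDiff ℝ ∞ η)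
    (h2 : HasCompactSupport η) (h3 : tsupport η ⊆ Ioo 0 R) : IsRadialTest R η := by
  obtain ⟨c, d, hc, hcd, hd, h⟩ := IsCompact.exists_subset_Ioo h2.isCompact hR h3
  exact ⟨h1, c, d, hc, hcd, hd, fun r hr => image_eq_zero_of_notMem_tsupport fun h' => hr (h h')⟩

lemma tsupport_subset_Icc_of_eq_zero {E : Type*} [Zero E] {c d : ℝ} {η : ℝ → E}
    (h : ∀ r, r ∉ Icc c d → η r = 0) : tsupport η ⊆ Icc c d :=
  closure_minimal (fun r hr => by_contra fun h' => hr (h r h')) isClosed_Icc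

lemma IsRadialTest.hasCompactSupport {R : ℝ} {η : ℝ → ℝ} (h : IsRadialTest R η) :
    HasCompactSupport η := by
  obtain ⟨_, c, d, _, _, _, h⟩ := h
  exact isCompact_Icc.of_isClosed_subset isClosed_closure
    (tsupport_subset_Icc_of_eq_zero fun r hr => h r fun h' => hr (Ioo_subset_Icc_self h'))

lemma IsRadialTest.tsupport_subset {R : ℝ} {η : ℝ → ℝ} (h : IsRadialTest R η) :
    tsupport η ⊆ Ioo 0 R := by
  obtain ⟨_, c, d, hc, _, hd, h⟩ := h
  exact (tsupport_subset_Icc_of_eq_zero fun r hr => h r fun h' =>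
    hr (Ioo_subset_Icc_self h')).trans fun r hr => ⟨hc.trans_le hr.1, hr.2.trans_lt hd⟩

lemma eventually_notMem_Ioo {c d r : ℝ} (h : r ∉ Icc c d) : ∀ᶠ s in nhds r, s ∉ Ioo c d := by
  filter_upwards [isClosed_Icc.isOpen_compl.mem_nhds h] with s hs h' using hs (Ioo_subset_Icc_self h')

lemma deriv_eq_zero_of_eq_zero {c d r : ℝ} {η : ℝ → ℝ} (h : ∀ r, r ∉ Ioo c d → η r = 0)
    (hr : r ∉ Icc c d) : deriv η r = 0 := by
  have : η =ᶠ[nhds r] fun _ => 0 := by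
    filter_upwards [eventually_notMem_Ioo hr] with s hs using h s hs
  rw [this.deriv_eq, deriv_const]

lemma deriv_deriv_eq_zero_of_eq_zero {c d r : ℝ} {η : ℝ → ℝ} (h : ∀ r, r ∉ Ioo c d → η r = 0)
    (hr : r ∉ Icc c d) : deriv (deriv η) r = 0 := by
  have : η =ᶠ[nhds r] fun _ => 0 := by
    filter_upwards [eventually_notMem_Ioo hr] with s hs using h s hs
  rw [this.deriv.deriv_eq]
  simp

lemma radialOp_eq_zero_of_eq_zero {lam : ℝ} {l : ℕ} {c d r : ℝ} {η : ℝ → ℝ}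
    (h : ∀ r, r ∉ Ioo c d → η r = 0) (hr : r ∉ Icc c d) : radialOp lam l η r = 0 := by
  rw [radialOp, deriv_eq_zero_of_eq_zero h hr, deriv_deriv_eq_zero_of_eq_zero h hr,
    h r fun h' => hr (Ioo_subset_Icc_self h')]
  simp

/-- Extension by zero from a compact part of `(0, R)`. It makes the singular coefficients `2/r` and
`ℓ(ℓ+1)/r²` at the origin harmless. -/
lemma continuous_of_continuousOn_of_eq_zero {E : Type*} [Zero E] [TopologicalSpace E] {R c d : ℝ}
    {f : ℝ → E} (hc : 0 < c) (hd : d < R) (hf : ContinuousOn f (Ioo 0 R))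
    (h : ∀ r, r ∉ Icc c d → f r = 0) : Continuous f :=
  continuous_of_tsupport fun _ hr => hf.continuousAt <| Ioo_mem_nhds
    (hc.trans_le (tsupport_subset_Icc_of_eq_zero h hr).1)
    ((tsupport_subset_Icc_of_eq_zero h hr).2.trans_lt hd)

lemma IsRadialTest.continuous_radialOp {R : ℝ} {η : ℝ → ℝ} (hη : IsRadialTest R η) (lam : ℝ)
    (l : ℕ) : Continuous (radialOp lam l η) := by
  obtain ⟨hη, c, d, hc, hcd, hd, h⟩ := hη
  refine continuous_of_continuousOn_of_eq_zero hc hd ?_ fun _ hr => radialOp_eq_zero_of_eq_zero h hr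
  have h0 := hη.continuous
  have h1 := (contDiff_infty_iff_deriv.1 hη).2
  have h2 := (contDiff_infty_iff_deriv.1 h1).2.continuous
  have h1 := h1.continuous
  unfold radialOp
  have : ∀ r ∈ Ioo 0 R, r ≠ 0 := fun r hr => hr.1.ne'
  have : ∀ r ∈ Ioo 0 R, r ^ 2 ≠ 0 := fun r hr => by have := hr.1; positivity
  fun_prop (disch := assumption)

/-- Green's identity for the radial operator. -/
lemma integral_mul_radialOp {lam : ℝ} {l : ℕ} {f f' η : ℝ → ℝ} {a b : ℝ} (ha : 0 < a) (hab : a ≤ b)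
    (hf : ∀ r ∈ Icc a b, HasDerivAt f (f' r) r)
    (hf' : ∀ r ∈ Icc a b,
      HasDerivAt f' (-(2 / r * f' r) + ((l : ℝ) * (l + 1) / r ^ 2 + lam ^ 2) * f r) r)
    (hη : ContDiff ℝ ∞ η) :
    ∫ r in a..b, f r * radialOp lam l η r * r ^ 2 =
      b ^ 2 * (f b * deriv η b - f' b * η b) - a ^ 2 * (f a * deriv η a - f' a * η a) := by
  have h1 := (contDiff_infty_iff_deriv.1 hη).2
  have h2 := (contDiff_infty_iff_deriv.1 h1).2.continuous
  have d0 : ∀ r, HasDerivAt η (deriv η r) r := fun r =>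
    (hη.differentiable (by simp) r).hasDerivAt
  have d1 : ∀ r, HasDerivAt (deriv η) (deriv (deriv η) r) r := fun r =>
    (h1.differentiable (by simp) r).hasDerivAt
  -- As `r²(u'' + 2u'/r) = (r² u')'`, the function `r²(f η' - f' η)` is a primitive: the zero-order
  -- terms cancel because `f` solves the homogeneous equation.
  refine intervalIntegral.integral_eq_sub_of_hasDerivAt
    (f := fun r => r ^ 2 * (f r * deriv η r - f' r * η r)) (fun r hr => ?_) ?_
  · rw [uIcc_of_le hab] at hr
    have hr0 : r ≠ 0 := (ha.trans_le hr.1).ne'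
    refine ((hasDerivAt_pow 2 r).mul (((hf r hr).mul (d1 r)).sub
      ((hf' r hr).mul (d0 r)))).congr_deriv ?_
    simp only [radialOp, Pi.sub_apply, Pi.mul_apply]
    push_cast
    field_simp
    ring
  · refine ContinuousOn.intervalIntegrable ?_
    rw [uIcc_of_le hab]
    have c0 := hη.continuous
    have c1 := h1.continuous
    have c2 : ContinuousOn f (Icc a b) := fun r hr => (hf r hr).continuousAt.continuousWithinAt
    have : ∀ r ∈ Icc a b, r ≠ 0 := fun r hr => (ha.trans_le hr.1).ne'
    have : ∀ r ∈ Icc a b, r ^ 2 ≠ 0 := fun r hr => pow_ne_zero 2 (ha.trans_le hr.1).ne'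
    unfold radialOp
    fun_prop (disch := assumption)

lemma hasDerivAt_besselI_mul (lam : ℝ) (l : ℕ) (r : ℝ) :
    HasDerivAt (fun r => besselI l (lam * r)) (lam * besselIDeriv l (lam * r)) r := by
  have := (hasDerivAt_besselI l (lam * r)).comp r ((hasDerivAt_id r).const_mul lam)
  refine this.congr_deriv (by ring)

lemma hasDerivAt_besselK_mul {lam : ℝ} (l : ℕ) {r : ℝ} (h : lam * r ≠ 0) :
    HasDerivAt (fun r => besselK l (lam * r)) (lam * besselKDeriv l (lam * r)) r := by
  have := (hasDerivAt_besselK l h).comp r ((hasDerivAt_id r).const_mul lam)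
  refine this.congr_deriv (by ring)

lemma hasDerivAt_besselIDeriv_mul {lam : ℝ} (l : ℕ) {r : ℝ} (h : lam * r ≠ 0) :
    HasDerivAt (fun r => lam * besselIDeriv l (lam * r))
      (-(2 / r * (lam * besselIDeriv l (lam * r))) +
        ((l : ℝ) * (l + 1) / r ^ 2 + lam ^ 2) * besselI l (lam * r)) r := by
  have := ((hasDerivAt_besselIDeriv l h).comp r ((hasDerivAt_id r).const_mul lam)).const_mul lam
  refine this.congr_deriv ?_
  have h1 := left_ne_zero_of_mul h
  have h2 := right_ne_zero_of_mul h
  field_simp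

lemma hasDerivAt_besselKDeriv_mul {lam : ℝ} (l : ℕ) {r : ℝ} (h : lam * r ≠ 0) :
    HasDerivAt (fun r => lam * besselKDeriv l (lam * r))
      (-(2 / r * (lam * besselKDeriv l (lam * r))) +
        ((l : ℝ) * (l + 1) / r ^ 2 + lam ^ 2) * besselK l (lam * r)) r := by
  have := ((hasDerivAt_besselKDeriv l h).comp r ((hasDerivAt_id r).const_mul lam)).const_mul lam
  refine this.congr_deriv ?_
  have h1 := left_ne_zero_of_mul h
  have h2 := right_ne_zero_of_mul h
  field_simp

lemma continuous_besselI_mul (lam : ℝ) (l : ℕ) : Continuous fun r => besselI l (lam * r) :=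
  (contDiff_besselI l).continuous.comp (continuous_const.mul continuous_id)

lemma contDiffAt_besselK_mul {lam : ℝ} (l : ℕ) {r : ℝ} (h : lam * r ≠ 0) :
    ContDiffAt ℝ ∞ (fun r => besselK l (lam * r)) r :=
  (contDiffAt_besselK l h).comp r (contDiffAt_const.mul contDiffAt_id)

/-! ### The radial Dirichlet Green function -/

section GreenFun

variable {lam R : ℝ} (l : ℕ)

lemma greenFun_comm (r r' : ℝ) : greenFun lam R l r r' = greenFun lam R l r' r := by
  rw [greenFun, greenFun, min_comm, max_comm]; ring

lemma greenFun_right_boundary (hlam : 0 < lam) (hR : 0 < R) {r : ℝ} (hr : r ≤ R) :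
    greenFun lam R l r R = 0 := by
  have := (besselI_pos l (mul_pos hlam hR)).ne'
  rw [greenFun, min_eq_left hr, max_eq_right hr]
  field_simp
  ring

lemma greenFun_left_boundary (hlam : 0 < lam) (hR : 0 < R) {r : ℝ} (hr : r ≤ R) :
    greenFun lam R l R r = 0 := by
  rw [greenFun_comm, greenFun_right_boundary l hlam hR hr]

lemma measurable_greenFun : Measurable fun p : ℝ × ℝ => greenFun lam R l p.1 p.2 := by
  have h1 := (contDiff_besselI l).continuous.measurable
  have h2 := measurable_besselK l
  unfold greenFun
  fun_prop

lemma continuousAt_greenFun (hlam : 0 < lam) {p : ℝ × ℝ} (hp : 0 < max p.1 p.2) :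
    ContinuousAt (fun p : ℝ × ℝ => greenFun lam R l p.1 p.2) p := by
  have h1 := (contDiff_besselI l).continuous
  have h2 : ContinuousAt (besselK l) (lam * max p.1 p.2) :=
    (contDiffAt_besselK l (mul_pos hlam hp).ne').continuousAt
  have h3 : ContinuousAt (fun p : ℝ × ℝ => besselK l (lam * max p.1 p.2)) p :=
    ContinuousAt.comp (f := fun p : ℝ × ℝ => lam * max p.1 p.2) (g := besselK l) h2
      (by fun_prop)
  unfold greenFun
  fun_prop

/-- The direct and the reflected term both lie in `[0, M]`, so the absolute value of their
difference is at most `M`. -/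
lemma abs_greenFun_le_of_bounds (hlam : 0 < lam) {r r' M : ℝ}
    (h1 : 0 ≤ besselI l (lam * min r r') * besselK l (lam * max r r'))
    (h2 : besselI l (lam * min r r') * besselK l (lam * max r r') ≤ M)
    (h3 : 0 ≤ besselI l (lam * r) * besselI l (lam * r') *
      (besselK l (lam * R) / besselI l (lam * R)))
    (h4 : besselI l (lam * r) * besselI l (lam * r') *
      (besselK l (lam * R) / besselI l (lam * R)) ≤ M) :
    |greenFun lam R l r r'| ≤ 4 * Real.pi * lam * M := by
  have hp := Real.pi_pos
  rw [greenFun, abs_mul, abs_of_pos (by positivity)]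
  gcongr
  exact abs_sub_le_of_nonneg_of_le h1 h2 h3 h4

lemma besselI_mul_le (hlam : 0 < lam) {r s : ℝ} (hr : 0 ≤ r) (h : r ≤ s) :
    besselI l (lam * r) ≤ besselI l (lam * s) :=
  (besselI_strictMonoOn l).monotoneOn (mem_Ici.2 (by positivity))
    (mem_Ici.2 (mul_nonneg hlam.le (hr.trans h))) (by gcongr)

lemma besselK_mul_le (hlam : 0 < lam) {r s : ℝ} (hr : 0 < r) (h : r ≤ s) :
    besselK l (lam * s) ≤ besselK l (lam * r) :=
  besselK_antitoneOn l (mem_Ioi.2 (by positivity))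
    (mem_Ioi.2 (mul_pos hlam (hr.trans_le h))) (by gcongr)

/-- As `i_ℓ(λr) ≤ i_ℓ(λR)`, the reflected term is controlled by the same kind of bound as the direct
one. -/
lemma besselI_mul_div_le (hlam : 0 < lam) (hR : 0 < R) {r x y : ℝ} (hx : 0 ≤ x) (hr : r ∈ Icc 0 R)
    (hy : besselK l (lam * R) ≤ y) :
    besselI l (lam * r) * x * (besselK l (lam * R) / besselI l (lam * R)) ≤ x * y := by
  have h1 := besselI_pos l (mul_pos hlam hR)
  have h2 := besselK_pos l (mul_pos hlam hR)
  have h3 := besselI_mul_le l hlam hr.1 hr.2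
  rw [show besselI l (lam * r) * x * (besselK l (lam * R) / besselI l (lam * R)) =
    (besselI l (lam * r) / besselI l (lam * R)) * (x * besselK l (lam * R)) by ring]
  refine (mul_le_of_le_one_left (by positivity) ((div_le_one h1).2 h3)).trans (by gcongr)

/-- A bound uniform in `r'`: for fixed `r > 0`, or `r` bounded away from `0`, the kernel can be
integrated against any `g` with `g r'²` integrable. -/
lemma abs_greenFun_le_besselK (hlam : 0 < lam) (hR : 0 < R) {r r' : ℝ} (hr : r ∈ Ioc 0 R)
    (hr' : r' ∈ Icc 0 R) :
    |greenFun lam R l r r'| ≤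
      4 * Real.pi * lam * (besselI l (lam * R) * besselK l (lam * r)) := by
  have h1 := besselI_pos l (mul_pos hlam hR)
  have h2 := besselK_pos l (mul_pos hlam hR)
  have h3 := besselI_nonneg l (mul_nonneg hlam.le hr.1.le)
  have h4 := besselI_nonneg l (mul_nonneg hlam.le hr'.1)
  have h5 : 0 < max r r' := lt_max_of_lt_left hr.1
  have h6 := besselI_nonneg l (mul_nonneg hlam.le (le_min hr.1.le hr'.1))
  have h7 := besselK_pos l (mul_pos hlam h5)
  have h8 := besselK_mul_le l hlam hr.1 (le_max_left r r')
  have h9 := besselI_mul_le l hlam (le_min hr.1.le hr'.1) ((min_le_left r r').trans hr.2)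
  have h10 := besselI_mul_le l hlam hr'.1 hr'.2
  have h11 := besselK_mul_le l hlam hr.1 hr.2
  refine abs_greenFun_le_of_bounds l hlam (by positivity) (by gcongr) (by positivity) ?_
  refine (besselI_mul_div_le l hlam hR h4 ⟨hr.1.le, hr.2⟩ h11).trans ?_
  have := h2.trans_le h11
  gcongr

/-- The complementary bound, uniform in `r` down to `r = 0`. By `exists_besselI_mul_besselK_mul_le`
it grows only like `1/r'`, which the weight `r'²` absorbs. -/
lemma abs_greenFun_le_besselI_mul_besselK (hlam : 0 < lam) (hR : 0 < R) {r r' : ℝ}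
    (hr : r ∈ Icc 0 R) (hr' : r' ∈ Ioc 0 R) :
    |greenFun lam R l r r'| ≤
      4 * Real.pi * lam * (besselI l (lam * r') * besselK l (lam * r')) := by
  have h1 := besselI_pos l (mul_pos hlam hR)
  have h2 := besselK_pos l (mul_pos hlam hR)
  have h3 := besselI_nonneg l (mul_nonneg hlam.le hr.1)
  have h4 := besselI_nonneg l (mul_nonneg hlam.le hr'.1.le)
  have h5 : 0 < max r r' := lt_max_of_lt_right hr'.1
  have h6 := besselI_nonneg l (mul_nonneg hlam.le (le_min hr.1 hr'.1.le))
  have h7 := besselK_pos l (mul_pos hlam h5)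
  have h8 := besselK_mul_le l hlam hr'.1 (le_max_right r r')
  have h9 := besselI_mul_le l hlam (le_min hr.1 hr'.1.le) (min_le_right r r')
  have h11 := besselK_mul_le l hlam hr'.1 hr'.2
  exact abs_greenFun_le_of_bounds l hlam (by positivity) (by gcongr) (by positivity)
    (besselI_mul_div_le l hlam hR h4 hr h11)

lemma exists_abs_greenFun_mul_sq_le (hlam : 0 < lam) (hR : 0 < R) :
    ∃ C, 0 ≤ C ∧ ∀ r ∈ Icc 0 R, ∀ r' ∈ Icc 0 R, |greenFun lam R l r r'| * r' ^ 2 ≤ C := by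
  obtain ⟨C, hC⟩ := exists_besselI_mul_besselK_mul_le l (lam * R)
  have hC0 : 0 ≤ C := by
    have h1 := besselI_pos l (mul_pos hlam hR)
    have h2 := besselK_pos l (mul_pos hlam hR)
    exact le_trans (by positivity) (hC (lam * R) ⟨by positivity, le_rfl⟩)
  have hp := Real.pi_pos
  refine ⟨4 * Real.pi * C * R, by positivity, fun r hr r' hr' => ?_⟩
  rcases hr'.1.eq_or_lt with rfl | h0
  · simp; positivity
  · have h1 := hC (lam * r') ⟨by positivity, by gcongr; exact hr'.2⟩
    have h2 := abs_greenFun_le_besselI_mul_besselK l hlam hR hr ⟨h0, hr'.2⟩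
    calc |greenFun lam R l r r'| * r' ^ 2
        ≤ 4 * Real.pi * lam * (besselI l (lam * r') * besselK l (lam * r')) * r' ^ 2 := by gcongr
      _ = 4 * Real.pi * (besselI l (lam * r') * besselK l (lam * r') * (lam * r')) * r' := by ring
      _ ≤ 4 * Real.pi * C * R := by gcongr; exact hr'.2

/-- The Green function solves `(Δ_r - λ²) G(·, r') = -(4π/r²) δ(r - r')` weakly. -/
lemma integral_greenFun_mul_radialOp (hlam : 0 < lam) {r' : ℝ} (hr' : r' ∈ Ioo 0 R) {η : ℝ → ℝ}
    (hη : IsRadialTest R η) :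
    ∫ r in (0 : ℝ)..R, greenFun lam R l r r' * radialOp lam l η r * r ^ 2 =
      -(4 * Real.pi) * η r' := by
  have hcont : Continuous fun r => greenFun lam R l r r' * radialOp lam l η r * r ^ 2 := by
    have h1 := hη.continuous_radialOp lam l
    have h2 : Continuous fun r => greenFun lam R l r r' := continuous_iff_continuousAt.2 fun r =>
      ContinuousAt.comp (f := fun r : ℝ => (r, r')) (continuousAt_greenFun l hlam
        (p := (r, r')) (lt_max_of_lt_right hr'.1)) (by fun_prop)
    fun_prop
  obtain ⟨hη, c, d, hc, hcd, hd, h⟩ := hη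
  -- Green's identity needs a positive left endpoint. Below `e` the test function vanishes, and `e <
  -- r'` puts `[0, e]` on one side of the diagonal.
  obtain ⟨e, he0, hec, her⟩ : ∃ e, 0 < e ∧ e < c ∧ e < r' :=
    ⟨min c r' / 2, by have := lt_min hc hr'.1; positivity,
      by have := lt_min hc hr'.1; have := min_le_left c r'; linarith,
      by have := lt_min hc hr'.1; have := min_le_right c r'; linarith⟩
  have hI := fun a b => hcont.intervalIntegrable (μ := volume) a b
  rw [← intervalIntegral.integral_add_adjacent_intervals (hI 0 e) (hI e R),
    ← intervalIntegral.integral_add_adjacent_intervals (hI e r') (hI r' R)]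
  have z0 : ∫ r in (0 : ℝ)..e, greenFun lam R l r r' * radialOp lam l η r * r ^ 2 = 0 := by
    refine (intervalIntegral.integral_congr fun r hr => ?_).trans intervalIntegral.integral_zero
    rw [uIcc_of_le he0.le] at hr
    have : radialOp lam l η r = 0 := radialOp_eq_zero_of_eq_zero h fun h' => by
      linarith [h'.1, hr.2]
    simp [this]
  have hne : ∀ {r}, 0 < r → lam * r ≠ 0 := fun hr => (mul_pos hlam hr).ne'
  set q := besselK l (lam * R) / besselI l (lam * R) with hq
  have z1 : ∫ r in e..r', greenFun lam R l r r' * radialOp lam l η r * r ^ 2 =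
      (4 * Real.pi * lam * (besselK l (lam * r') - besselI l (lam * r') * q)) *
      ∫ r in e..r', besselI l (lam * r) * radialOp lam l η r * r ^ 2 := by
    rw [← intervalIntegral.integral_const_mul]
    refine intervalIntegral.integral_congr fun r hr => ?_
    rw [uIcc_of_le her.le] at hr
    simp only [greenFun, min_eq_left hr.2, max_eq_right hr.2]
    ring
  have z2 : ∫ r in r'..R, greenFun lam R l r r' * radialOp lam l η r * r ^ 2 =
      (4 * Real.pi * lam * besselI l (lam * r')) *
      ∫ r in r'..R, (besselK l (lam * r) - besselI l (lam * r) * q) *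
        radialOp lam l η r * r ^ 2 := by
    rw [← intervalIntegral.integral_const_mul]
    refine intervalIntegral.integral_congr fun r hr => ?_
    rw [uIcc_of_le hr'.2.le] at hr
    simp only [greenFun, min_eq_right hr.1, max_eq_left hr.1]
    ring
  rw [z0, z1, z2,
    integral_mul_radialOp he0 her.le (fun r _ => hasDerivAt_besselI_mul lam l r)
      (fun r hr => hasDerivAt_besselIDeriv_mul l (hne (he0.trans_le hr.1))) hη,
    integral_mul_radialOp (f := fun r => besselK l (lam * r) - besselI l (lam * r) * q)
      (f' := fun r => lam * besselKDeriv l (lam * r) -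
      lam * besselIDeriv l (lam * r) * q) hr'.1 hr'.2.le
      (fun r hr => (hasDerivAt_besselK_mul l (hne (hr'.1.trans_le hr.1))).sub
        ((hasDerivAt_besselI_mul lam l r).mul_const q))
      (fun r hr => (((hasDerivAt_besselKDeriv_mul l (hne (hr'.1.trans_le hr.1))).sub
        ((hasDerivAt_besselIDeriv_mul l (hne (hr'.1.trans_le hr.1))).mul_const q)).congr_deriv
          (by ring))) hη,
    h R (fun h' => by linarith [h'.2]), h e (fun h' => by linarith [h'.1]),
    deriv_eq_zero_of_eq_zero h (r := R) (fun h' => by linarith [h'.2]),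
    deriv_eq_zero_of_eq_zero h (r := e) (fun h' => by linarith [h'.1])]
  -- The boundary terms at `e` and `R` are zero. At `r'` the terms with `η'` cancel because `G` is
  -- continuous across the diagonal, the multiples of `q` cancel as well, and the terms with `η r'`
  -- form the Wronskian.
  have hw := bessel_wronskian l (hne hr'.1)
  have hr0 := hr'.1.ne'
  have hw' : r' ^ 2 * lam ^ 2 * (besselI l (lam * r') * besselKDeriv l (lam * r') -
      besselIDeriv l (lam * r') * besselK l (lam * r')) = -1 := by
    rw [hw]; field_simp
  linear_combination 4 * Real.pi * η r' * hw'

end GreenFun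

/-! ### Weak solutions of the homogeneous radial equation -/

lemma IsRadialTest.continuous_mul {R : ℝ} {θ : ℝ → ℝ} (hθ : IsRadialTest R θ) {w : ℝ → ℝ}
    (hw : ContinuousOn w (Ioo 0 R)) : Continuous fun r => w r * θ r * r ^ 2 := by
  obtain ⟨hθ, c, d, hc, hcd, hd, h⟩ := hθ
  refine continuous_of_continuousOn_of_eq_zero hc hd ?_ fun r hr => ?_
  · have := hθ.continuous
    fun_prop
  · simp [h r fun h' => hr (Ioo_subset_Icc_self h')]

/-- The space of radial test functions. -/
def radialTestSpace (R : ℝ) (hR : 0 < R) : Submodule ℝ (ℝ → ℝ) where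
  carrier := {θ | IsRadialTest R θ}
  zero_mem' := ⟨contDiff_const, R / 3, R / 2, by positivity, by linarith, by linarith, by simp⟩
  add_mem' := by
    rintro θ ψ ⟨h1, c, d, hc, hcd, hd, h⟩ ⟨h1', c', d', hc', hcd', hd', h'⟩
    refine ⟨h1.add h1', min c c', max d d', lt_min hc hc',
      (min_le_left _ _).trans_lt (hcd.trans_le (le_max_left _ _)), max_lt hd hd', fun r hr => ?_⟩
    rw [Pi.add_apply, h r, h' r, add_zero]
    · exact fun hh => hr ⟨(min_le_right _ _).trans_lt hh.1, hh.2.trans_le (le_max_right _ _)⟩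
    · exact fun hh => hr ⟨(min_le_left _ _).trans_lt hh.1, hh.2.trans_le (le_max_left _ _)⟩
  smul_mem' := by
    rintro a θ ⟨h1, c, d, hc, hcd, hd, h⟩
    exact ⟨contDiff_const.smul h1, c, d, hc, hcd, hd, fun r hr => by simp [h r hr]⟩

/-- The functional `θ ↦ ∫₀^R w θ r² dr` on radial test functions. -/
noncomputable def radialPairing {R : ℝ} (hR : 0 < R) {w : ℝ → ℝ} (hw : ContinuousOn w (Ioo 0 R)) :
    radialTestSpace R hR →ₗ[ℝ] ℝ where
  toFun θ := ∫ r in (0 : ℝ)..R, w r * θ.1 r * r ^ 2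
  map_add' θ ψ := by
    rw [← intervalIntegral.integral_add
      ((IsRadialTest.continuous_mul θ.2 hw).intervalIntegrable _ _)
      ((IsRadialTest.continuous_mul ψ.2 hw).intervalIntegrable _ _)]
    refine intervalIntegral.integral_congr fun r _ => ?_
    simp only [Submodule.coe_add, Pi.add_apply]
    ring
  map_smul' a θ := by
    rw [RingHom.id_apply, smul_eq_mul, ← intervalIntegral.integral_const_mul]
    refine intervalIntegral.integral_congr fun r _ => ?_
    simp only [Submodule.coe_smul, Pi.smul_apply, smul_eq_mul]
    ring

lemma continuousOn_besselK_mul {lam R : ℝ} (hlam : 0 < lam) (l : ℕ) :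
    ContinuousOn (fun r => besselK l (lam * r)) (Ioo 0 R) := fun _ hr =>
  (contDiffAt_besselK_mul l (mul_pos hlam hr.1).ne').continuousAt.continuousWithinAt

lemma contDiff_of_hasDerivAt {A g : ℝ → ℝ} (h : ∀ r, HasDerivAt A (g r) r) (hg : ContDiff ℝ ∞ g) :
    ContDiff ℝ ∞ A := by
  rw [contDiff_infty_iff_deriv, show deriv A = g from funext fun r => (h r).deriv]
  exact ⟨fun r => (h r).differentiableAt, hg⟩

/-- To the left of the support the primitive from `0` is zero; to the right it equals the total
integral, which vanishes by assumption. So the primitive is again supported in the same interval. -/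
lemma exists_primitive {f : ℝ → ℝ} {c d R : ℝ} (hc : 0 < c) (hd : d < R) (hf : ContDiff ℝ ∞ f)
    (h : ∀ r, r ∉ Ioo c d → f r = 0) (h0 : ∫ r in (0 : ℝ)..R, f r = 0) :
    ∃ A : ℝ → ℝ, ContDiff ℝ ∞ A ∧ (∀ r, HasDerivAt A (f r) r) ∧ ∀ r, r ∉ Ioo c d → A r = 0 := by
  have hd1 : ∀ r, HasDerivAt (fun r => ∫ s in (0 : ℝ)..r, f s) (f r) r := fun r =>
    intervalIntegral.integral_hasDerivAt_right (hf.continuous.intervalIntegrable _ _)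
      (hf.continuous.stronglyMeasurableAtFilter _ _) hf.continuous.continuousAt
  refine ⟨_, contDiff_of_hasDerivAt hd1 hf, hd1, fun r hr => ?_⟩
  have hI := fun a b => hf.continuous.intervalIntegrable (μ := volume) a b
  by_cases hrc : r ≤ c
  · refine (intervalIntegral.integral_congr fun s hs => ?_).trans intervalIntegral.integral_zero
    refine h s fun h' => ?_
    have h2 := hs.2.trans (max_le hc.le hrc)
    linarith [h'.1]
  · have hrd : d ≤ r := by
      by_contra h'
      exact hr ⟨not_le.1 hrc, not_le.1 h'⟩
    have h3 := intervalIntegral.integral_interval_sub_left (hI 0 r) (hI 0 R)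
    rw [h0, sub_zero] at h3
    rw [h3]
    refine (intervalIntegral.integral_congr fun s hs => ?_).trans intervalIntegral.integral_zero
    refine h s fun h' => ?_
    have h2 := (le_min hd.le hrd).trans hs.1
    linarith [h'.2]

/-- Variation of parameters. -/
lemma exists_radialOp_eq {lam R : ℝ} (hlam : 0 < lam) (l : ℕ) {θ : ℝ → ℝ} (hθ : IsRadialTest R θ)
    (hI : ∫ r in (0 : ℝ)..R, besselI l (lam * r) * θ r * r ^ 2 = 0)
    (hK : ∫ r in (0 : ℝ)..R, besselK l (lam * r) * θ r * r ^ 2 = 0) :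
    ∃ χ, IsRadialTest R χ ∧ ∀ r ∈ Ioo 0 R, radialOp lam l χ r = θ r := by
  obtain ⟨hθ, c, d, hc, hcd, hd, h⟩ := hθ
  -- `k_ℓ(λr)` is smooth only for `r > 0`, but the factor `ψ` vanishes for `r < c`.
  have hsm : ∀ (w ψ : ℝ → ℝ), (∀ r, 0 < r → ContDiffAt ℝ ∞ w r) → ContDiff ℝ ∞ ψ →
      (∀ r, r ∉ Ioo c d → ψ r = 0) → ContDiff ℝ ∞ fun r => w r * ψ r := by
    intro w ψ hw hψ hz
    rw [contDiff_iff_contDiffAt]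
    intro r
    rcases lt_or_ge 0 r with hr | hr
    · exact (hw r hr).mul hψ.contDiffAt
    · have : (fun r => w r * ψ r) =ᶠ[nhds r] fun _ => 0 := by
        filter_upwards [Iio_mem_nhds (hr.trans_lt hc)] with s hs
        rw [hz s fun h' => (lt_asymm h'.1 hs), mul_zero]
      exact contDiffAt_const.congr_of_eventuallyEq this
  have hIs : ∀ r, 0 < r → ContDiffAt ℝ ∞ (fun r => besselI l (lam * r)) r := fun r _ =>
    ((contDiff_besselI l).comp (contDiff_const.mul contDiff_id)).contDiffAt
  have hKs : ∀ r, 0 < r → ContDiffAt ℝ ∞ (fun r => besselK l (lam * r)) r := fun r hr =>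
    contDiffAt_besselK_mul l (mul_pos hlam hr).ne'
  have hz2 : ∀ r, r ∉ Ioo c d → θ r * r ^ 2 = 0 := fun r hr => by rw [h r hr, zero_mul]
  obtain ⟨A, hA, hA', hAz⟩ := exists_primitive hc hd
    (hsm _ _ hIs (hθ.mul (contDiff_id.pow 2)) hz2) (fun r hr => by simp [h r hr])
    (by simpa only [mul_assoc, id] using hI)
  obtain ⟨B, hB, hB', hBz⟩ := exists_primitive hc hd
    (hsm _ _ hKs (hθ.mul (contDiff_id.pow 2)) hz2) (fun r hr => by simp [h r hr])
    (by simpa only [mul_assoc, id] using hK)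
  simp only [id] at hA' hB'
  -- With `A' = i_ℓ θ r²` and `B' = k_ℓ θ r²` the products `i_ℓ B'` and `k_ℓ A'` cancel in the first
  -- derivative. In the second derivative the Wronskian turns them into `θ`. The orthogonality
  -- conditions made `A` and `B` vanish outside `(c, d)`.
  refine ⟨fun r => lam * (besselI l (lam * r) * B r - besselK l (lam * r) * A r),
    ⟨contDiff_const.mul ((hsm _ _ hIs hB hBz).sub (hsm _ _ hKs hA hAz)), c, d, hc, hcd, hd,
      fun r hr => by simp [hAz r hr, hBz r hr]⟩, fun r hr => ?_⟩
  have hne : ∀ {r}, 0 < r → lam * r ≠ 0 := fun hr => (mul_pos hlam hr).ne'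
  have d1 : ∀ r, 0 < r → HasDerivAt
      (fun r => lam * (besselI l (lam * r) * B r - besselK l (lam * r) * A r))
      (lam * (lam * besselIDeriv l (lam * r) * B r - lam * besselKDeriv l (lam * r) * A r)) r := by
    intro r hr
    refine ((((hasDerivAt_besselI_mul lam l r).mul (hB' r)).sub
      ((hasDerivAt_besselK_mul l (hne hr)).mul (hA' r))).const_mul lam).congr_deriv ?_
    ring
  have d2 := (((hasDerivAt_besselIDeriv_mul l (hne hr.1)).mul (hB' r)).sub
      ((hasDerivAt_besselKDeriv_mul l (hne hr.1)).mul (hA' r))).const_mul lam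
  have e1 : deriv (fun r => lam * (besselI l (lam * r) * B r - besselK l (lam * r) * A r))
      =ᶠ[nhds r] fun r =>
        lam * (lam * besselIDeriv l (lam * r) * B r - lam * besselKDeriv l (lam * r) * A r) := by
    filter_upwards [Ioi_mem_nhds hr.1] with s hs using (d1 s hs).deriv
  rw [radialOp, e1.deriv_eq, (d1 r hr.1).deriv]
  have e2 := d2.deriv
  simp only [Pi.sub_def, Pi.mul_def] at e2
  rw [e2]
  have hw := bessel_wronskian l (hne hr.1)
  have hr0 := hr.1.ne'
  have hw' : r ^ 2 * lam ^ 2 * (besselI l (lam * r) * besselKDeriv l (lam * r) -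
      besselIDeriv l (lam * r) * besselK l (lam * r)) = -1 := by
    rw [hw]; field_simp
  linear_combination -θ r * hw'

/-- By `exists_radialOp_eq`, the functional `θ ↦ ∫ w θ r²` vanishes wherever the functionals given
by `i_ℓ` and `k_ℓ` both vanish. A linear functional vanishing on the intersection of finitely many
kernels is a linear combination of the corresponding functionals, so no topology on the test space
is needed. The fundamental lemma of the calculus of variations and continuity then give the identity
pointwise. -/
lemma exists_eq_besselI_add_besselK {lam R : ℝ} (hlam : 0 < lam) (hR : 0 < R) (l : ℕ) {w : ℝ → ℝ}
    (hw : ContinuousOn w (Ioo 0 R))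
    (h : ∀ η, IsRadialTest R η → ∫ r in (0 : ℝ)..R, w r * radialOp lam l η r * r ^ 2 = 0) :
    ∃ a b : ℝ, ∀ r ∈ Ioo 0 R, w r = a * besselI l (lam * r) + b * besselK l (lam * r) := by
  have hI : ContinuousOn (fun r => besselI l (lam * r)) (Ioo 0 R) :=
    (continuous_besselI_mul lam l).continuousOn
  have hK := continuousOn_besselK_mul (R := R) hlam l
  have key : radialPairing hR hw ∈
      Submodule.span ℝ (range ![radialPairing hR hI, radialPairing hR hK]) := by
    refine mem_span_of_iInf_ker_le_ker fun θ hθ => ?_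
    simp only [Submodule.mem_iInf, LinearMap.mem_ker, Fin.forall_fin_two, Matrix.cons_val_zero,
      Matrix.cons_val_one] at hθ
    obtain ⟨χ, hχ, he⟩ := exists_radialOp_eq hlam l θ.2 hθ.1 hθ.2
    rw [LinearMap.mem_ker, ← h χ hχ]
    refine intervalIntegral.integral_congr_ae ?_
    -- The equation for `χ` is known only on the open interval, so the endpoint `R` is discarded as
    -- a null set.
    have : ∀ᵐ r : ℝ, r ≠ R := by simp [ae_iff]
    filter_upwards [this] with r hr hr'
    rw [uIoc_of_le hR.le] at hr'
    rw [he r ⟨hr'.1, lt_of_le_of_ne hr'.2 hr⟩]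
  rw [Matrix.range_cons, Matrix.range_cons, Matrix.range_empty, union_empty, singleton_union,
    Submodule.mem_span_pair] at key
  obtain ⟨a, b, hab⟩ := key
  refine ⟨a, b, fun r hr => ?_⟩
  have hcont : ContinuousOn
      (fun r => (w r - (a * besselI l (lam * r) + b * besselK l (lam * r))) * r ^ 2) (Ioo 0 R) := by
    fun_prop
  have hae := isOpen_Ioo.ae_eq_zero_of_integral_contDiff_smul_eq_zero (μ := volume)
    (hcont.locallyIntegrableOn measurableSet_Ioo) fun g hg1 hg2 hg3 => by
      have hg := isRadialTest_of_tsupport hR hg1 hg2 hg3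
      have h1 := LinearMap.congr_fun hab (⟨g, hg⟩ : radialTestSpace R hR)
      simp only [LinearMap.add_apply, LinearMap.smul_apply, smul_eq_mul] at h1
      change a * (∫ r in (0 : ℝ)..R, _) + b * (∫ r in (0 : ℝ)..R, _) = ∫ r in (0 : ℝ)..R, _ at h1
      simp only at h1
      have i1 := (hg.continuous_mul hI).intervalIntegrable (μ := volume) 0 R
      have i2 := (hg.continuous_mul hK).intervalIntegrable (μ := volume) 0 R
      have i3 := (hg.continuous_mul hw).intervalIntegrable (μ := volume) 0 R
      rw [← intervalIntegral.integral_const_mul, ← intervalIntegral.integral_const_mul,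
        ← intervalIntegral.integral_add (i1.const_mul _) (i2.const_mul _), eq_comm, ← sub_eq_zero,
        ← intervalIntegral.integral_sub i3 ((i1.const_mul _).add (i2.const_mul _))] at h1
      rw [← h1, intervalIntegral.integral_of_le hR.le, ← setIntegral_eq_integral_of_forall_compl_eq_zero
        (s := Ioc 0 R)]
      · refine setIntegral_congr_fun measurableSet_Ioc fun r _ => ?_
        simp only [smul_eq_mul]
        ring
      · intro x hx
        rw [image_eq_zero_of_notMem_tsupport fun h' => hx (Ioo_subset_Ioc_self (hg3 h')), zero_smul]
  have hz := Measure.eqOn_open_of_ae_eq (U := Ioo 0 R) (μ := volume) (g := fun _ => (0 : ℝ))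
    ((ae_restrict_iff' measurableSet_Ioo).2 hae) isOpen_Ioo hcont continuousOn_const hr
  have hr2 : r ^ 2 ≠ 0 := pow_ne_zero 2 hr.1.ne'
  exact sub_eq_zero.1 ((mul_eq_zero.1 hz).resolve_right hr2)

lemma tendsto_besselK_mul_nhdsGT_zero {lam : ℝ} (hlam : 0 < lam) (l : ℕ) :
    Filter.Tendsto (fun r => besselK l (lam * r)) (nhdsWithin 0 (Ioi 0)) Filter.atTop := by
  refine (tendsto_besselK_nhdsGT_zero l).comp (tendsto_nhdsWithin_iff.2 ⟨?_, ?_⟩)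
  · have : Filter.Tendsto (fun r : ℝ => lam * r) (nhds 0) (nhds (lam * 0)) :=
      (continuous_const.mul continuous_id).tendsto 0
    rw [mul_zero] at this
    exact this.mono_left nhdsWithin_le_nhds
  · filter_upwards [self_mem_nhdsWithin] with r hr using mul_pos hlam hr

/-- A weak solution of the homogeneous equation which is `o(k_ℓ(λr))` at `0` and vanishes at `R`
is zero. -/
lemma eq_zero_of_weak_homogeneous {lam R : ℝ} (hlam : 0 < lam) (hR : 0 < R) (l : ℕ) {w : ℝ → ℝ}
    (hw : ContinuousOn w (Ioc 0 R)) (hwR : w R = 0)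
    (hw0 : Filter.Tendsto (fun r => w r / besselK l (lam * r)) (nhdsWithin 0 (Ioi 0)) (nhds 0))
    (h : ∀ η, IsRadialTest R η → ∫ r in (0 : ℝ)..R, w r * radialOp lam l η r * r ^ 2 = 0) :
    ∀ r ∈ Ioc 0 R, w r = 0 := by
  obtain ⟨a, b, hab⟩ := exists_eq_besselI_add_besselK hlam hR l (hw.mono Ioo_subset_Ioc_self) h
  -- Divided by `k_ℓ`, the `i_ℓ` part tends to `0` at the origin, so `b` is the limit of `w / k_ℓ`.
  have hb : b = 0 := by
    have h1 : Filter.Tendsto (fun r => a * (besselI l (lam * r) / besselK l (lam * r)) + b)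
        (nhdsWithin 0 (Ioi 0)) (nhds (a * 0 + b)) := by
      refine (Filter.Tendsto.const_mul a ?_).add_const b
      exact (((continuous_besselI_mul lam l).tendsto 0).mono_left
        nhdsWithin_le_nhds).div_atTop (tendsto_besselK_mul_nhdsGT_zero hlam l)
    have h2 := tendsto_nhds_unique (hw0.congr' ?_) h1
    · simpa using h2.symm
    · filter_upwards [Ioo_mem_nhdsGT hR] with r hr
      have := (besselK_pos l (mul_pos hlam hr.1)).ne'
      rw [hab r hr]
      field_simp
  have ha : a = 0 := by
    have h1 : Filter.Tendsto w (nhdsWithin R (Iio R)) (nhds (w R)) :=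
      (hw R ⟨hR, le_rfl⟩).mono_of_mem_nhdsWithin (Ioc_mem_nhdsLT hR)
    have h2 : Filter.Tendsto (fun r => a * besselI l (lam * r)) (nhdsWithin R (Iio R))
        (nhds (a * besselI l (lam * R))) :=
      ((continuous_const.mul (continuous_besselI_mul lam l)).tendsto R).mono_left nhdsWithin_le_nhds
    have h3 := tendsto_nhds_unique (h1.congr' ?_) h2
    · rw [hwR] at h3
      exact (mul_eq_zero.1 h3.symm).resolve_right (besselI_pos l (mul_pos hlam hR)).ne'
    · filter_upwards [Ioo_mem_nhdsLT hR] with r hr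
      rw [hab r hr, hb, zero_mul, add_zero]
  intro r hr
  rcases hr.2.eq_or_lt with rfl | hlt
  · exact hwR
  · rw [hab r ⟨hr.1, hlt⟩, ha, hb]; ring

lemma tendsto_div_besselK_of_continuousOn {lam R : ℝ} (hlam : 0 < lam) (hR : 0 < R) (l : ℕ)
    {w : ℝ → ℝ} (hw : ContinuousOn w (Icc 0 R)) :
    Filter.Tendsto (fun r => w r / besselK l (lam * r)) (nhdsWithin 0 (Ioi 0)) (nhds 0) :=
  Filter.Tendsto.div_atTop
    ((hw 0 ⟨le_rfl, hR.le⟩).mono_of_mem_nhdsWithin (Icc_mem_nhdsGT hR))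
    (tendsto_besselK_mul_nhdsGT_zero hlam l)

/-! ### Characterisation of the Green function -/

/-- No condition sees the corner `(0,0)`: it is removed from both domains of regularity, `R > 0`
keeps it off the boundary, and the equation concerns `r' > 0`. -/
lemma IsRadialDirichletGreen.congr {lam R : ℝ} {l : ℕ} {G H : ℝ → ℝ → ℝ}
    (hH : IsRadialDirichletGreen lam R l H)
    (hR : 0 < R) (h : ∀ r ∈ Icc 0 R, ∀ r' ∈ Icc 0 R, (r, r') ≠ (0, 0) → G r r' = H r r') : IsRadialDirichletGreen lam R l G where
  continuousOn := hH.continuousOn.congr fun p hp => h _ hp.1.1 _ hp.1.2 fun h' => hp.2 h'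
  contDiffOn := hH.contDiffOn.congr fun p hp => h _ hp.1.1 _ hp.1.2 fun h' => hp.2 <| by
    have := Prod.mk.inj h'
    exact this.1.trans this.2.symm
  boundary r hr r' hr' hb := by
    have h0 : (r, r') ≠ (0, 0) := fun h0 => by
      obtain ⟨rfl, rfl⟩ := Prod.mk.inj h0
      exact hb.elim hR.ne hR.ne
    rw [h r hr r' hr' h0, hH.boundary r hr r' hr' hb]
  equation r' hr' η h1 h2 h3 := by
    rw [← hH.equation r' hr' η h1 h2 h3]
    refine intervalIntegral.integral_congr fun r hr => ?_
    rw [uIcc_of_le hR.le] at hr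
    rw [h r hr r' (Ioo_subset_Icc_self hr') fun h' => hr'.1.ne' (Prod.mk.inj h').2]

lemma two_le_infty : (2 : WithTop ℕ∞) ≤ ∞ := by
  exact ENat.LEInfty.out

lemma isRadialDirichletGreen_greenFun {lam R : ℝ} (hlam : 0 < lam) (hR : 0 < R) (l : ℕ) :
    IsRadialDirichletGreen lam R l (greenFun lam R l) where
  continuousOn := by
    rintro ⟨r, r'⟩ ⟨⟨hr, hr'⟩, hne⟩
    refine (continuousAt_greenFun l hlam ?_).continuousWithinAt
    by_contra h
    have h1 := not_lt.1 h
    exact hne (Prod.ext (le_antisymm ((le_max_left _ _).trans h1) hr.1)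
      (le_antisymm ((le_max_right _ _).trans h1) hr'.1))
  contDiffOn := by
    have hI := (contDiff_besselI l).of_le (m := 2) two_le_infty
    have hK : ∀ x : ℝ, x ≠ 0 → ContDiffAt ℝ 2 (besselK l) x := fun x hx =>
      (contDiffAt_besselK l hx).of_le two_le_infty
    -- This is the formula for the triangle `r < r'`, smooth wherever the second coordinate is
    -- positive; the other triangle follows by symmetry. In `r < r'` with `0 ≤ r` that coordinate is
    -- indeed positive.
    have hsm : ∀ p : ℝ × ℝ, 0 < p.2 → ContDiffAt ℝ 2 (fun p : ℝ × ℝ => 4 * Real.pi * lam *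
        (besselI l (lam * p.1) * besselK l (lam * p.2) - besselI l (lam * p.1) *
          besselI l (lam * p.2) * (besselK l (lam * R) / besselI l (lam * R)))) p := by
      intro p hp
      have h1 : ContDiffAt ℝ 2 (fun p : ℝ × ℝ => besselI l (lam * p.1)) p :=
        (hI.comp (contDiff_const.mul contDiff_fst)).contDiffAt
      have h2 : ContDiffAt ℝ 2 (fun p : ℝ × ℝ => besselI l (lam * p.2)) p :=
        (hI.comp (contDiff_const.mul contDiff_snd)).contDiffAt
      have h3 : ContDiffAt ℝ 2 (fun p : ℝ × ℝ => besselK l (lam * p.2)) p :=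
        (hK _ (mul_pos hlam hp).ne').comp p (contDiffAt_const.mul contDiffAt_snd)
      exact contDiffAt_const.mul ((h1.mul h3).sub ((h1.mul h2).mul contDiffAt_const))
    rintro ⟨r, r'⟩ ⟨⟨hr, hr'⟩, hne⟩
    refine ContDiffAt.contDiffWithinAt ?_
    rcases lt_or_gt_of_ne (show r ≠ r' from hne) with h | h
    · refine (hsm (r, r') (hr.1.trans_lt h)).congr_of_eventuallyEq ?_
      filter_upwards [(isOpen_lt continuous_fst continuous_snd).mem_nhds
        (show (r, r') ∈ {p : ℝ × ℝ | p.1 < p.2} from h)] with p hp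
      rw [greenFun, min_eq_left (le_of_lt hp), max_eq_right (le_of_lt hp)]
    · refine (ContDiffAt.comp (f := fun p : ℝ × ℝ => (p.2, p.1)) (r, r')
        (hsm (r', r) (hr'.1.trans_lt h))
        (contDiff_snd.prodMk contDiff_fst).contDiffAt).congr_of_eventuallyEq ?_
      filter_upwards [(isOpen_lt continuous_snd continuous_fst).mem_nhds
        (show (r, r') ∈ {p : ℝ × ℝ | p.2 < p.1} from h)] with p hp
      rw [greenFun_comm, greenFun, min_eq_left (le_of_lt hp), max_eq_right (le_of_lt hp)]
      rfl
  boundary r hr r' hr' h := by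
    rcases h with rfl | rfl
    · exact greenFun_left_boundary l hlam hR hr'.2
    · exact greenFun_right_boundary l hlam hR hr.2
  equation r' hr' η h1 h2 h3 :=
    integral_greenFun_mul_radialOp l hlam hr' (isRadialTest_of_tsupport hR h1 h2 h3)

/-- For fixed `r'` the point sources cancel in the difference, which is continuous on `[0, R]`,
vanishes at `R` and solves the homogeneous equation weakly. Continuity adds the point `r = 0`. -/
lemma IsRadialDirichletGreen.eq_of_mem_Ioo {lam R : ℝ} (hlam : 0 < lam) (hR : 0 < R) {l : ℕ}
    {G H : ℝ → ℝ → ℝ} (hG : IsRadialDirichletGreen lam R l G)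
    (hH : IsRadialDirichletGreen lam R l H) {r r' : ℝ} (hr : r ∈ Icc 0 R) (hr' : r' ∈ Ioo 0 R) :
    G r r' = H r r' := by
  have hc : ∀ {F : ℝ → ℝ → ℝ}, IsRadialDirichletGreen lam R l F →
      ContinuousOn (fun r => F r r') (Icc 0 R) := fun {F} hF => by
    refine hF.continuousOn.comp (f := fun r : ℝ => (r, r')) (by fun_prop) fun r hr => ?_
    exact ⟨⟨hr, Ioo_subset_Icc_self hr'⟩, fun h => hr'.1.ne' (Prod.mk.inj h).2⟩
  have hw : ContinuousOn (fun r => G r r' - H r r') (Icc 0 R) := (hc hG).sub (hc hH)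
  have hz : ∀ r ∈ Ioc 0 R, G r r' - H r r' = 0 := by
    refine eq_zero_of_weak_homogeneous (w := fun r => G r r' - H r r') hlam hR l
      (hw.mono Ioc_subset_Icc_self) ?_
      (tendsto_div_besselK_of_continuousOn hlam hR l hw) fun η hη => ?_
    · have hRm : R ∈ Icc 0 R := ⟨hR.le, le_rfl⟩
      rw [hG.boundary R hRm r' (Ioo_subset_Icc_self hr') (.inl rfl),
        hH.boundary R hRm r' (Ioo_subset_Icc_self hr') (.inl rfl), sub_zero]
    · have hi : ∀ {F : ℝ → ℝ → ℝ}, IsRadialDirichletGreen lam R l F → IntervalIntegrable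
          (fun r => F r r' * radialOp lam l η r * r ^ 2) volume 0 R := fun {F} hF => by
        refine ContinuousOn.intervalIntegrable ?_
        rw [uIcc_of_le hR.le]
        have h1 := hc hF
        have h2 := hη.continuous_radialOp lam l
        fun_prop
      have h1 := hG.equation r' hr' η hη.1 hη.hasCompactSupport hη.tsupport_subset
      have h2 := hH.equation r' hr' η hη.1 hη.hasCompactSupport hη.tsupport_subset
      refine Eq.trans ?_ (sub_eq_zero.2 (h1.trans h2.symm))
      rw [← intervalIntegral.integral_sub (hi hG) (hi hH)]
      exact intervalIntegral.integral_congr fun r _ => by simp only [sub_mul]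
  refine EqOn.of_subset_closure (s := Ioc 0 R) (fun r hr => sub_eq_zero.1 (hz r hr)) (hc hG) (hc hH)
    Ioc_subset_Icc_self (by rw [closure_Ioc hR.ne]) hr

/-- The equation determines `G` only for `0 < r' < R`. For `r > 0` the values at `r' = 0` and `r' =
R` follow by continuity in `r'`; for `r = 0` the remaining case `r' = R` is the boundary condition.
-/
lemma isRadialDirichletGreen_iff {lam R : ℝ} (hlam : 0 < lam) (hR : 0 < R) (l : ℕ)
    (G : ℝ → ℝ → ℝ) :
    IsRadialDirichletGreen lam R l G ↔
      ∀ r ∈ Icc 0 R, ∀ r' ∈ Icc 0 R, (r, r') ≠ (0, 0) → G r r' = greenFun lam R l r r' := by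
  have hgr := isRadialDirichletGreen_greenFun hlam hR l
  refine ⟨fun hG r hr r' hr' hne => ?_, fun h => hgr.congr hR h⟩
  rcases hr.1.eq_or_lt with rfl | hr0
  · have hr'0 : 0 < r' := lt_of_le_of_ne hr'.1 fun h => hne (by rw [h])
    rcases hr'.2.eq_or_lt with rfl | hr'R
    · rw [hG.boundary _ hr _ hr' (.inr rfl), hgr.boundary _ hr _ hr' (.inr rfl)]
    · exact hG.eq_of_mem_Ioo hlam hR hgr hr ⟨hr'0, hr'R⟩
  · have hc : ∀ {F : ℝ → ℝ → ℝ}, IsRadialDirichletGreen lam R l F →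
        ContinuousOn (fun r' => F r r') (Icc 0 R) := fun {F} hF => by
      refine hF.continuousOn.comp (f := fun r' : ℝ => (r, r')) (by fun_prop) fun r' hr' => ?_
      exact ⟨⟨hr, hr'⟩, fun h => hr0.ne' (Prod.mk.inj h).1⟩
    exact EqOn.of_subset_closure (s := Ioo 0 R)
      (fun r' hr' => hG.eq_of_mem_Ioo hlam hR hgr hr hr') (hc hG) (hc hgr) Ioo_subset_Icc_self
      (by rw [closure_Ioo hR.ne]) hr'


/-! ### Representation of weak radial solutions -/

/-- `u` solves `(Δ_r - λ²) u = -4π g` on `(0, R)`, tested against radial test functions. -/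
def IsWeakRadialSolution (lam R : ℝ) (l : ℕ) (u g : ℝ → ℂ) : Prop :=
  ∀ η, IsRadialTest R η → ∫ r in (0 : ℝ)..R, (radialOp lam l η r * r ^ 2) • u r =
    -(4 * Real.pi) • ∫ r in (0 : ℝ)..R, (η r * r ^ 2) • g r

section Potential

variable {lam R : ℝ} (l : ℕ) {g : ℝ → ℂ}

lemma integral_besselI_mul_radialOp {η : ℝ → ℝ} (hlam : 0 < lam) (hη : IsRadialTest R η) :
    ∫ r in (0 : ℝ)..R, besselI l (lam * r) * radialOp lam l η r * r ^ 2 = 0 := by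
  have hcont : Continuous fun r => besselI l (lam * r) * radialOp lam l η r * r ^ 2 := by
    have h1 := hη.continuous_radialOp lam l
    have h2 := continuous_besselI_mul lam l
    fun_prop
  obtain ⟨hη, c, d, hc, hcd, hd, h⟩ := hη
  have hI := fun a b => hcont.intervalIntegrable (μ := volume) a b
  have hc2 : 0 < c / 2 := by positivity
  have z0 : ∫ r in (0 : ℝ)..(c / 2), besselI l (lam * r) * radialOp lam l η r * r ^ 2 = 0 := by
    refine (intervalIntegral.integral_congr fun r hr => ?_).trans intervalIntegral.integral_zero
    rw [uIcc_of_le hc2.le] at hr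
    have : radialOp lam l η r = 0 := radialOp_eq_zero_of_eq_zero h fun h' => by
      linarith [h'.1, hr.2]
    simp [this]
  rw [← intervalIntegral.integral_add_adjacent_intervals (hI 0 (c / 2)) (hI (c / 2) R), z0,
    integral_mul_radialOp hc2 (by linarith) (fun r _ => hasDerivAt_besselI_mul lam l r)
      (fun r hr => hasDerivAt_besselIDeriv_mul l (mul_pos hlam (hc2.trans_le hr.1)).ne') hη,
    h R (fun h' => by linarith [h'.2]), h (c / 2) (fun h' => by linarith [h'.1]),
    deriv_eq_zero_of_eq_zero h (r := R) (fun h' => by linarith [h'.2]),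
    deriv_eq_zero_of_eq_zero h (r := c / 2) (fun h' => by linarith [h'.1])]
  ring

lemma norm_greenFun_mul (r r' : ℝ) : ‖(greenFun lam R l r r' : ℂ) * g r' * (r' : ℂ) ^ 2‖ =
    |greenFun lam R l r r'| * ‖g r' * (r' : ℂ) ^ 2‖ := by
  rw [mul_assoc, norm_mul, Complex.norm_real, Real.norm_eq_abs]

lemma aestronglyMeasurable_greenFun_mul
    (hg : IntervalIntegrable (fun r' => g r' * (r' : ℂ) ^ 2) volume 0 R) (r : ℝ) :
    AEStronglyMeasurable (fun r' => (greenFun lam R l r r' : ℂ) * g r' * (r' : ℂ) ^ 2)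
      (volume.restrict (Ioc 0 R)) := by
  simp only [mul_assoc]
  refine AEStronglyMeasurable.mul ?_ hg.1.aestronglyMeasurable
  exact (Complex.measurable_ofReal.comp ((measurable_greenFun l).comp
    (measurable_const.prodMk measurable_id))).aestronglyMeasurable

lemma intervalIntegrable_greenFun_mul (hlam : 0 < lam) (hR : 0 < R)
    (hg : IntervalIntegrable (fun r' => g r' * (r' : ℂ) ^ 2) volume 0 R) {r : ℝ}
    (hr : r ∈ Ioc 0 R) : IntervalIntegrable
      (fun r' => (greenFun lam R l r r' : ℂ) * g r' * (r' : ℂ) ^ 2) volume 0 R := by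
  rw [intervalIntegrable_iff_integrableOn_Ioc_of_le hR.le]
  refine (hg.1.norm.const_mul (4 * Real.pi * lam * (besselI l (lam * R) *
    besselK l (lam * r)))).mono' (aestronglyMeasurable_greenFun_mul l hg r) ?_
  filter_upwards [ae_restrict_mem measurableSet_Ioc] with r' hr'
  rw [norm_greenFun_mul]
  exact mul_le_mul_of_nonneg_right
    (abs_greenFun_le_besselK l hlam hR hr (Ioc_subset_Icc_self hr')) (norm_nonneg _)

lemma continuousOn_integral_greenFun_mul (hlam : 0 < lam) (hR : 0 < R)
    (hg : IntervalIntegrable (fun r' => g r' * (r' : ℂ) ^ 2) volume 0 R) :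
    ContinuousOn (fun r => ∫ r' in (0 : ℝ)..R,
      (greenFun lam R l r r' : ℂ) * g r' * (r' : ℂ) ^ 2) (Ioc 0 R) := by
  intro r hr
  -- Near `r` only radii above `r/2` matter, where `k_ℓ(λr/2)` gives a common dominating factor.
  have hr2 : 0 < r / 2 := half_pos hr.1
  refine intervalIntegral.continuousWithinAt_of_dominated_interval
    (bound := fun r' => (4 * Real.pi * lam * (besselI l (lam * R) *
      besselK l (lam * (r / 2)))) * ‖g r' * (r' : ℂ) ^ 2‖) ?_ ?_ (hg.norm.const_mul _) ?_
  · rw [uIoc_of_le hR.le]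
    exact .of_forall fun s => aestronglyMeasurable_greenFun_mul l hg s
  · filter_upwards [self_mem_nhdsWithin, mem_nhdsWithin_of_mem_nhds
      (Ioi_mem_nhds (half_lt_self hr.1))] with s hs hs2
    refine .of_forall fun r' hr' => ?_
    rw [uIoc_of_le hR.le] at hr'
    rw [norm_greenFun_mul]
    refine mul_le_mul_of_nonneg_right
      ((abs_greenFun_le_besselK l hlam hR hs (Ioc_subset_Icc_self hr')).trans ?_) (norm_nonneg _)
    have h1 := besselI_pos l (mul_pos hlam hR)
    have h2 := besselK_mul_le l hlam hr2 (le_of_lt hs2)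
    have := Real.pi_pos
    gcongr
  · refine .of_forall fun r' hr' => ContinuousAt.continuousWithinAt ?_
    rw [uIoc_of_le hR.le] at hr'
    have h1 : ContinuousAt (fun s => greenFun lam R l s r') r :=
      ContinuousAt.comp (f := fun s : ℝ => (s, r')) (continuousAt_greenFun l hlam
        (p := (r, r')) (lt_max_of_lt_right hr'.1)) (by fun_prop)
    have h2 := Complex.continuous_ofReal.continuousAt.comp h1
    exact (h2.mul continuousAt_const).mul continuousAt_const

/-- For `r' > 0` the kernel has a finite limit as `r → 0` while `k_ℓ(λr) → ∞`, and the quotient is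
bounded by a constant, so dominated convergence applies. For a merely integrable density this
replaces boundedness of the potential at the centre and suffices to exclude a `k_ℓ` component. -/
lemma tendsto_integral_greenFun_mul_div_besselK (hlam : 0 < lam) (hR : 0 < R)
    (hg : IntervalIntegrable (fun r' => g r' * (r' : ℂ) ^ 2) volume 0 R) :
    Filter.Tendsto (fun r => (besselK l (lam * r))⁻¹ • ∫ r' in (0 : ℝ)..R,
      (greenFun lam R l r r' : ℂ) * g r' * (r' : ℂ) ^ 2) (nhdsWithin 0 (Ioi 0)) (nhds 0) := by
  simp only [← intervalIntegral.integral_smul]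
  have h0 : (0 : ℂ) = ∫ _ in (0 : ℝ)..R, (0 : ℂ) := by simp
  rw [h0]
  refine intervalIntegral.tendsto_integral_filter_of_dominated_convergence
    (bound := fun r' => (4 * Real.pi * lam * besselI l (lam * R)) * ‖g r' * (r' : ℂ) ^ 2‖)
    ?_ ?_ (hg.norm.const_mul _) ?_
  · rw [uIoc_of_le hR.le]
    exact .of_forall fun s => (aestronglyMeasurable_greenFun_mul l hg s).const_smul _
  · filter_upwards [Ioo_mem_nhdsGT hR] with s hs
    refine .of_forall fun r' hr' => ?_
    rw [uIoc_of_le hR.le] at hr'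
    have h1 := besselK_pos l (mul_pos hlam hs.1)
    rw [norm_smul, norm_greenFun_mul, norm_inv, Real.norm_eq_abs, abs_of_pos h1, ← mul_assoc]
    refine mul_le_mul_of_nonneg_right ?_ (norm_nonneg _)
    rw [inv_mul_le_iff₀ h1]
    refine (abs_greenFun_le_besselK l hlam hR ⟨hs.1, hs.2.le⟩
      (Ioc_subset_Icc_self hr')).trans (le_of_eq (by ring))
  · refine .of_forall fun r' hr' => ?_
    rw [uIoc_of_le hR.le] at hr'
    have h1 : ContinuousAt (fun s => greenFun lam R l s r') 0 :=
      ContinuousAt.comp (f := fun s : ℝ => (s, r')) (continuousAt_greenFun l hlam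
        (p := (0, r')) (lt_max_of_lt_right hr'.1)) (by fun_prop)
    have h2 := (h1.tendsto.mono_left (nhdsWithin_le_nhds (s := Ioi 0))).div_atTop
      (tendsto_besselK_mul_nhdsGT_zero hlam l)
    have h3 := ((Complex.continuous_ofReal.tendsto 0).comp h2).mul_const (g r' * (r' : ℂ) ^ 2)
    rw [Complex.ofReal_zero, zero_mul] at h3
    refine h3.congr fun s => ?_
    simp only [Function.comp, Complex.real_smul]
    push_cast
    ring

/-- Fubini moves the test function onto the kernel, where the equation for `G(·, r')` applies for
almost every `r'`. -/
lemma isWeakRadialSolution_integral_greenFun (hlam : 0 < lam) (hR : 0 < R)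
    (hg : IntervalIntegrable (fun r' => g r' * (r' : ℂ) ^ 2) volume 0 R) :
    IsWeakRadialSolution lam R l (fun r => ∫ r' in (0 : ℝ)..R,
      (greenFun lam R l r r' : ℂ) * g r' * (r' : ℂ) ^ 2) g := by
  intro η hη
  have hcont := hη.continuous_radialOp lam l
  obtain ⟨c, d, hc, hcd, hd, h⟩ := hη.2
  set μ := volume.restrict (Ioc 0 R) with hμ
  have hg' : Integrable (fun r' => g r' * (r' : ℂ) ^ 2) μ := hg.1
  have hF : Integrable (Function.uncurry fun r r' =>
      ((radialOp lam l η r * r ^ 2 * greenFun lam R l r r' : ℝ) : ℂ) *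
        (g r' * (r' : ℂ) ^ 2)) (μ.prod μ) := by
    obtain ⟨M, hM⟩ := (isCompact_Icc (a := (0 : ℝ)) (b := R)).exists_bound_of_continuousOn
      (f := fun r => radialOp lam l η r * r ^ 2) (by fun_prop)
    have hbase : Integrable (fun p : ℝ × ℝ => g p.2 * (p.2 : ℂ) ^ 2) (μ.prod μ) := by
      have := Integrable.mul_prod (integrable_const (1 : ℂ) (μ := μ)) hg'
      simpa using this
    refine hbase.bdd_mul (c := M * (4 * Real.pi * lam * (besselI l (lam * R) *
      besselK l (lam * c)))) ?_ ?_
    · refine (Complex.measurable_ofReal.comp (Measurable.mul ?_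
        (measurable_greenFun l))).aestronglyMeasurable
      have := hcont.measurable
      fun_prop
    · rw [hμ, Measure.prod_restrict]
      filter_upwards [ae_restrict_mem (measurableSet_Ioc.prod measurableSet_Ioc)] with p hp
      have hM' := hM p.1 (Ioc_subset_Icc_self hp.1)
      have h1 := besselI_pos l (mul_pos hlam hR)
      have h2 := besselK_pos l (mul_pos hlam hc)
      have := Real.pi_pos
      have hM0 := (norm_nonneg _).trans hM'
      rw [Complex.norm_real, norm_mul]
      -- For `r ≥ c` the kernel is bounded through `k_ℓ(λc)`; for `r < c` the test function
      -- vanishes.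
      by_cases hpc : c ≤ p.1
      · refine mul_le_mul hM' ?_ (norm_nonneg _) hM0
        refine (abs_greenFun_le_besselK l hlam hR hp.1 (Ioc_subset_Icc_self hp.2)).trans ?_
        have h3 := besselK_mul_le l hlam hc hpc
        gcongr
      · rw [radialOp_eq_zero_of_eq_zero h fun h' => hpc h'.1, zero_mul, norm_zero, zero_mul]
        positivity
  have hswap := integral_integral_swap hF
  rw [intervalIntegral.integral_of_le hR.le, intervalIntegral.integral_of_le hR.le, ← integral_smul]
  calc ∫ r in Ioc 0 R, (radialOp lam l η r * r ^ 2) • ∫ r' in (0 : ℝ)..R,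
        (greenFun lam R l r r' : ℂ) * g r' * (r' : ℂ) ^ 2
      = ∫ r, ∫ r', ((radialOp lam l η r * r ^ 2 * greenFun lam R l r r' : ℝ) : ℂ) *
        (g r' * (r' : ℂ) ^ 2) ∂μ ∂μ := by
        refine integral_congr_ae (.of_forall fun r => ?_)
        simp only
        rw [intervalIntegral.integral_of_le hR.le, ← integral_smul]
        refine integral_congr_ae (.of_forall fun r' => ?_)
        simp only [Complex.real_smul]
        push_cast
        ring
    _ = _ := hswap
    _ = ∫ r' in Ioc 0 R, -(4 * Real.pi) • ((η r' * r' ^ 2) • g r') := by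
        have hne : ∀ᵐ r : ℝ ∂μ, r ≠ R := ae_restrict_of_ae (by simp [ae_iff])
        refine integral_congr_ae ?_
        filter_upwards [ae_restrict_mem measurableSet_Ioc, hne] with r' hr' hr'R
        rw [integral_mul_const, integral_complex_ofReal]
        have := integral_greenFun_mul_radialOp l hlam
          ⟨hr'.1, lt_of_le_of_ne hr'.2 hr'R⟩ hη
        rw [intervalIntegral.integral_of_le hR.le] at this
        rw [show ∫ r, radialOp lam l η r * r ^ 2 * greenFun lam R l r r' ∂μ =
          -(4 * Real.pi) * η r' by rw [← this]; exact integral_congr_ae (.of_forall fun r => by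
            simp only; ring)]
        simp only [Complex.real_smul]
        push_cast
        ring

lemma radialPotential_boundary (hlam : 0 < lam) (hR : 0 < R) (b : ℂ) :
    radialPotential lam R l g b R = b := by
  rw [radialPotential, div_self (besselI_pos l (mul_pos hlam hR)).ne']
  have : ∫ r' in (0 : ℝ)..R, (greenFun lam R l R r' : ℂ) * g r' * (r' : ℂ) ^ 2 = 0 := by
    refine (intervalIntegral.integral_congr fun r hr => ?_).trans intervalIntegral.integral_zero
    rw [uIcc_of_le hR.le] at hr
    simp [greenFun_left_boundary l hlam hR hr.2]
  simp [this]

/-- A weak solution which is continuous on `[0, R]` is given by the Green function and its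
boundary value. -/
theorem IsWeakRadialSolution.eq_radialPotential {u : ℝ → ℂ} (hlam : 0 < lam) (hR : 0 < R)
    (hu : ContinuousOn u (Icc 0 R))
    (hg : IntervalIntegrable (fun r' => g r' * (r' : ℂ) ^ 2) volume 0 R)
    (h : IsWeakRadialSolution lam R l u g) :
    ∀ r ∈ Ioc 0 R, u r = radialPotential lam R l g (u R) r := by
  set P : ℝ → ℂ := fun r => ∫ r' in (0 : ℝ)..R,
    (greenFun lam R l r r' : ℂ) * g r' * (r' : ℂ) ^ 2 with hP
  set J : ℝ → ℂ := fun r => (besselI l (lam * r) / besselI l (lam * R)) • u R with hJ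
  have hpot : ∀ r, radialPotential lam R l g (u R) r = P r + J r := fun r => by
    rw [radialPotential, hP, hJ]
    simp only [Complex.real_smul]
    ring
  have hJc : Continuous J := by
    have := continuous_besselI_mul lam l
    fun_prop
  have hPc := continuousOn_integral_greenFun_mul l hlam hR hg
  have hPw := isWeakRadialSolution_integral_greenFun l hlam hR hg
  have huJ : ContinuousOn (fun r => u r - J r) (Icc 0 R) := hu.sub hJc.continuousOn
  have hwc : ContinuousOn (fun r => u r - J r - P r) (Ioc 0 R) :=
    (huJ.mono Ioc_subset_Icc_self).sub hPc
  -- The uniqueness lemma is for real functions, so it is applied to every real linear functional of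
  -- the difference; real and imaginary part suffice at the end.
  have key : ∀ L : ℂ →L[ℝ] ℝ, ∀ r ∈ Ioc 0 R, L (u r - J r - P r) = 0 := by
    intro L
    refine eq_zero_of_weak_homogeneous (w := fun r => L (u r - J r - P r)) hlam hR l
      (L.continuous.comp_continuousOn hwc) ?_ ?_ fun η hη => ?_
    · have := hpot R
      rw [radialPotential_boundary l hlam hR] at this
      rw [this]
      simp
    · have h1 := tendsto_div_besselK_of_continuousOn hlam hR l (L.continuous.comp_continuousOn huJ)
      have h2 := (L.continuous.tendsto 0).comp
        (tendsto_integral_greenFun_mul_div_besselK l hlam hR hg)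
      rw [map_zero] at h2
      have h3 := h1.sub h2
      rw [sub_zero] at h3
      refine h3.congr fun r => ?_
      simp only [Function.comp, map_smul, smul_eq_mul, map_sub]
      ring
    · have hcont := hη.continuous_radialOp lam l
      have i1 : IntervalIntegrable (fun r => (radialOp lam l η r * r ^ 2) • u r) volume 0 R := by
        refine ContinuousOn.intervalIntegrable ?_
        rw [uIcc_of_le hR.le]
        fun_prop
      have i2 : IntervalIntegrable (fun r => (radialOp lam l η r * r ^ 2) • J r) volume 0 R :=
        Continuous.intervalIntegrable (by fun_prop) _ _
      have i3 : IntervalIntegrable (fun r => (radialOp lam l η r * r ^ 2) • P r) volume 0 R := by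
        refine Continuous.intervalIntegrable ?_ _ _
        obtain ⟨hη, c, d, hc, hcd, hd, hz⟩ := hη
        refine continuous_of_continuousOn_of_eq_zero hc hd ?_ fun r hr => ?_
        · have := hPc.mono Ioo_subset_Ioc_self
          fun_prop
        · rw [radialOp_eq_zero_of_eq_zero hz hr, zero_mul, zero_smul]
      have e1 : ∀ r, L (u r - J r - P r) * radialOp lam l η r * r ^ 2 =
          L ((radialOp lam l η r * r ^ 2) • u r - (radialOp lam l η r * r ^ 2) • J r -
            (radialOp lam l η r * r ^ 2) • P r) := fun r => by
        rw [← smul_sub, ← smul_sub, map_smul, smul_eq_mul]; ring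
      simp only [e1]
      rw [L.intervalIntegral_comp_comm ((i1.sub i2).sub i3),
        intervalIntegral.integral_sub (i1.sub i2) i3, intervalIntegral.integral_sub i1 i2,
        h η hη, hPw η hη]
      have e2 : ∫ r in (0 : ℝ)..R, (radialOp lam l η r * r ^ 2) • J r = 0 := by
        have : ∀ r, (radialOp lam l η r * r ^ 2) • J r =
            (besselI l (lam * r) * radialOp lam l η r * r ^ 2) •
              ((besselI l (lam * R))⁻¹ • u R) := fun r => by
          rw [hJ, smul_smul, smul_smul]; congr 1; ring
        simp only [this]
        rw [intervalIntegral.integral_smul_const, integral_besselI_mul_radialOp l hlam hη, zero_smul]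
      rw [e2]
      simp
  intro r hr
  have h1 := key Complex.reCLM r hr
  have h2 := key Complex.imCLM r hr
  rw [hpot, ← sub_eq_zero, add_comm, ← sub_sub]
  exact Complex.ext h1 h2

end Potential

/-! ### Polar coordinates -/

/-- The surface measure on the unit sphere. -/
noncomputable abbrev sphereMeasure : Measure (sphere (0 : E3) 1) := (volume : Measure E3).toSphere

/-- The origin is a null set, and off it `x ↦ (x/‖x‖, ‖x‖)` carries Lebesgue measure to surface
measure times `r² dr`; the rest is Fubini. -/
lemma polar_coordinates {F : E3 → ℂ} (hF : Integrable F) :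
    IntegrableOn (fun r : ℝ => r ^ 2 • ∫ n, F (r • (n : E3)) ∂sphereMeasure) (Ioi 0) ∧
      ∫ x, F x = ∫ r in Ioi (0 : ℝ), r ^ 2 • ∫ n, F (r • (n : E3)) ∂sphereMeasure := by
  have hmp := (volume : Measure E3).measurePreserving_homeomorphUnitSphereProd
  have hemb : MeasurableEmbedding (homeomorphUnitSphereProd E3) := Homeomorph.measurableEmbedding _
  rw [finrank_euclideanSpace_fin] at hmp
  let g : sphere (0 : E3) 1 × Ioi (0 : ℝ) → ℂ := fun p => F (p.2.1 • p.1.1)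
  have hg : g ∘ homeomorphUnitSphereProd E3 = fun x : ({0}ᶜ : Set E3) => F x := by
    ext x
    have hx : ‖(x : E3)‖ ≠ 0 := norm_ne_zero_iff.2 x.2
    simp only [g, Function.comp, homeomorphUnitSphereProd_apply_snd_coe,
      homeomorphUnitSphereProd_apply_fst_coe, smul_smul, mul_inv_cancel₀ hx, one_smul]
  have hgi : Integrable g (sphereMeasure.prod (Measure.volumeIoiPow 2)) := by
    rw [← hmp.integrable_comp_emb hemb, hg]
    have h1 : IntegrableOn F ({0}ᶜ : Set E3) := hF.integrableOn
    rwa [integrableOn_iff_comap_subtypeVal (measurableSet_singleton _).compl] at h1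
  have hw : ∀ x : Ioi (0 : ℝ), ((ENNReal.ofReal ((x : ℝ) ^ 2)).toReal) = (x : ℝ) ^ 2 := fun x =>
    ENNReal.toReal_ofReal (by positivity)
  have hmeas : Measurable fun x : Ioi (0 : ℝ) => ENNReal.ofReal ((x : ℝ) ^ 2) := by fun_prop
  constructor
  · have h1 := hgi.integral_prod_right
    rw [Measure.volumeIoiPow, integrable_withDensity_iff_integrable_smul' hmeas
      (.of_forall fun _ => ENNReal.ofReal_lt_top)] at h1
    simp only [hw] at h1
    rw [integrableOn_iff_comap_subtypeVal measurableSet_Ioi]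
    exact h1
  · calc ∫ x, F x = ∫ x : ({0}ᶜ : Set E3), F x ∂(volume.comap Subtype.val) := by
          rw [integral_subtype_comap (measurableSet_singleton _).compl F, restrict_compl_singleton]
      _ = ∫ p, g p ∂(sphereMeasure.prod (Measure.volumeIoiPow 2)) := by
          rw [← hmp.integral_comp hemb]
          exact integral_congr_ae (.of_forall fun x => (congrFun hg x).symm)
      _ = ∫ r, ∫ n, g (n, r) ∂sphereMeasure ∂(Measure.volumeIoiPow 2) := integral_prod_symm _ hgi
      _ = _ := by
          rw [Measure.volumeIoiPow, integral_withDensity_eq_integral_toReal_smul hmeas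
            (.of_forall fun _ => ENNReal.ofReal_lt_top)]
          simp only [hw]
          exact integral_subtype_comap measurableSet_Ioi
            fun r : ℝ => r ^ 2 • ∫ n, F (r • (n : E3)) ∂sphereMeasure

lemma polar_coordinates_ball {F : E3 → ℂ} {τ : E3} {R : ℝ} (hR : 0 < R)
    (hF : IntegrableOn F (ball τ R)) :
    IntervalIntegrable (fun r : ℝ => r ^ 2 • ∫ n, F (τ + r • (n : E3)) ∂sphereMeasure)
        volume 0 R ∧
      ∫ x in ball τ R, F x =
        ∫ r in (0 : ℝ)..R, r ^ 2 • ∫ n, F (τ + r • (n : E3)) ∂sphereMeasure := by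
  have h1 : Integrable fun x => (ball τ R).indicator F (τ + x) :=
    ((integrable_indicator_iff measurableSet_ball).2 hF).comp_add_left τ
  obtain ⟨h2, h3⟩ := polar_coordinates h1
  have h4 : ∀ r ∈ Ioi (0 : ℝ),
      r ^ 2 • ∫ n, (ball τ R).indicator F (τ + r • (n : E3)) ∂sphereMeasure =
        (Iio R).indicator (fun r => r ^ 2 • ∫ n, F (τ + r • (n : E3)) ∂sphereMeasure) r := by
    intro r hr
    have hn : ∀ n : sphere (0 : E3) 1, τ + r • (n : E3) ∈ ball τ R ↔ r < R := fun n => by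
      rw [mem_ball, dist_self_add_left, norm_smul, Real.norm_of_nonneg (le_of_lt hr),
        norm_eq_of_mem_sphere n, mul_one]
    by_cases hrR : r < R
    · simp [indicator, hn, hrR]
    · simp [indicator, hn, hrR]
  rw [setIntegral_congr_fun measurableSet_Ioi h4, setIntegral_indicator measurableSet_Iio,
    Ioi_inter_Iio, ← integral_Ioc_eq_integral_Ioo, ← intervalIntegral.integral_of_le hR.le,
    integral_add_left_eq_self (fun x => (ball τ R).indicator F x) τ,
    integral_indicator measurableSet_ball] at h3
  refine ⟨?_, h3⟩
  have h5 := (integrableOn_congr_fun h4 measurableSet_Ioi).1 h2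
  rw [intervalIntegrable_iff_integrableOn_Ioo_of_le hR.le]
  refine (h5.mono_set Ioo_subset_Ioi_self).congr_fun (fun r hr => ?_) measurableSet_Ioo
  rw [indicator_of_mem (show r ∈ Iio R from hr.2)]

/-! ### Legendre polynomials -/

/-- The polynomial `u = (X² - 1)^ℓ` satisfies `(X² - 1) u' = 2ℓ X u`. Its derivative is the case `n
= 0`, and differentiating the identity for `n` gives the one for `n + 1`. -/
lemma iterate_derivative_X_sq_sub_one_pow (l n : ℕ) :
    (Polynomial.X ^ 2 - 1) * Polynomial.derivative^[n + 2] ((Polynomial.X ^ 2 - 1 : Polynomial ℝ) ^ l)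
      + Polynomial.C (2 * (n + 1 - l) : ℝ) * Polynomial.X *
        Polynomial.derivative^[n + 1] ((Polynomial.X ^ 2 - 1) ^ l)
      + Polynomial.C ((n + 1) * n - 2 * l * (n + 1) : ℝ) *
        Polynomial.derivative^[n] ((Polynomial.X ^ 2 - 1) ^ l) = 0 := by
  induction n with
  | zero =>
    set u : Polynomial ℝ := (Polynomial.X ^ 2 - 1) ^ l with hu
    have h0 : (Polynomial.X ^ 2 - 1) * Polynomial.derivative u =
        Polynomial.C (2 * l : ℝ) * Polynomial.X * u := by
      rw [hu, Polynomial.derivative_pow]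
      rcases l with _ | l
      · simp
      · simp only [Polynomial.derivative_sub, Polynomial.derivative_X_pow, Polynomial.derivative_one,
          Nat.add_sub_cancel, map_mul, map_natCast, map_ofNat]
        push_cast
        ring
    have h1 := congrArg Polynomial.derivative h0
    simp only [Polynomial.derivative_mul, Polynomial.derivative_sub, Polynomial.derivative_X_pow,
      Polynomial.derivative_one, Polynomial.derivative_C, Polynomial.derivative_X] at h1
    simp only [Function.iterate_succ, Function.iterate_zero, Function.comp, id, zero_add,
      Nat.cast_zero]
    simp only [map_sub, map_mul, map_zero, map_one, map_natCast, map_ofNat] at h1 ⊢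
    push_cast at h1
    linear_combination h1
  | succ n ih =>
    have h1 := congrArg Polynomial.derivative ih
    simp only [Polynomial.derivative_mul, Polynomial.derivative_sub, Polynomial.derivative_X_pow,
      Polynomial.derivative_one, Polynomial.derivative_C, Polynomial.derivative_X,
      Polynomial.derivative_add, ← Function.iterate_succ_apply' Polynomial.derivative,
      Polynomial.derivative_zero] at h1
    simp only [Nat.succ_eq_add_one] at h1
    push_cast at h1 ⊢
    simp only [map_sub, map_mul, map_add, map_one, map_natCast, map_ofNat] at h1 ⊢
    linear_combination h1

/-- The differential equation of the associated Legendre polynomials. -/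
lemma legendreP_ode (l m : ℕ) (t : ℝ) :
    (1 - t ^ 2) * (Polynomial.derivative^[m + 2] (legendreP l)).eval t -
      2 * (m + 1) * t * (Polynomial.derivative^[m + 1] (legendreP l)).eval t +
      (l * (l + 1) - m * (m + 1)) * (Polynomial.derivative^[m] (legendreP l)).eval t = 0 := by
  have h := congrArg (Polynomial.eval t) (iterate_derivative_X_sq_sub_one_pow l (l + m))
  simp only [Polynomial.eval_add, Polynomial.eval_mul, Polynomial.eval_sub, Polynomial.eval_pow,
    Polynomial.eval_X, Polynomial.eval_one, Polynomial.eval_C, Polynomial.eval_zero] at h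
  have e : ∀ k, (Polynomial.derivative^[k] (legendreP l)).eval t = 1 / (2 ^ l * (l ! : ℝ)) *
      (Polynomial.derivative^[l + k] ((Polynomial.X ^ 2 - 1) ^ l)).eval t := fun k => by
    rw [legendreP, Polynomial.iterate_derivative_C_mul, Polynomial.eval_mul, Polynomial.eval_C,
      ← Function.iterate_add_apply, add_comm k l]
  rw [e, e, e]
  push_cast at h
  simp only [← add_assoc]
  linear_combination -(1 / (2 ^ l * (l ! : ℝ))) * h

/-- In characteristic zero each of the `ℓ + m` derivatives lowers the degree `2ℓ` by exactly one.
The exact degrees are what makes these polynomials a basis in the completeness proof. -/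
lemma degree_iterate_derivative_legendreP (l m : ℕ) (h : m ≤ l) :
    (Polynomial.derivative^[m] (legendreP l)).degree = ((l - m : ℕ) : WithBot ℕ) := by
  have hmon : ((Polynomial.X ^ 2 - 1 : Polynomial ℝ) ^ l).Monic := by
    refine Polynomial.Monic.pow ?_ l
    exact Polynomial.monic_X_pow_sub_C 1 two_ne_zero
  have hdeg : ((Polynomial.X ^ 2 - 1 : Polynomial ℝ) ^ l).natDegree = 2 * l := by
    rw [Polynomial.natDegree_pow, show (Polynomial.X ^ 2 - 1 : Polynomial ℝ) =
      Polynomial.X ^ 2 - Polynomial.C 1 by simp, Polynomial.natDegree_X_pow_sub_C, mul_comm]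
  have hiter : ∀ (p : Polynomial ℝ) (d k : ℕ), p.degree = ((d + k : ℕ) : WithBot ℕ) →
      (Polynomial.derivative^[k] p).degree = (d : WithBot ℕ) := by
    intro p d k
    induction k generalizing p with
    | zero => intro h; simpa using h
    | succ k ih =>
      intro h
      rw [Function.iterate_succ_apply]
      apply ih
      have hn : p.natDegree = d + k + 1 := Polynomial.natDegree_eq_of_degree_eq_some h
      rw [Polynomial.degree_derivative (by omega), hn]
      rfl
  rw [legendreP, Polynomial.iterate_derivative_C_mul, Polynomial.degree_C_mul (by positivity),
    ← Function.iterate_add_apply]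
  refine hiter _ _ _ ?_
  rw [Polynomial.degree_eq_natDegree hmon.ne_zero, hdeg]
  congr 1
  omega

/-! ### The Laplacian in coordinates -/

/-- The standard basis vectors of `ℝ³`. -/
noncomputable abbrev stdVec (i : Fin 3) : E3 := EuclideanSpace.single i 1

/-- `d i` and `d2 i` are the first and second partial derivatives of `f` away from the origin. -/
def HasPartials {A : Type*} [NormedAddCommGroup A] [NormedSpace ℝ A] (f : E3 → A)
    (d d2 : Fin 3 → E3 → A) : Prop :=
  ∀ y ≠ 0, ∀ i, HasLineDerivAt ℝ f (d i y) y (stdVec i) ∧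
    HasLineDerivAt ℝ (d i) (d2 i y) y (stdVec i)

lemma HasPartials.congr {A : Type*} [NormedAddCommGroup A] [NormedSpace ℝ A] {f : E3 → A}
    {d d2 d' d2' : Fin 3 → E3 → A} (h : HasPartials f d d2) (h1 : ∀ i y, d i y = d' i y)
    (h2 : ∀ i y, d2 i y = d2' i y) : HasPartials f d' d2' := by
  rwa [show d' = d from funext fun i => funext fun y => (h1 i y).symm,
    show d2' = d2 from funext fun i => funext fun y => (h2 i y).symm]

lemma laplacian_eq_sum_fderiv {A : Type*} [NormedAddCommGroup A] [NormedSpace ℝ A] (f : E3 → A)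
    (x : E3) : Δ f x = ∑ i, fderiv ℝ (fderiv ℝ f) x (stdVec i) (stdVec i) := by
  rw [InnerProductSpace.laplacian_eq_iteratedFDeriv_orthonormalBasis f
    (EuclideanSpace.basisFun (Fin 3) ℝ)]
  refine Finset.sum_congr rfl fun i _ => ?_
  rw [iteratedFDeriv_two_apply]
  simp [stdVec]

/-- The data `d`, `d2` are derivatives along coordinate lines only; second-order smoothness
identifies them with values of the Fréchet derivatives. -/
lemma HasPartials.laplacian_eq {A : Type*} [NormedAddCommGroup A] [NormedSpace ℝ A] {f : E3 → A}
    {d d2 : Fin 3 → E3 → A} (h : HasPartials f d d2) {x : E3} (hx : x ≠ 0)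
    (hf : ContDiffAt ℝ 2 f x) : Δ f x = ∑ i, d2 i x := by
  rw [laplacian_eq_sum_fderiv]
  refine Finset.sum_congr rfl fun i _ => ?_
  have h1 : d i =ᶠ[nhds x] fun y => fderiv ℝ f y (stdVec i) := by
    filter_upwards [isOpen_ne.mem_nhds hx, hf.eventually (by simp)] with y hy hfy
    have hdf : DifferentiableAt ℝ f y := hfy.differentiableAt (by simp)
    exact (((h y hy i).1).lineDeriv).symm.trans hdf.lineDeriv_eq_fderiv
  have h2 : DifferentiableAt ℝ (fderiv ℝ f) x :=
    (hf.fderiv_right (m := 1) (by norm_num)).differentiableAt (by simp)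
  have h3 : HasFDerivAt (fun y => fderiv ℝ f y (stdVec i))
      ((ContinuousLinearMap.apply ℝ A (stdVec i)).comp (fderiv ℝ (fderiv ℝ f) x)) x :=
    ((ContinuousLinearMap.apply ℝ A (stdVec i)).hasFDerivAt).comp x h2.hasFDerivAt
  have h4 := (h3.congr_of_eventuallyEq h1).hasLineDerivAt (stdVec i)
  exact (h4.lineDeriv).symm.trans ((h x hx i).2).lineDeriv

section Partials

variable {A : Type*} [NormedCommRing A] [NormedAlgebra ℝ A] {f g : E3 → A}
  {df d2f dg d2g : Fin 3 → E3 → A}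

lemma hasLineDerivAt_mul {a b : A} {x v : E3} (hf : HasLineDerivAt ℝ f a x v)
    (hg : HasLineDerivAt ℝ g b x v) :
    HasLineDerivAt ℝ (fun y => f y * g y) (a * g x + f x * b) x v := by
  have := HasDerivAt.mul hf hg
  unfold HasLineDerivAt
  refine this.congr_deriv (by simp)

lemma hasLineDerivAt_add {a b : A} {x v : E3} (hf : HasLineDerivAt ℝ f a x v)
    (hg : HasLineDerivAt ℝ g b x v) :
    HasLineDerivAt ℝ (fun y => f y + g y) (a + b) x v :=
  HasDerivAt.add hf hg

lemma HasPartials.mul (hf : HasPartials f df d2f) (hg : HasPartials g dg d2g) :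
    HasPartials (fun y => f y * g y) (fun i y => df i y * g y + f y * dg i y)
      (fun i y => d2f i y * g y + df i y * dg i y + (df i y * dg i y + f y * d2g i y)) := by
  intro y hy i
  obtain ⟨f1, f2⟩ := hf y hy i
  obtain ⟨g1, g2⟩ := hg y hy i
  exact ⟨hasLineDerivAt_mul f1 g1,
    hasLineDerivAt_add (hasLineDerivAt_mul f2 g1) (hasLineDerivAt_mul f1 g2)⟩

lemma HasPartials.add (hf : HasPartials f df d2f) (hg : HasPartials g dg d2g) :
    HasPartials (fun y => f y + g y) (fun i y => df i y + dg i y)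
      (fun i y => d2f i y + d2g i y) := fun y hy i =>
  ⟨hasLineDerivAt_add (hf y hy i).1 (hg y hy i).1, hasLineDerivAt_add (hf y hy i).2 (hg y hy i).2⟩

lemma HasPartials.const_mul (c : A) (hf : HasPartials f df d2f) :
    HasPartials (fun y => c * f y) (fun i y => c * df i y) (fun i y => c * d2f i y) :=
  fun y hy i => ⟨HasDerivAt.const_mul c (hf y hy i).1, HasDerivAt.const_mul c (hf y hy i).2⟩

lemma HasPartials.pow (hf : HasPartials f df d2f) (m : ℕ) :
    HasPartials (fun y => f y ^ m) (fun i y => m * f y ^ (m - 1) * df i y)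
      (fun i y => m * ((m - 1 : ℕ) * f y ^ (m - 1 - 1) * df i y) * df i y
        + m * f y ^ (m - 1) * d2f i y) := by
  have hp : ∀ (k : ℕ) {y v : E3} {a : A}, HasLineDerivAt ℝ f a y v →
      HasLineDerivAt ℝ (fun y => f y ^ k) (k * f y ^ (k - 1) * a) y v := fun k y v a h => by
    have := HasDerivAt.fun_pow h k
    unfold HasLineDerivAt
    refine this.congr_deriv (by simp)
  intro y hy i
  refine ⟨hp m (hf y hy i).1, ?_⟩
  have h1 : HasLineDerivAt ℝ (fun y => (m : A) * f y ^ (m - 1))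
      (m * ((m - 1 : ℕ) * f y ^ (m - 1 - 1) * df i y)) y (stdVec i) :=
    HasDerivAt.const_mul (m : A) (hp (m - 1) (hf y hy i).1)
  exact hasLineDerivAt_mul h1 (hf y hy i).2

end Partials

lemma HasPartials.comp {u : E3 → ℝ} {du d2u : Fin 3 → E3 → ℝ} (hu : HasPartials u du d2u)
    {θ θ' θ'' : ℝ → ℝ} (h1 : ∀ y : E3, y ≠ 0 → HasDerivAt θ (θ' (u y)) (u y))
    (h2 : ∀ y : E3, y ≠ 0 → HasDerivAt θ' (θ'' (u y)) (u y)) :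
    HasPartials (fun y => θ (u y)) (fun i y => θ' (u y) * du i y)
      (fun i y => θ'' (u y) * du i y * du i y + θ' (u y) * d2u i y) := by
  have hc : ∀ {θ θ' : ℝ → ℝ} {y v : E3} {a : ℝ}, HasDerivAt θ (θ' (u y)) (u y) →
      HasLineDerivAt ℝ u a y v → HasLineDerivAt ℝ (fun y => θ (u y)) (θ' (u y) * a) y v := by
    intro θ θ' y v a h h'
    have h3 : HasDerivAt θ (θ' (u y)) (u (y + (0 : ℝ) • v)) := by simpa using h
    exact HasDerivAt.comp (0 : ℝ) h3 h'
  intro y hy i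
  exact ⟨hc (h1 y hy) (hu y hy i).1, hasLineDerivAt_mul (hc (h2 y hy) (hu y hy i).1) (hu y hy i).2⟩

lemma HasPartials.ofReal {u : E3 → ℝ} {du d2u : Fin 3 → E3 → ℝ} (hu : HasPartials u du d2u) :
    HasPartials (fun y => (u y : ℂ)) (fun i y => (du i y : ℂ)) (fun i y => (d2u i y : ℂ)) :=
  fun y hy i => ⟨HasDerivAt.ofReal_comp (hu y hy i).1, HasDerivAt.ofReal_comp (hu y hy i).2⟩

lemma hasPartials_coord (j : Fin 3) :
    HasPartials (fun y : E3 => y j) (fun i _ => if i = j then 1 else 0) (fun _ _ => 0) := by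
  intro y _ i
  refine ⟨?_, hasDerivAt_const _ _⟩
  unfold HasLineDerivAt
  have : (fun t : ℝ => (y + t • stdVec i) j) = fun t => y j + t * (if i = j then 1 else 0) := by
    ext t
    by_cases h : i = j
    · subst h; simp
    · simp [h, Ne.symm h]
  rw [this]
  simpa using ((hasDerivAt_id (0 : ℝ)).mul_const (if i = j then (1 : ℝ) else 0)).const_add (y j)

lemma norm_sq_eq_coord (y : E3) : ‖y‖ ^ 2 = y 0 ^ 2 + y 1 ^ 2 + y 2 ^ 2 := by
  rw [EuclideanSpace.norm_sq_eq, Fin.sum_univ_three]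
  simp

lemma hasPartials_norm_sq : HasPartials (fun y : E3 => y 0 ^ 2 + y 1 ^ 2 + y 2 ^ 2)
    (fun i y => 2 * y i) (fun _ _ => 2) := by
  have h := (((hasPartials_coord 0).pow 2).add ((hasPartials_coord 1).pow 2)).add
    ((hasPartials_coord 2).pow 2)
  exact h.congr (fun i y => by fin_cases i <;> simp) (fun i y => by fin_cases i <;> simp)

lemma hasPartials_norm : HasPartials (fun y : E3 => ‖y‖) (fun i y => y i * ‖y‖⁻¹)
    (fun i y => ‖y‖⁻¹ - y i ^ 2 * ‖y‖⁻¹ ^ 3) := by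
  have hq : ∀ y : E3, y ≠ 0 → y 0 ^ 2 + y 1 ^ 2 + y 2 ^ 2 ≠ 0 := fun y hy => by
    rw [← norm_sq_eq_coord]; exact pow_ne_zero 2 (norm_ne_zero_iff.2 hy)
  have h := hasPartials_norm_sq.comp (θ := Real.sqrt) (θ' := fun s => (1 / 2) * (Real.sqrt s)⁻¹)
    (θ'' := fun s => -(1 / 4) * (Real.sqrt s)⁻¹ ^ 3)
    (fun y hy => (Real.hasDerivAt_sqrt (hq y hy)).congr_deriv (by ring)) (fun y hy => by
      have h0 : Real.sqrt (y 0 ^ 2 + y 1 ^ 2 + y 2 ^ 2) ≠ 0 := by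
        rw [← norm_sq_eq_coord, Real.sqrt_sq (norm_nonneg _)]; exact norm_ne_zero_iff.2 hy
      refine (((Real.hasDerivAt_sqrt (hq y hy)).inv h0).const_mul (1 / 2)).congr_deriv ?_
      field_simp
      ring)
  have he : ∀ y : E3, Real.sqrt (y 0 ^ 2 + y 1 ^ 2 + y 2 ^ 2) = ‖y‖ := fun y => by
    rw [← norm_sq_eq_coord, Real.sqrt_sq (norm_nonneg _)]
  simp only [he] at h
  exact h.congr (fun i y => by ring) (fun i y => by ring)

lemma hasPartials_norm_inv : HasPartials (fun y : E3 => ‖y‖⁻¹) (fun i y => -(y i * ‖y‖⁻¹ ^ 3))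
    (fun i y => -‖y‖⁻¹ ^ 3 + 3 * (y i ^ 2 * ‖y‖⁻¹ ^ 5)) := by
  have hq : ∀ y : E3, y ≠ 0 → ‖y‖ ≠ 0 := fun y hy => norm_ne_zero_iff.2 hy
  have h := hasPartials_norm.comp (θ := fun r => r⁻¹) (θ' := fun r => -r⁻¹ ^ 2)
    (θ'' := fun r => 2 * r⁻¹ ^ 3)
    (fun y hy => (hasDerivAt_inv (hq y hy)).congr_deriv (by simp)) (fun y hy => by
      refine ((hasDerivAt_inv (hq y hy)).pow 2).neg.congr_deriv ?_
      have := hq y hy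
      field_simp
      norm_num
      rw [mul_assoc, mul_inv_cancel₀ this, mul_one])
  exact h.congr (fun i y => by ring) (fun i y => by ring)

/-- The partial derivatives of a radial function. -/
lemma hasPartials_radial {χ : ℝ → ℝ} (hχ : ContDiff ℝ ∞ χ) :
    HasPartials (fun y : E3 => χ ‖y‖) (fun i y => deriv χ ‖y‖ * (y i * ‖y‖⁻¹))
      (fun i y => deriv (deriv χ) ‖y‖ * (y i * ‖y‖⁻¹) * (y i * ‖y‖⁻¹) +
        deriv χ ‖y‖ * (‖y‖⁻¹ - y i ^ 2 * ‖y‖⁻¹ ^ 3)) :=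
  hasPartials_norm.comp
    (fun _ _ => (hχ.differentiable (by simp) _).hasDerivAt)
    (fun _ _ => ((contDiff_infty_iff_deriv.1 hχ).2.differentiable (by simp) _).hasDerivAt)

/-- The partial derivatives of the components of the direction `y / ‖y‖`. -/
lemma hasPartials_direction (j : Fin 3) : HasPartials (fun y : E3 => y j * ‖y‖⁻¹)
    (fun i y => (if i = j then 1 else 0) * ‖y‖⁻¹ + y j * -(y i * ‖y‖⁻¹ ^ 3))
    (fun i y => 2 * ((if i = j then 1 else 0) * -(y i * ‖y‖⁻¹ ^ 3)) +
      y j * (-‖y‖⁻¹ ^ 3 + 3 * (y i ^ 2 * ‖y‖⁻¹ ^ 5))) :=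
  ((hasPartials_coord j).mul hasPartials_norm_inv).congr (fun _ _ => rfl) (fun i y => by ring)

/-! ### Radial functions times spherical harmonics -/

/-- The product rule for `Δ(X(r) U^m Q(T))` with `U = n₀ + i n₁`, `T = n₂`, `s = 1/r`, as pure
algebra. The hypotheses `h1`–`h9` are the Laplacians of `r`, `U`, `T` and the products of their
gradients; for instance `∇r` is orthogonal to `∇U` and `∇T`. What remains of the angular part is the
associated Legendre equation `hQ`. -/
lemma sum_second_partials_radial_mul_harmonic (r rr u uu t tt : Fin 3 → ℂ)
    {X0 X1 X2 Q0 Q1 Q2 U T s L : ℂ} (m : ℕ)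
    (h1 : ∑ i, r i * r i = 1) (h2 : ∑ i, rr i = 2 * s) (h3 : ∑ i, r i * t i = 0)
    (h4 : ∑ i, t i * t i = s ^ 2 * (1 - T ^ 2)) (h5 : ∑ i, tt i = -2 * T * s ^ 2)
    (h6 : ∑ i, r i * u i = 0) (h7 : ∑ i, u i * u i = -(U ^ 2 * s ^ 2))
    (h8 : ∑ i, uu i = -2 * U * s ^ 2) (h9 : ∑ i, u i * t i = -(U * T * s ^ 2))
    (hQ : (1 - T ^ 2) * Q2 - 2 * (m + 1) * T * Q1 + (L - m * (m + 1)) * Q0 = 0) :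
    ∑ i, ((X2 * r i * r i + X1 * rr i) * (U ^ m * Q0) +
        X1 * r i * (m * U ^ (m - 1) * u i * Q0 + U ^ m * (Q1 * t i)) +
        (X1 * r i * (m * U ^ (m - 1) * u i * Q0 + U ^ m * (Q1 * t i)) +
          X0 * ((m * ((m - 1 : ℕ) * U ^ (m - 1 - 1) * u i) * u i + m * U ^ (m - 1) * uu i) * Q0 +
            m * U ^ (m - 1) * u i * (Q1 * t i) +
            (m * U ^ (m - 1) * u i * (Q1 * t i) +
              U ^ m * (Q2 * t i * t i + Q1 * tt i))))) =
      (X2 + 2 * s * X1 - L * s ^ 2 * X0) * (U ^ m * Q0) := by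
  -- `U` may vanish and `m - 1`, `m - 1 - 1` are truncated, so the lower powers are treated as
  -- unknowns that are tied to `U ^ m` only by `e1` and `e2`.
  have e1 : (m : ℂ) * U ^ (m - 1) * U = m * U ^ m := by
    rcases m with _ | m
    · simp
    · rw [Nat.add_sub_cancel, pow_succ]; ring
  have e2 : (m : ℂ) * ((m - 1 : ℕ) * U ^ (m - 1 - 1)) * U ^ 2 = m * (m - 1) * U ^ m := by
    rcases m with _ | _ | m
    · simp
    · simp
    · simp only [Nat.add_sub_cancel, show m + 1 + 1 - 1 = m + 1 by omega]
      push_cast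
      ring
  generalize (m : ℂ) * U ^ (m - 1) = U1 at e1 ⊢
  have e3 : ∀ i, (m : ℂ) * ((m - 1 : ℕ) * U ^ (m - 1 - 1) * u i) =
    (m : ℂ) * ((m - 1 : ℕ) * U ^ (m - 1 - 1)) * u i := fun i => by ring
  simp only [e3]
  generalize (m : ℂ) * ((m - 1 : ℕ) * U ^ (m - 1 - 1)) = U2 at e2 ⊢
  generalize U ^ m = U0 at *
  simp only [Fin.sum_univ_three] at *
  linear_combination X2 * U0 * Q0 * h1 + X1 * U0 * Q0 * h2 + 2 * X1 * U1 * Q0 * h6 +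
    2 * X1 * U0 * Q1 * h3 + X0 * U2 * Q0 * h7 + X0 * U1 * Q0 * h8 + 2 * X0 * U1 * Q1 * h9 +
    X0 * U0 * Q2 * h4 + X0 * U0 * Q1 * h5 - X0 * Q0 * s ^ 2 * e2 - 2 * X0 * Q0 * s ^ 2 * e1 -
    2 * X0 * Q1 * T * s ^ 2 * e1 + X0 * U0 * s ^ 2 * hQ

/-- `(n₀ + i n₁)^m P_ℓ^{(m)}(n₂)` with `n = y / ‖y‖`. -/
noncomputable def directionHarmonic (l m : ℕ) (y : E3) : ℂ :=
  (((y 0 * ‖y‖⁻¹ : ℝ) : ℂ) + Complex.I * ((y 1 * ‖y‖⁻¹ : ℝ) : ℂ)) ^ m *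
    (((Polynomial.derivative^[m] (legendreP l)).eval (y 2 * ‖y‖⁻¹) : ℝ) : ℂ)

lemma contDiffAt_directionHarmonic (l m : ℕ) {x : E3} (hx : x ≠ 0) :
    ContDiffAt ℝ ∞ (directionHarmonic l m) x := by
  have hn : ∀ j, ContDiffAt ℝ ∞ (fun y : E3 => y j * ‖y‖⁻¹) x := fun j => by
    refine ContDiffAt.mul ?_ ((contDiffAt_norm ℝ hx).inv (norm_ne_zero_iff.2 hx))
    exact (EuclideanSpace.proj (𝕜 := ℝ) j).contDiff.contDiffAt
  have hc : ∀ {h : E3 → ℝ}, ContDiffAt ℝ ∞ h x → ContDiffAt ℝ ∞ (fun y => (h y : ℂ)) x :=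
    fun hh => Complex.ofRealCLM.contDiff.contDiffAt.comp x hh
  refine ContDiffAt.mul (ContDiffAt.pow ((hc (hn 0)).add (contDiffAt_const.mul (hc (hn 1)))) m)
    (hc ?_)
  have hQ := (Polynomial.contDiff_aeval (𝕜 := ℝ) (Polynomial.derivative^[m] (legendreP l)) ∞)
  simp only [Polynomial.coe_aeval_eq_eval] at hQ
  exact hQ.contDiffAt.comp x (hn 2)

lemma contDiffAt_radial_mul_directionHarmonic {χ : ℝ → ℝ} (hχ : ContDiff ℝ ∞ χ) (l m : ℕ) {x : E3}
    (hx : x ≠ 0) : ContDiffAt ℝ ∞ (fun y : E3 => (χ ‖y‖ : ℂ) * directionHarmonic l m y) x :=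
  ContDiffAt.mul (Complex.ofRealCLM.contDiff.contDiffAt.comp x
    (hχ.contDiffAt.comp x (contDiffAt_norm ℝ hx))) (contDiffAt_directionHarmonic l m hx)

lemma laplacian_radial_mul_directionHarmonic {χ : ℝ → ℝ} (hχ : ContDiff ℝ ∞ χ) (l m : ℕ) {x : E3}
    (hx : x ≠ 0) : Δ (fun y : E3 => (χ ‖y‖ : ℂ) * directionHarmonic l m y) x =
      (((deriv (deriv χ) ‖x‖ + 2 / ‖x‖ * deriv χ ‖x‖ - l * (l + 1) / ‖x‖ ^ 2 * χ ‖x‖ : ℝ)) : ℂ) *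
        directionHarmonic l m x := by
  set Q := Polynomial.derivative^[m] (legendreP l) with hQ
  have hP := (hasPartials_radial hχ).ofReal.mul ((((hasPartials_direction 0).ofReal.add
    ((hasPartials_direction 1).ofReal.const_mul Complex.I)).pow m).mul
    ((hasPartials_direction 2).comp (θ := fun z => Q.eval z)
      (θ' := fun z => (Polynomial.derivative Q).eval z)
      (θ'' := fun z => (Polynomial.derivative (Polynomial.derivative Q)).eval z)
      (fun _ _ => Polynomial.hasDerivAt _ _) (fun _ _ => Polynomial.hasDerivAt _ _)).ofReal)
  have h0 := hP.laplacian_eq hx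
    ((contDiffAt_radial_mul_directionHarmonic hχ l m hx).of_le two_le_infty)
  refine h0.trans ?_
  have hs : (‖x‖ : ℂ) ≠ 0 := by exact_mod_cast norm_ne_zero_iff.2 hx
  have hn : (((x 0 : ℝ) : ℂ) ^ 2 + ((x 1 : ℝ) : ℂ) ^ 2 + ((x 2 : ℝ) : ℂ) ^ 2) *
      (‖x‖ : ℂ)⁻¹ ^ 2 = 1 := by
    have := norm_sq_eq_coord x
    have h2 : ((‖x‖ : ℂ)) ^ 2 = ((x 0 : ℝ) : ℂ) ^ 2 + ((x 1 : ℝ) : ℂ) ^ 2 + ((x 2 : ℝ) : ℂ) ^ 2 := by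
      exact_mod_cast this
    rw [← h2]
    field_simp
  have hI := Complex.I_sq
  have hode := legendreP_ode l m (x 2 * ‖x‖⁻¹)
  rw [show m + 2 = (m + 1) + 1 by ring, Function.iterate_succ_apply', Function.iterate_succ_apply',
    ← hQ] at hode
  have hode' := congrArg (fun z : ℝ => (z : ℂ)) hode
  simp only [Complex.ofReal_zero] at hode'
  push_cast at hode'
  have key := sum_second_partials_radial_mul_harmonic
    (r := fun i => ((x i : ℝ) : ℂ) * (‖x‖ : ℂ)⁻¹)
    (rr := fun i => (‖x‖ : ℂ)⁻¹ - ((x i : ℝ) : ℂ) ^ 2 * (‖x‖ : ℂ)⁻¹ ^ 3)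
    (u := fun i => (((if i = 0 then 1 else 0) * ‖x‖⁻¹ + x 0 * -(x i * ‖x‖⁻¹ ^ 3) : ℝ) : ℂ) +
      Complex.I * (((if i = 1 then 1 else 0) * ‖x‖⁻¹ + x 1 * -(x i * ‖x‖⁻¹ ^ 3) : ℝ) : ℂ))
    (uu := fun i => ((2 * ((if i = 0 then 1 else 0) * -(x i * ‖x‖⁻¹ ^ 3)) +
      x 0 * (-‖x‖⁻¹ ^ 3 + 3 * (x i ^ 2 * ‖x‖⁻¹ ^ 5)) : ℝ) : ℂ) + Complex.I *
      ((2 * ((if i = 1 then 1 else 0) * -(x i * ‖x‖⁻¹ ^ 3)) +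
      x 1 * (-‖x‖⁻¹ ^ 3 + 3 * (x i ^ 2 * ‖x‖⁻¹ ^ 5)) : ℝ) : ℂ))
    (t := fun i => (((if i = 2 then 1 else 0) * ‖x‖⁻¹ + x 2 * -(x i * ‖x‖⁻¹ ^ 3) : ℝ) : ℂ))
    (tt := fun i => ((2 * ((if i = 2 then 1 else 0) * -(x i * ‖x‖⁻¹ ^ 3)) +
      x 2 * (-‖x‖⁻¹ ^ 3 + 3 * (x i ^ 2 * ‖x‖⁻¹ ^ 5)) : ℝ) : ℂ))
    (X0 := (χ ‖x‖ : ℂ)) (X1 := ((deriv χ ‖x‖ : ℝ) : ℂ)) (X2 := ((deriv (deriv χ) ‖x‖ : ℝ) : ℂ))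
    (Q0 := ((Q.eval (x 2 * ‖x‖⁻¹) : ℝ) : ℂ))
    (Q1 := (((Polynomial.derivative Q).eval (x 2 * ‖x‖⁻¹) : ℝ) : ℂ))
    (Q2 := (((Polynomial.derivative (Polynomial.derivative Q)).eval (x 2 * ‖x‖⁻¹) : ℝ) : ℂ))
    (U := ((x 0 * ‖x‖⁻¹ : ℝ) : ℂ) + Complex.I * ((x 1 * ‖x‖⁻¹ : ℝ) : ℂ))
    (T := ((x 2 : ℝ) : ℂ) * (‖x‖ : ℂ)⁻¹) (s := (‖x‖ : ℂ)⁻¹) (L := l * (l + 1)) m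
    ?_ ?_ ?_ ?_ ?_ ?_ ?_ ?_ ?_ (by linear_combination hode')
  · refine Eq.trans (Finset.sum_congr rfl fun i _ => ?_) (key.trans ?_)
    · push_cast
      rfl
    · rw [directionHarmonic, ← hQ]
      push_cast
      field_simp
  -- With the coordinates, the inverse norm and `I` replaced by variables, the nine gradient
  -- relations are polynomial identities modulo `(a² + b² + c²) s² = 1` and `ι² = -1`.
  all_goals
    simp only [Fin.sum_univ_three, Fin.isValue, if_true, one_ne_zero, if_false, zero_ne_one,
      Fin.reduceEq]
    push_cast
    generalize (‖x‖ : ℂ)⁻¹ = s at *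
    generalize ((x 0 : ℝ) : ℂ) = a at *
    generalize ((x 1 : ℝ) : ℂ) = b at *
    generalize ((x 2 : ℝ) : ℂ) = c at *
    generalize Complex.I = ι at *
  · linear_combination hn
  · linear_combination -s * hn
  · linear_combination -(c * s ^ 2) * hn
  · linear_combination c ^ 2 * s ^ 4 * hn
  · linear_combination 3 * c * s ^ 3 * hn
  · linear_combination -((a + ι * b) * s ^ 2) * hn
  · linear_combination s ^ 2 * hI + (a + ι * b) ^ 2 * s ^ 4 * hn
  · linear_combination 3 * (a + ι * b) * s ^ 3 * hn
  · linear_combination (a + ι * b) * c * s ^ 4 * hn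

/-- The direction `(x - τ) / ‖x - τ‖`. -/
noncomputable abbrev direction (τ x : E3) : E3 := ‖x - τ‖⁻¹ • (x - τ)

lemma exists_conj_sphericalHarmonic_eq (l : ℕ) (m : ℤ) : ∃ (c : ℂ) (k : ℕ),
    (∀ y : E3, conj (sphericalHarmonic l m (‖y‖⁻¹ • y)) = c * directionHarmonic l k y) ∨
    (∀ y : E3, conj (sphericalHarmonic l m (‖y‖⁻¹ • y)) = c * conj (directionHarmonic l k y)) := by
  have h : ∀ k, ∃ c : ℂ, ∀ y : E3,
      sphericalHarmonicNonneg l k (‖y‖⁻¹ • y) = c * directionHarmonic l k y := fun k =>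
    ⟨(-1) ^ k * (Real.sqrt ((2 * l + 1) / (4 * Real.pi) *
      (((l - k)! : ℝ) / ((l + k)! : ℝ))) : ℂ), fun y => by
        rw [sphericalHarmonicNonneg, directionHarmonic]
        simp only [PiLp.smul_apply, smul_eq_mul, mul_comm (‖y‖⁻¹)]
        ring⟩
  obtain ⟨c, hc⟩ := h m.natAbs
  by_cases hm : 0 ≤ m
  · refine ⟨conj c, m.natAbs, .inr fun y => ?_⟩
    rw [sphericalHarmonic, if_pos hm, hc, map_mul]
  · refine ⟨(-1) ^ m.natAbs * c, m.natAbs, .inl fun y => ?_⟩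
    rw [sphericalHarmonic, if_neg hm, hc]
    simp only [map_mul, map_pow, map_neg, map_one, Complex.conj_conj]
    ring

/-- The function `χ(‖x - τ‖) conj Y_L((x - τ)/‖x - τ‖)`. -/
noncomputable def radialHarmonic (χ : ℝ → ℝ) (τ : E3) (l : ℕ) (m : ℤ) (x : E3) : ℂ :=
  (χ ‖x - τ‖ : ℂ) * conj (sphericalHarmonic l m (direction τ x))

lemma laplacian_comp_sub {A : Type*} [NormedAddCommGroup A] [NormedSpace ℝ A] (f : E3 → A)
    (τ x : E3) : Δ (fun x => f (x - τ)) x = Δ f (x - τ) := by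
  rw [InnerProductSpace.laplacian_eq_iteratedFDeriv_stdOrthonormalBasis,
    InnerProductSpace.laplacian_eq_iteratedFDeriv_stdOrthonormalBasis]
  simp only [iteratedFDeriv_comp_sub]

/-- Up to a constant, `conj Y_L` is `directionHarmonic` or its conjugate. Both are images under a
real-linear map of `ℂ`, and such maps commute with the Laplacian, so one computation covers both
signs of `m`. -/
lemma radialHarmonic_of_ne {χ : ℝ → ℝ} (hχ : ContDiff ℝ ∞ χ) (τ : E3) (l : ℕ) (m : ℤ) {x : E3}
    (hx : x ≠ τ) : ContDiffAt ℝ ∞ (radialHarmonic χ τ l m) x ∧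
      Δ (radialHarmonic χ τ l m) x =
        ((deriv (deriv χ) ‖x - τ‖ + 2 / ‖x - τ‖ * deriv χ ‖x - τ‖ -
          l * (l + 1) / ‖x - τ‖ ^ 2 * χ ‖x - τ‖ : ℝ) : ℂ) *
          conj (sphericalHarmonic l m (direction τ x)) := by
  have hx' : x - τ ≠ 0 := sub_ne_zero.2 hx
  have hsub : ContDiffAt ℝ ∞ (fun x : E3 => x - τ) x := by fun_prop
  obtain ⟨c, k, h⟩ := exists_conj_sphericalHarmonic_eq l m
  have h1 := contDiffAt_radial_mul_directionHarmonic hχ l k hx'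
  have h2 := laplacian_radial_mul_directionHarmonic hχ l k hx'
  have hfin : ∀ L : ℂ →L[ℝ] ℂ, (∀ y : E3, (χ ‖y‖ : ℂ) *
      conj (sphericalHarmonic l m (‖y‖⁻¹ • y)) = L ((χ ‖y‖ : ℂ) * directionHarmonic l k y)) →
      (∀ a : ℝ, (a : ℂ) * conj (sphericalHarmonic l m (direction τ x)) =
        L ((a : ℂ) * directionHarmonic l k (x - τ))) →
      ContDiffAt ℝ ∞ (radialHarmonic χ τ l m) x ∧
      Δ (radialHarmonic χ τ l m) x =
        ((deriv (deriv χ) ‖x - τ‖ + 2 / ‖x - τ‖ * deriv χ ‖x - τ‖ -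
          l * (l + 1) / ‖x - τ‖ ^ 2 * χ ‖x - τ‖ : ℝ) : ℂ) *
          conj (sphericalHarmonic l m (direction τ x)) := by
    intro L hL hL'
    have he : radialHarmonic χ τ l m = fun x =>
        (L ∘ fun y : E3 => (χ ‖y‖ : ℂ) * directionHarmonic l k y) (x - τ) :=
      funext fun x => hL (x - τ)
    rw [he]
    have h3 : ContDiffAt ℝ ∞ (L ∘ fun y : E3 => (χ ‖y‖ : ℂ) * directionHarmonic l k y) (x - τ) :=
      L.contDiff.contDiffAt.comp _ h1
    refine ⟨ContDiffAt.comp (f := fun x : E3 => x - τ) x h3 hsub, ?_⟩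
    rw [laplacian_comp_sub, (h1.of_le two_le_infty).laplacian_CLM_comp_left, Function.comp, h2, hL']
  rcases h with h | h
  · refine hfin ((ContinuousLinearMap.mul ℝ ℂ) c) (fun y => ?_) fun a => ?_
    · rw [h, ContinuousLinearMap.mul_apply']; ring
    · rw [direction, h, ContinuousLinearMap.mul_apply']; ring
  · refine hfin (((ContinuousLinearMap.mul ℝ ℂ) c).comp (Complex.conjCLE : ℂ →L[ℝ] ℂ))
      (fun y => ?_) fun a => ?_
    · rw [h]
      simp
      ring
    · rw [direction, h]
      simp
      ring

/-- The direction is singular only at `τ`, where the factor `χ` vanishes identically nearby. Hence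
the product is an admissible test function in space and `Δ - λ²` acts on it through the radial
operator. -/
lemma radialHarmonic_isTest {R : ℝ} {χ : ℝ → ℝ} (hχ : IsRadialTest R χ) (lam : ℝ) (τ : E3) (l : ℕ)
    (m : ℤ) : ContDiff ℝ ∞ (radialHarmonic χ τ l m) ∧
      HasCompactSupport (radialHarmonic χ τ l m) ∧
      tsupport (radialHarmonic χ τ l m) ⊆ ball τ R ∧
      ∀ x, Δ (radialHarmonic χ τ l m) x - (lam : ℂ) ^ 2 * radialHarmonic χ τ l m x =
        (radialOp lam l χ ‖x - τ‖ : ℂ) * conj (sphericalHarmonic l m (direction τ x)) := by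
  obtain ⟨hχ, c, d, hc, hcd, hd, h⟩ := hχ
  have h0 : radialHarmonic χ τ l m =ᶠ[nhds τ] fun _ => 0 := by
    filter_upwards [ball_mem_nhds τ hc] with x hx
    rw [radialHarmonic, h _ fun h' => (h'.1.trans (mem_ball_iff_norm.1 hx)).false]
    simp
  have hsupp : tsupport (radialHarmonic χ τ l m) ⊆ closedBall τ d := by
    refine closure_minimal (fun x hx => ?_) isClosed_closedBall
    by_contra hx'
    refine hx ?_
    rw [radialHarmonic, h _ fun h' => hx' (mem_closedBall_iff_norm.2 h'.2.le)]
    simp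
  refine ⟨contDiff_iff_contDiffAt.2 fun x => ?_,
    (isCompact_closedBall τ d).of_isClosed_subset isClosed_closure hsupp,
    hsupp.trans (closedBall_subset_ball hd), fun x => ?_⟩
  · by_cases hx : x = τ
    · rw [hx]
      exact contDiffAt_const.congr_of_eventuallyEq h0
    · exact (radialHarmonic_of_ne hχ τ l m hx).1
  · by_cases hx : x = τ
    · rw [hx, (InnerProductSpace.laplacian_congr_nhds h0).eq_of_nhds, h0.self_of_nhds, sub_self, norm_zero,
        radialOp_eq_zero_of_eq_zero h fun h' => hc.not_ge h'.1]
      simp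
    · rw [(radialHarmonic_of_ne hχ τ l m hx).2, radialHarmonic, radialOp]
      push_cast
      ring

/-! ### Radial components -/

lemma continuous_sphericalHarmonic (l : ℕ) (m : ℤ) : Continuous (sphericalHarmonic l m) := by
  have h : ∀ k, Continuous (sphericalHarmonicNonneg l k) := fun k => by
    unfold sphericalHarmonicNonneg
    have := (Polynomial.derivative^[k] (legendreP l)).continuous
    fun_prop
  unfold sphericalHarmonic
  split_ifs
  · exact h _
  · exact continuous_const.mul (Complex.continuous_conj.comp (h _))

lemma norm_direction_le (τ x : E3) : ‖direction τ x‖ ≤ 1 := by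
  rw [norm_smul, norm_inv, norm_norm]
  exact inv_mul_le_one

lemma exists_norm_sphericalHarmonic_le (l : ℕ) (m : ℤ) :
    ∃ C, ∀ v : E3, ‖v‖ ≤ 1 → ‖sphericalHarmonic l m v‖ ≤ C := by
  obtain ⟨C, hC⟩ := (isCompact_closedBall (0 : E3) 1).exists_bound_of_continuousOn
    (continuous_sphericalHarmonic l m).continuousOn
  exact ⟨C, fun v hv => hC v (mem_closedBall_zero_iff.2 hv)⟩

lemma measurable_direction (τ : E3) : Measurable (direction τ) := by
  unfold direction; fun_prop

lemma direction_add_smul (τ : E3) {r : ℝ} (hr : 0 < r) (n : sphere (0 : E3) 1) :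
    direction τ (τ + r • (n : E3)) = n := by
  rw [direction, add_sub_cancel_left, norm_smul, norm_eq_of_mem_sphere, mul_one,
    Real.norm_of_nonneg hr.le, smul_smul, inv_mul_cancel₀ hr.ne', one_smul]

lemma norm_add_smul_sub (τ : E3) {r : ℝ} (hr : 0 ≤ r) (n : sphere (0 : E3) 1) :
    ‖τ + r • (n : E3) - τ‖ = r := by
  rw [add_sub_cancel_left, norm_smul, norm_eq_of_mem_sphere, mul_one, Real.norm_of_nonneg hr]

lemma integrableOn_mul_sphericalHarmonic {f : E3 → ℂ} {τ : E3} {s : Set E3}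
    (hf : IntegrableOn f s) (l : ℕ) (m : ℤ) :
    IntegrableOn (fun x => f x * sphericalHarmonic l m (direction τ x)) s := by
  obtain ⟨C, hC⟩ := exists_norm_sphericalHarmonic_le l m
  exact hf.mul_bdd (c := C) ((continuous_sphericalHarmonic l m).measurable.comp
    (measurable_direction τ)).aestronglyMeasurable
    (.of_forall fun x => hC _ (norm_direction_le τ x))

lemma integrableOn_mul_conj_sphericalHarmonic {f : E3 → ℂ} {τ : E3} {s : Set E3}
    (hf : IntegrableOn f s) (l : ℕ) (m : ℤ) :
    IntegrableOn (fun x => f x * conj (sphericalHarmonic l m (direction τ x))) s := by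
  obtain ⟨C, hC⟩ := exists_norm_sphericalHarmonic_le l m
  refine hf.mul_bdd (c := C) (Complex.continuous_conj.measurable.comp
    ((continuous_sphericalHarmonic l m).measurable.comp
    (measurable_direction τ))).aestronglyMeasurable
    (.of_forall fun x => ?_)
  simpa using hC _ (norm_direction_le τ x)

lemma polar_radialComponent {f : E3 → ℂ} {τ : E3} {R : ℝ} (hR : 0 < R)
    (hf : IntegrableOn f (ball τ R)) (l : ℕ) (m : ℤ) :
    IntervalIntegrable (fun r => radialComponent f τ l m r * (r : ℂ) ^ 2) volume 0 R ∧
      ∫ x in ball τ R, f x * conj (sphericalHarmonic l m (direction τ x)) =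
        ∫ r in (0 : ℝ)..R, r ^ 2 • radialComponent f τ l m r := by
  obtain ⟨h1, h2⟩ := polar_coordinates_ball hR (integrableOn_mul_conj_sphericalHarmonic (τ := τ) hf l m)
  have he : ∀ r ∈ Ioc 0 R, r ^ 2 • ∫ n, f (τ + r • (n : E3)) *
      conj (sphericalHarmonic l m (direction τ (τ + r • (n : E3)))) ∂sphereMeasure =
      r ^ 2 • radialComponent f τ l m r := fun r hr => by
    simp only [direction_add_smul τ hr.1]
    rfl
  constructor
  · refine h1.congr fun r hr => ?_
    rw [uIoc_of_le hR.le] at hr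
    simp only [he r hr, Complex.real_smul]
    push_cast
    ring
  · rw [h2]
    refine intervalIntegral.integral_congr_ae (.of_forall fun r hr => ?_)
    rw [uIoc_of_le hR.le] at hr
    exact he r hr

lemma radialComponent_radial_mul (f : E3 → ℂ) (ψ : ℝ → ℝ) (τ : E3) (l : ℕ) (m : ℤ) {r : ℝ}
    (hr : 0 ≤ r) : radialComponent (fun x => (ψ ‖x - τ‖ : ℂ) * f x) τ l m r =
      (ψ r : ℂ) * radialComponent f τ l m r := by
  simp only [radialComponent, norm_add_smul_sub τ hr, mul_assoc]
  exact integral_const_mul _ _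

lemma integral_ball_mul_radial {f : E3 → ℂ} {τ : E3} {R : ℝ} (hR : 0 < R)
    (hf : IntegrableOn f (ball τ R)) {ψ : ℝ → ℝ} (hψ : Continuous ψ) (l : ℕ) (m : ℤ) :
    ∫ x in ball τ R, f x * ((ψ ‖x - τ‖ : ℂ) * conj (sphericalHarmonic l m (direction τ x))) =
      ∫ r in (0 : ℝ)..R, (ψ r * r ^ 2) • radialComponent f τ l m r := by
  have hψf : IntegrableOn (fun x => (ψ ‖x - τ‖ : ℂ) * f x) (ball τ R) :=
    hf.continuousOn_mul_of_subset (K := closedBall τ R) (by fun_prop) (isCompact_closedBall _ _)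
      measurableSet_ball ball_subset_closedBall
  have h := (polar_radialComponent hR hψf l m).2
  rw [show ∫ x in ball τ R, f x * ((ψ ‖x - τ‖ : ℂ) *
      conj (sphericalHarmonic l m (direction τ x))) = ∫ x in ball τ R, ((ψ ‖x - τ‖ : ℂ) * f x) *
      conj (sphericalHarmonic l m (direction τ x)) by congr 1; ext x; ring, h]
  refine intervalIntegral.integral_congr fun r hr => ?_
  rw [uIcc_of_le hR.le] at hr
  simp only [radialComponent_radial_mul f ψ τ l m hr.1, Complex.real_smul]
  push_cast
  ring

lemma add_smul_mem_closedBall (τ : E3) {r R : ℝ} (hr : r ∈ Icc 0 R) (n : sphere (0 : E3) 1) :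
    τ + r • (n : E3) ∈ closedBall τ R := by
  rw [mem_closedBall_iff_norm, norm_add_smul_sub τ hr.1]; exact hr.2

lemma continuousOn_radialComponent {f : E3 → ℂ} {τ : E3} {R : ℝ}
    (hf : ContinuousOn f (closedBall τ R)) (l : ℕ) (m : ℤ) :
    ContinuousOn (radialComponent f τ l m) (Icc 0 R) := by
  obtain ⟨C, hC⟩ := exists_norm_sphericalHarmonic_le l m
  obtain ⟨M, hM⟩ := (isCompact_closedBall τ R).exists_bound_of_continuousOn hf
  have hY := continuous_sphericalHarmonic l m
  refine continuousOn_of_dominated (bound := fun _ => M * C) (fun r hr => ?_) (fun r hr => ?_)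
    (integrable_const _) (.of_forall fun n => ?_)
  · refine Continuous.aestronglyMeasurable ?_
    refine Continuous.mul ?_ (Complex.continuous_conj.comp (hY.comp continuous_subtype_val))
    exact hf.comp_continuous (by fun_prop) fun n => add_smul_mem_closedBall τ hr n
  · refine .of_forall fun n => ?_
    have h1 := hM _ (add_smul_mem_closedBall τ hr n)
    have h2 := hC n (norm_eq_of_mem_sphere n).le
    rw [norm_mul, RCLike.norm_conj]
    exact mul_le_mul h1 h2 (norm_nonneg _) ((norm_nonneg _).trans h1)
  · refine ContinuousOn.mul ?_ continuousOn_const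
    exact hf.comp (by fun_prop) fun r hr => add_smul_mem_closedBall τ hr n

/-! ### The radial components of a solution of the Dirichlet problem -/

lemma contDiff_laplacian {A : Type*} [NormedAddCommGroup A] [NormedSpace ℝ A] {f : E3 → A}
    (hf : ContDiff ℝ ∞ f) : ContDiff ℝ ∞ (Δ f) := by
  rw [show Δ f = fun x => ∑ i, fderiv ℝ (fderiv ℝ f) x (stdVec i) (stdVec i) from
    funext (laplacian_eq_sum_fderiv f)]
  have h1 : ContDiff ℝ ∞ (fderiv ℝ f) := hf.fderiv_right (by simp)
  have h2 : ContDiff ℝ ∞ (fderiv ℝ (fderiv ℝ f)) := h1.fderiv_right (by simp)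
  exact ContDiff.sum fun i _ => (h2.clm_apply contDiff_const).clm_apply contDiff_const

namespace IsDirichletSolution

variable {lam R : ℝ} {τ : E3} {ρ VI V : E3 → ℂ}

lemma integrableOn (hV : IsDirichletSolution lam τ R ρ VI V) : IntegrableOn V (ball τ R) :=
  (hV.continuousOn.integrableOn_compact (isCompact_closedBall τ R)).mono_set ball_subset_closedBall

/-- The definition tests with real functions only. Both sides are linear in the test function, so
real and imaginary parts combine; this is needed because `conj Y_L` is complex. -/
lemma equation_complex (hρ : IntegrableOn ρ (ball τ R)) (hV : IsDirichletSolution lam τ R ρ VI V)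
    {ζ : E3 → ℂ} (h1 : ContDiff ℝ ∞ ζ) (h2 : HasCompactSupport ζ) (h3 : tsupport ζ ⊆ ball τ R) :
    ∫ x in ball τ R, V x * (Δ ζ x - (lam : ℂ) ^ 2 * ζ x) =
      -(4 * Real.pi) * ∫ x in ball τ R, ρ x * ζ x := by
  have hpart : ∀ L : ℂ →L[ℝ] ℝ, ∫ x in ball τ R, V x *
      ((L (Δ ζ x - (lam : ℂ) ^ 2 * ζ x) : ℝ) : ℂ) =
        -(4 * Real.pi) * ∫ x in ball τ R, ρ x * ((L (ζ x) : ℝ) : ℂ) := by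
    intro L
    have hs : tsupport (L ∘ ζ) ⊆ tsupport ζ := closure_mono fun x hx hx' => hx (by simp [hx'])
    refine Eq.trans ?_ (hV.equation (L ∘ ζ) (L.contDiff.comp h1)
      (h2.isCompact.of_isClosed_subset isClosed_closure hs) (hs.trans h3))
    congr 1
    ext x
    rw [(h1.contDiffAt.of_le two_le_infty).laplacian_CLM_comp_left]
    simp only [Function.comp, map_sub]
    congr 3
    rw [← smul_eq_mul (lam ^ 2), ← map_smul, Complex.real_smul]
    push_cast
    rfl
  have hint : ∀ {f F : E3 → ℂ} (L : ℂ →L[ℝ] ℝ), IntegrableOn f (ball τ R) → Continuous F →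
      IntegrableOn (fun x => f x * ((L (F x) : ℝ) : ℂ)) (ball τ R) := by
    intro f F L hf hF
    exact hf.mul_continuousOn_of_subset (K := closedBall τ R) (by fun_prop)
      measurableSet_ball (isCompact_closedBall _ _) ball_subset_closedBall
  have hsplit : ∀ {f F : E3 → ℂ}, IntegrableOn f (ball τ R) → Continuous F →
      ∫ x in ball τ R, f x * F x = (∫ x in ball τ R, f x * ((Complex.reCLM (F x) : ℝ) : ℂ)) +
        (∫ x in ball τ R, f x * ((Complex.imCLM (F x) : ℝ) : ℂ)) * Complex.I := by
    intro f F hf hF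
    rw [← integral_mul_const, ← integral_add (hint _ hf hF) ((hint _ hf hF).mul_const _)]
    congr 1
    ext x
    conv_lhs => rw [← Complex.re_add_im (F x)]
    simp only [Complex.reCLM_apply, Complex.imCLM_apply]
    ring
  rw [hsplit (F := fun x => Δ ζ x - (lam : ℂ) ^ 2 * ζ x) hV.integrableOn ((contDiff_laplacian h1).continuous.sub
    (continuous_const.mul h1.continuous)), hsplit hρ h1.continuous, hpart, hpart]
  ring

/-- Test the equation with `χ(‖x - τ‖) conj Y_L` and pass to polar coordinates. -/
lemma isWeakRadialSolution (hR : 0 < R) (hρ : IntegrableOn ρ (ball τ R))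
    (hV : IsDirichletSolution lam τ R ρ VI V) (l : ℕ) (m : ℤ) :
    IsWeakRadialSolution lam R l (radialComponent V τ l m) (radialComponent ρ τ l m) := by
  intro χ hχ
  obtain ⟨h1, h2, h3, h4⟩ := radialHarmonic_isTest hχ lam τ l m
  have h := hV.equation_complex hρ h1 h2 h3
  simp only [h4] at h
  rw [integral_ball_mul_radial hR hV.integrableOn (hχ.continuous_radialOp lam l)] at h
  simp only [radialHarmonic] at h
  rw [integral_ball_mul_radial hR hρ hχ.1.continuous] at h
  rw [h, Complex.real_smul]
  push_cast
  ring

lemma radialComponent_boundary (hV : IsDirichletSolution lam τ R ρ VI V) (hR : 0 < R) (l : ℕ)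
    (m : ℤ) : radialComponent V τ l m R = radialComponent VI τ l m R := by
  unfold radialComponent
  congr 1
  ext n
  rw [hV.boundary]
  rw [mem_sphere_iff_norm, norm_add_smul_sub τ hR.le]

/-- The radial components of a solution are given by the radial Green function. -/
theorem radialComponent_eq (hlam : 0 < lam) (hR : 0 < R) (hρ : IntegrableOn ρ (ball τ R))
    (hV : IsDirichletSolution lam τ R ρ VI V) (l : ℕ) (m : ℤ) {r : ℝ} (hr : r ∈ Ioc 0 R) :
    radialComponent V τ l m r = radialPotential lam R l (radialComponent ρ τ l m)
      (radialComponent VI τ l m R) r := by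
  rw [← hV.radialComponent_boundary hR]
  exact (hV.isWeakRadialSolution hR hρ l m).eq_radialPotential l hlam hR
    (continuousOn_radialComponent hV.continuousOn l m) (polar_radialComponent hR hρ l m).1 r hr

end IsDirichletSolution

/-! ### The representation with separate integrals -/

/-- Splitting at `r' = r` resolves the minimum and maximum, and the reflected terms of the two
pieces recombine to an integral over `[0, R]`. Separating the summands is legitimate because each is
integrable on its range. -/
lemma integral_greenFun_mul_eq {lam R : ℝ} (l : ℕ) {g : ℝ → ℂ}
    {r : ℝ} (hr : r ∈ Ioc 0 R)
    (hI : IntervalIntegrable (fun r' : ℝ => g r' * (besselI l (lam * r') : ℂ) * (r' : ℂ) ^ 2)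
      volume 0 R)
    (hK : IntervalIntegrable (fun r' : ℝ => g r' * (besselK l (lam * r') : ℂ) * (r' : ℂ) ^ 2)
      volume r R)
    (hG : IntervalIntegrable (fun r' : ℝ => (greenFun lam R l r r' : ℂ) * g r' * (r' : ℂ) ^ 2)
      volume 0 R) :
    ∫ r' in (0 : ℝ)..R, (greenFun lam R l r r' : ℂ) * g r' * (r' : ℂ) ^ 2 =
      4 * (Real.pi : ℂ) * (lam : ℂ) *
        ((∫ r' in (0 : ℝ)..r, g r' * (besselI l (lam * r') : ℂ) * (r' : ℂ) ^ 2) *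
            (besselK l (lam * r) : ℂ)
          + (∫ r' in r..R, g r' * (besselK l (lam * r') : ℂ) * (r' : ℂ) ^ 2) *
            (besselI l (lam * r) : ℂ)
          - (∫ r' in (0 : ℝ)..R, g r' * (besselI l (lam * r') : ℂ) * (r' : ℂ) ^ 2) *
            ((besselI l (lam * r) * (besselK l (lam * R) / besselI l (lam * R)) : ℝ) : ℂ)) := by
  have hR : 0 ≤ R := hr.1.le.trans hr.2
  have s1 : uIcc 0 r ⊆ uIcc 0 R := by
    rw [uIcc_of_le hr.1.le, uIcc_of_le hR]; exact Icc_subset_Icc_right hr.2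
  have s2 : uIcc r R ⊆ uIcc 0 R := by
    rw [uIcc_of_le hr.2, uIcc_of_le hR]; exact Icc_subset_Icc_left hr.1.le
  have hI1 := hI.mono_set s1
  have hI2 := hI.mono_set s2
  rw [← intervalIntegral.integral_add_adjacent_intervals (hG.mono_set s1) (hG.mono_set s2),
    ← intervalIntegral.integral_add_adjacent_intervals hI1 hI2]
  set q := besselK l (lam * R) / besselI l (lam * R)
  have e1 : ∫ r' in (0 : ℝ)..r, (greenFun lam R l r r' : ℂ) * g r' * (r' : ℂ) ^ 2 =
      (4 * (Real.pi : ℂ) * lam * (besselK l (lam * r) - besselI l (lam * r) * q)) *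
      ∫ r' in (0 : ℝ)..r, g r' * (besselI l (lam * r') : ℂ) * (r' : ℂ) ^ 2 := by
    rw [← intervalIntegral.integral_const_mul]
    refine intervalIntegral.integral_congr fun r' hr' => ?_
    rw [uIcc_of_le hr.1.le] at hr'
    simp only [greenFun, q, min_eq_right hr'.2, max_eq_left hr'.2]
    push_cast
    ring
  have e2 : ∫ r' in r..R, (greenFun lam R l r r' : ℂ) * g r' * (r' : ℂ) ^ 2 =
      (4 * (Real.pi : ℂ) * lam * besselI l (lam * r)) *
        (∫ r' in r..R, g r' * (besselK l (lam * r') : ℂ) * (r' : ℂ) ^ 2) -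
      (4 * (Real.pi : ℂ) * lam * besselI l (lam * r) * q) *
        ∫ r' in r..R, g r' * (besselI l (lam * r') : ℂ) * (r' : ℂ) ^ 2 := by
    rw [← intervalIntegral.integral_const_mul, ← intervalIntegral.integral_const_mul,
      ← intervalIntegral.integral_sub (hK.const_mul _) (hI2.const_mul _)]
    refine intervalIntegral.integral_congr fun r' hr' => ?_
    rw [uIcc_of_le hr.2] at hr'
    simp only [greenFun, q, min_eq_left hr'.1, max_eq_right hr'.1]
    push_cast
    ring
  rw [e1, e2]
  push_cast
  ring

lemma intervalIntegrable_mul_besselI (lam : ℝ) (l : ℕ) {R : ℝ} {g : ℝ → ℂ}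
    (hg : IntervalIntegrable (fun r' => g r' * (r' : ℂ) ^ 2) volume 0 R) :
    IntervalIntegrable (fun r' : ℝ => g r' * (besselI l (lam * r') : ℂ) * (r' : ℂ) ^ 2)
      volume 0 R := by
  have hc := continuous_besselI_mul lam l
  refine (hg.mul_continuousOn (g := fun r => (besselI l (lam * r) : ℂ)) (Complex.continuous_ofReal.comp hc).continuousOn).congr
    fun r _ => ?_
  ring

lemma intervalIntegrable_mul_besselK {lam : ℝ} (hlam : 0 < lam) (l : ℕ) {R : ℝ} {g : ℝ → ℂ}
    (hg : IntervalIntegrable (fun r' => g r' * (r' : ℂ) ^ 2) volume 0 R) {r : ℝ}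
    (hr : r ∈ Ioc 0 R) :
    IntervalIntegrable (fun r' : ℝ => g r' * (besselK l (lam * r') : ℂ) * (r' : ℂ) ^ 2)
      volume r R := by
  have hR : 0 ≤ R := hr.1.le.trans hr.2
  have s2 : uIcc r R ⊆ uIcc 0 R := by
    rw [uIcc_of_le hr.2, uIcc_of_le hR]; exact Icc_subset_Icc_left hr.1.le
  refine ((hg.mono_set s2).mul_continuousOn (g := fun r => (besselK l (lam * r) : ℂ)) ?_).congr
    fun r _ => ?_
  · rw [uIcc_of_le hr.2]
    refine Complex.continuous_ofReal.comp_continuousOn fun s hs => ?_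
    exact (contDiffAt_besselK_mul l
      (mul_pos hlam (hr.1.trans_le hs.1)).ne').continuousAt.continuousWithinAt
  · ring

/-! ### The radial potential of a continuous density -/

section RadialPotential

variable {lam R : ℝ} (l : ℕ) {g h : ℝ → ℂ}

lemma intervalIntegrable_mul_sq (hR : 0 < R) (hg : ContinuousOn g (Icc 0 R)) :
    IntervalIntegrable (fun r' => g r' * (r' : ℂ) ^ 2) volume 0 R := by
  refine ContinuousOn.intervalIntegrable ?_
  rw [uIcc_of_le hR.le]
  exact hg.mul (by fun_prop)

/-- For a continuous density the uniform bound on `|G| r'²` is a dominating function up to and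
including `r = 0`. -/
lemma continuousOn_radialPotential (hlam : 0 < lam) (hR : 0 < R) (hg : ContinuousOn g (Icc 0 R))
    (b : ℂ) : ContinuousOn (radialPotential lam R l g b) (Icc 0 R) := by
  obtain ⟨C, hC0, hC⟩ := exists_abs_greenFun_mul_sq_le l hlam hR
  obtain ⟨M, hM⟩ := isCompact_Icc.exists_bound_of_continuousOn hg
  refine ContinuousOn.add (fun r hr => ?_) ?_
  · refine intervalIntegral.continuousWithinAt_of_dominated_interval (bound := fun _ => C * M)
      ?_ ?_ intervalIntegrable_const ?_
    · rw [uIoc_of_le hR.le]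
      exact .of_forall fun s => aestronglyMeasurable_greenFun_mul l
        (intervalIntegrable_mul_sq hR hg) s
    · filter_upwards [self_mem_nhdsWithin] with s hs
      refine .of_forall fun r' hr' => ?_
      rw [uIoc_of_le hR.le] at hr'
      have h1 := hC s hs r' (Ioc_subset_Icc_self hr')
      have h2 := hM r' (Ioc_subset_Icc_self hr')
      rw [norm_greenFun_mul, norm_mul, norm_pow, Complex.norm_real, Real.norm_eq_abs, sq_abs,
        mul_comm ‖g r'‖, ← mul_assoc]
      exact mul_le_mul h1 h2 (norm_nonneg _) hC0
    · refine .of_forall fun r' hr' => ContinuousAt.continuousWithinAt ?_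
      rw [uIoc_of_le hR.le] at hr'
      have h1 : ContinuousAt (fun s => greenFun lam R l s r') r :=
        ContinuousAt.comp (f := fun s : ℝ => (s, r')) (continuousAt_greenFun l hlam
          (p := (r, r')) (lt_max_of_lt_right hr'.1)) (by fun_prop)
      have h2 := Complex.continuous_ofReal.continuousAt.comp h1
      exact (h2.mul continuousAt_const).mul continuousAt_const
  · have := continuous_besselI_mul lam l
    exact continuousOn_const.mul (Complex.continuous_ofReal.comp (this.div_const _)).continuousOn

lemma besselI_zero {l : ℕ} (hl : l ≠ 0) : besselI l 0 = 0 := by simp [besselI, hl]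

/-- At the centre `min 0 r' = 0` and `i_ℓ(0) = 0` for `ℓ ≥ 1`. This makes the sum over `L`
continuous at `τ`, where there is no direction. -/
lemma radialPotential_zero {l : ℕ} (hl : l ≠ 0) (hR : 0 < R) (b : ℂ) :
    radialPotential lam R l g b 0 = 0 := by
  have : ∫ r' in (0 : ℝ)..R, (greenFun lam R l 0 r' : ℂ) * g r' * (r' : ℂ) ^ 2 = 0 := by
    refine (intervalIntegral.integral_congr fun r hr => ?_).trans intervalIntegral.integral_zero
    rw [uIcc_of_le hR.le] at hr
    simp [greenFun, min_eq_left hr.1, besselI_zero hl]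
  simp [radialPotential, this, besselI_zero hl]

/-- The radial Green operator is symmetric with respect to `r² dr`. -/
lemma integral_greenFun_mul_symm (hlam : 0 < lam) (hR : 0 < R) (hg : ContinuousOn g (Icc 0 R))
    (hh : ContinuousOn h (Icc 0 R)) :
    ∫ r in (0 : ℝ)..R, (∫ r' in (0 : ℝ)..R, (greenFun lam R l r r' : ℂ) * g r' * (r' : ℂ) ^ 2) *
      h r * (r : ℂ) ^ 2 =
    ∫ r in (0 : ℝ)..R, g r * (∫ r' in (0 : ℝ)..R, (greenFun lam R l r r' : ℂ) * h r' *
      (r' : ℂ) ^ 2) * (r : ℂ) ^ 2 := by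
  obtain ⟨C, hC0, hC⟩ := exists_abs_greenFun_mul_sq_le l hlam hR
  set μ := volume.restrict (Ioc 0 R) with hμ
  have hgi : Integrable g μ :=
    (hg.integrableOn_compact isCompact_Icc).mono_set Ioc_subset_Icc_self
  have hhi : Integrable (fun r => h r * (r : ℂ) ^ 2) μ := (intervalIntegrable_mul_sq hR hh).1
  have hF : Integrable (Function.uncurry fun r r' : ℝ =>
      ((greenFun lam R l r r' * r' ^ 2 : ℝ) : ℂ) * (h r * (r : ℂ) ^ 2 * g r')) (μ.prod μ) := by
    refine (hhi.mul_prod hgi).bdd_mul (c := C) ?_ ?_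
    · refine (Complex.measurable_ofReal.comp (Measurable.mul
        (measurable_greenFun l) ?_)).aestronglyMeasurable
      fun_prop
    · rw [hμ, Measure.prod_restrict]
      filter_upwards [ae_restrict_mem (measurableSet_Ioc.prod measurableSet_Ioc)] with p hp
      rw [Complex.norm_real, norm_mul, Real.norm_eq_abs, norm_pow, Real.norm_eq_abs, sq_abs]
      exact hC _ (Ioc_subset_Icc_self hp.1) _ (Ioc_subset_Icc_self hp.2)
  simp only [intervalIntegral.integral_of_le hR.le]
  calc _ = ∫ r, ∫ r', ((greenFun lam R l r r' * r' ^ 2 : ℝ) : ℂ) *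
        (h r * (r : ℂ) ^ 2 * g r') ∂μ ∂μ := by
        refine integral_congr_ae (.of_forall fun r => ?_)
        simp only
        rw [mul_assoc, ← integral_mul_const]
        refine integral_congr_ae (.of_forall fun r' => ?_)
        simp only
        push_cast
        ring
    _ = _ := integral_integral_swap hF
    _ = _ := by
        refine integral_congr_ae (.of_forall fun r => ?_)
        simp only
        rw [mul_right_comm, ← integral_const_mul]
        refine integral_congr_ae (.of_forall fun r' => ?_)
        simp only [greenFun_comm l r' r]
        push_cast
        ring

end RadialPotential

/-! ### Finite sums of spherical harmonics -/

lemma sphericalHarmonic_zero_eq {m : ℤ} (hm : m = 0) (v w : E3) :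
    sphericalHarmonic 0 m v = sphericalHarmonic 0 m w := by
  simp [hm, sphericalHarmonic, sphericalHarmonicNonneg, legendreP]

/-- Only `x = τ` is delicate. For `ℓ = 0` the harmonic is constant, so its value at the default
direction `0` is the right one; for `ℓ ≥ 1` it is bounded and the coefficient tends to `0`. -/
lemma continuousOn_mul_sphericalHarmonic {a : ℝ → ℂ} {τ : E3} {R : ℝ} (l : ℕ) {m : ℤ}
    (hm : |m| ≤ l) (ha : ContinuousOn a (Icc 0 R)) (h0 : l ≠ 0 → a 0 = 0) :
    ContinuousOn (fun x => a ‖x - τ‖ * sphericalHarmonic l m (direction τ x))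
      (closedBall τ R) := by
  have hmaps : MapsTo (fun x => ‖x - τ‖) (closedBall τ R) (Icc 0 R) := fun x hx =>
    ⟨norm_nonneg _, mem_closedBall_iff_norm.1 hx⟩
  have ha' : ContinuousOn (fun x => a ‖x - τ‖) (closedBall τ R) :=
    ha.comp (f := fun x => ‖x - τ‖) (by fun_prop) hmaps
  by_cases hl : l = 0
  · subst hl
    have hm : m = 0 := by simpa using hm
    simp only [fun x => sphericalHarmonic_zero_eq hm (direction τ x) 0]
    exact ha'.mul continuousOn_const
  intro x hx
  by_cases hxt : x = τ
  · subst hxt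
    obtain ⟨C, hC⟩ := exists_norm_sphericalHarmonic_le l m
    have h1 := ha' x hx
    simp only [ContinuousWithinAt, sub_self, norm_zero, h0 hl, zero_mul] at h1 ⊢
    refine squeeze_zero_norm (a := fun y => ‖a ‖y - x‖‖ * C) (fun y => ?_) ?_
    · rw [norm_mul]
      exact mul_le_mul_of_nonneg_left (hC _ (norm_direction_le x y)) (norm_nonneg _)
    · simpa using h1.norm.mul_const C
  · refine (ha' x hx).mul (ContinuousAt.continuousWithinAt ?_)
    refine (continuous_sphericalHarmonic l m).continuousAt.comp (f := direction τ) ?_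
    have : ‖x - τ‖ ≠ 0 := norm_ne_zero_iff.2 (sub_ne_zero.2 hxt)
    unfold direction
    fun_prop (disch := assumption)

lemma continuousOn_harmonicSum {a : ℕ → ℤ → ℝ → ℂ} {N : ℕ} {τ : E3} {R : ℝ}
    (ha : ∀ l m, ContinuousOn (a l m) (Icc 0 R)) (h0 : ∀ l m, l ≠ 0 → a l m 0 = 0) :
    ContinuousOn (harmonicSum a N τ) (closedBall τ R) :=
  continuousOn_finsetSum _ fun l _ => continuousOn_finsetSum _ fun m hm =>
    continuousOn_mul_sphericalHarmonic l (abs_le.2 (Finset.mem_Icc.1 hm)) (ha l m) (h0 l m)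

/-! ### Pairing with a test function -/

lemma radialComponent_conj_eq (F : E3 → ℂ) (τ : E3) (l : ℕ) (m : ℤ) (r : ℝ) :
    conj (radialComponent F τ l m r) = ∫ n : sphere (0 : E3) 1,
      conj (F (τ + r • (n : E3))) * sphericalHarmonic l m n ∂sphereMeasure := by
  rw [radialComponent, ← integral_conj]
  simp

lemma integral_mul_sphericalHarmonic_mul {a : ℝ → ℂ} {F : E3 → ℝ} {τ : E3} {R : ℝ} (hR : 0 < R)
    (ha : ContinuousOn a (Icc 0 R)) (hF : Continuous F) (l : ℕ) (m : ℤ) :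
    ∫ x in ball τ R, a ‖x - τ‖ * sphericalHarmonic l m (direction τ x) * (F x : ℂ) =
      ∫ r in (0 : ℝ)..R, a r * conj (radialComponent (fun x => (F x : ℂ)) τ l m r) *
        (r : ℂ) ^ 2 := by
  have ha' : ContinuousOn (fun x => a ‖x - τ‖ * (F x : ℂ)) (closedBall τ R) :=
    (ha.comp (f := fun x => ‖x - τ‖) (by fun_prop) fun x hx =>
      ⟨norm_nonneg _, mem_closedBall_iff_norm.1 hx⟩).mul (by fun_prop)
  have hi : IntegrableOn (fun x => a ‖x - τ‖ * (F x : ℂ)) (ball τ R) :=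
    (ha'.integrableOn_compact (isCompact_closedBall τ R)).mono_set ball_subset_closedBall
  have h2 := (polar_coordinates_ball hR (integrableOn_mul_sphericalHarmonic (τ := τ) hi l m)).2
  simp only [mul_right_comm (a _) (sphericalHarmonic _ _ _)]
  rw [h2]
  refine intervalIntegral.integral_congr_ae (.of_forall fun r hr => ?_)
  rw [uIoc_of_le hR.le] at hr
  simp only [direction_add_smul τ hr.1, norm_add_smul_sub τ hr.1.le, radialComponent_conj_eq,
    Complex.conj_ofReal, Complex.real_smul, mul_assoc]
  rw [integral_const_mul]
  push_cast
  ring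

/-! ### Test functions as solutions of the Dirichlet problem -/

/-- Two integrations by parts in each coordinate; the compact support of `η` alone removes the
boundary terms. -/
lemma integral_mul_laplacian_comm {η ζ : E3 → ℝ} (hη : ContDiff ℝ ∞ η) (hηs : HasCompactSupport η)
    (hζ : ContDiff ℝ ∞ ζ) :
    ∫ x, η x * Δ ζ x = ∫ x, Δ η x * ζ x := by
  have d1 : ∀ {f : E3 → ℝ}, ContDiff ℝ ∞ f → ∀ v, ContDiff ℝ ∞ fun x => fderiv ℝ f x v :=
    fun hf v => (hf.fderiv_right (by simp)).clm_apply contDiff_const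
  have d2 : ∀ {f : E3 → ℝ}, ContDiff ℝ ∞ f → ∀ v x, fderiv ℝ (fun x => fderiv ℝ f x v) x v =
      fderiv ℝ (fderiv ℝ f) x v v := fun {f} hf v x => by
    have h1 : ContDiff ℝ ∞ (fderiv ℝ f) := hf.fderiv_right (by simp)
    have := (h1.differentiable (by simp) x).hasFDerivAt.clm_apply (hasFDerivAt_const v x)
    rw [this.fderiv]
    simp
  have hint : ∀ {f g : E3 → ℝ}, Continuous f → HasCompactSupport f → Continuous g →
      Integrable fun x => f x * g x := fun hf hfs hg =>
    (hf.mul hg).integrable_of_hasCompactSupport hfs.mul_right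
  have hparts : ∀ {f g : E3 → ℝ}, ContDiff ℝ ∞ f → HasCompactSupport f → ContDiff ℝ ∞ g → ∀ v,
      ∫ x, f x * fderiv ℝ g x v = -∫ x, fderiv ℝ f x v * g x := fun hf hfs hg v =>
    integral_mul_fderiv_eq_neg_fderiv_mul_of_integrable
      (hint (d1 hf v).continuous (hfs.fderiv_apply ℝ v) hg.continuous)
      (hint hf.continuous hfs (d1 hg v).continuous) (hint hf.continuous hfs hg.continuous)
      (fun x _ => hf.differentiable (by simp) x) (fun x _ => hg.differentiable (by simp) x)
  simp only [laplacian_eq_sum_fderiv, Finset.mul_sum, Finset.sum_mul]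
  simp only [← d2 hη, ← d2 hζ]
  rw [integral_finsetSum _ fun i _ => hint hη.continuous hηs (d1 (d1 hζ _) _).continuous,
    integral_finsetSum _ fun i _ => hint (d1 (d1 hη _) _).continuous
      ((hηs.fderiv_apply ℝ _).fderiv_apply ℝ _) hζ.continuous]
  refine Finset.sum_congr rfl fun i _ => ?_
  rw [hparts hη hηs (d1 hζ _), ← neg_eq_iff_eq_neg.2 (hparts (d1 hη _) (hηs.fderiv_apply ℝ _) hζ _)]

section TestFunction

variable {lam R : ℝ} {τ : E3} {η : E3 → ℝ}

/-- The density `-(Δη - λ²η)/(4π)`, for which `η` solves the Dirichlet problem. -/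
noncomputable def testDensity (lam : ℝ) (η : E3 → ℝ) (x : E3) : ℝ :=
  -(4 * Real.pi)⁻¹ * (Δ η x - lam ^ 2 * η x)

lemma continuous_testDensity (hη : ContDiff ℝ ∞ η) : Continuous (testDensity lam η) :=
  continuous_const.mul ((contDiff_laplacian hη).continuous.sub
    (continuous_const.mul hη.continuous))

/-- This makes the representation by the radial Green function available for test functions, which
is the input of the duality argument for existence. -/
lemma isDirichletSolution_of_test (hη : ContDiff ℝ ∞ η) (hηs : HasCompactSupport η)
    (hηR : tsupport η ⊆ ball τ R) :
    IsDirichletSolution lam τ R (fun x => (testDensity lam η x : ℂ)) 0 fun x => (η x : ℂ) where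
  continuousOn := (Complex.continuous_ofReal.comp hη.continuous).continuousOn
  boundary x hx := by
    have : η x = 0 := image_eq_zero_of_notMem_tsupport fun h =>
      (mem_ball.1 (hηR h)).ne (mem_sphere.1 hx)
    simp [this]
  equation ζ h1 h2 h3 := by
    have hz : ∀ {f : E3 → ℝ}, tsupport f ⊆ ball τ R → ∀ x ∉ ball τ R, f x = 0 := fun h x hx =>
      image_eq_zero_of_notMem_tsupport fun h' => hx (h h')
    have hη0 := hz hηR
    have hζ0 := hz h3
    simp only [← Complex.ofReal_mul, integral_complex_ofReal]
    rw [setIntegral_eq_integral_of_forall_compl_eq_zero fun x hx => by rw [hη0 x hx, zero_mul],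
      setIntegral_eq_integral_of_forall_compl_eq_zero fun x hx => by rw [hζ0 x hx, mul_zero]]
    have i1 : Integrable fun x => η x * Δ ζ x :=
      (hη.continuous.mul (contDiff_laplacian h1).continuous).integrable_of_hasCompactSupport
        hηs.mul_right
    have i2 : Integrable fun x => Δ η x * ζ x :=
      ((contDiff_laplacian hη).continuous.mul h1.continuous).integrable_of_hasCompactSupport
        h2.mul_left
    have i3 : Integrable fun x => lam ^ 2 * (η x * ζ x) :=
      ((hη.continuous.mul h1.continuous).integrable_of_hasCompactSupport hηs.mul_right).const_mul _
    have e1 : ∫ x, η x * (Δ ζ x - lam ^ 2 * ζ x) = ∫ x, (Δ η x - lam ^ 2 * η x) * ζ x := by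
      rw [show (fun x => η x * (Δ ζ x - lam ^ 2 * ζ x)) =
          fun x => η x * Δ ζ x - lam ^ 2 * (η x * ζ x) by ext x; ring,
        show (fun x => (Δ η x - lam ^ 2 * η x) * ζ x) =
          fun x => Δ η x * ζ x - lam ^ 2 * (η x * ζ x) by ext x; ring,
        integral_sub i1 i3, integral_sub i2 i3, integral_mul_laplacian_comm hη hηs h1]
    rw [e1]
    simp only [testDensity, mul_assoc]
    rw [integral_const_mul]
    have := Real.pi_ne_zero
    push_cast
    field_simp

lemma integrableOn_testDensity (hη : ContDiff ℝ ∞ η) :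
    IntegrableOn (fun x => (testDensity lam η x : ℂ)) (ball τ R) :=
  (((Complex.continuous_ofReal.comp (continuous_testDensity hη)).continuousOn).integrableOn_compact
    (isCompact_closedBall τ R)).mono_set ball_subset_closedBall

lemma continuousOn_radialComponent_testDensity (hη : ContDiff ℝ ∞ η) (l : ℕ) (m : ℤ) :
    ContinuousOn (radialComponent (fun x => (testDensity lam η x : ℂ)) τ l m) (Icc 0 R) :=
  continuousOn_radialComponent
    (Complex.continuous_ofReal.comp (continuous_testDensity hη)).continuousOn l m

lemma radialComponent_test (hlam : 0 < lam) (hR : 0 < R) (hη : ContDiff ℝ ∞ η)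
    (hηs : HasCompactSupport η) (hηR : tsupport η ⊆ ball τ R) (l : ℕ) (m : ℤ) {r : ℝ}
    (hr : r ∈ Ioc 0 R) : radialComponent (fun x => (η x : ℂ)) τ l m r =
      ∫ r' in (0 : ℝ)..R, (greenFun lam R l r r' : ℂ) *
        radialComponent (fun x => (testDensity lam η x : ℂ)) τ l m r' * (r' : ℂ) ^ 2 := by
  rw [(isDirichletSolution_of_test hη hηs hηR).radialComponent_eq hlam hR
    (integrableOn_testDensity hη) l m hr, radialPotential]
  simp [radialComponent]

/-- Evaluate the representation of `η_L` at a radius `r` between the support of `η` and `R`. There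
`η_L(r) = 0`, while the Green integral is the moment in question times `4πλ (k_ℓ(λr) - i_ℓ(λr)
k_ℓ(λR)/i_ℓ(λR))`, which is positive because `r < R` and `i_ℓ` is strictly increasing. -/
lemma integral_besselI_mul_testDensity (hlam : 0 < lam) (hR : 0 < R) (hη : ContDiff ℝ ∞ η)
    (hηs : HasCompactSupport η) (hηR : tsupport η ⊆ ball τ R) (l : ℕ) (m : ℤ) :
    ∫ r in (0 : ℝ)..R, radialComponent (fun x => (testDensity lam η x : ℂ)) τ l m r *
      (besselI l (lam * r) : ℂ) * (r : ℂ) ^ 2 = 0 := by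
  obtain ⟨d, hd, hdR, hds⟩ : ∃ d, 0 < d ∧ d < R ∧ tsupport η ⊆ closedBall τ d := by
    obtain ⟨d, hd, h⟩ := exists_pos_lt_subset_ball hR (isClosed_tsupport η) hηR
    exact ⟨d, hd.1, hd.2, h.trans ball_subset_closedBall⟩
  have hη0 : ∀ x, x ∉ closedBall τ d → η x = 0 := fun x hx =>
    image_eq_zero_of_notMem_tsupport fun h => hx (hds h)
  have hρ0 : ∀ x, x ∉ closedBall τ d → testDensity lam η x = 0 := fun x hx => by
    have : η =ᶠ[nhds x] fun _ => 0 := by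
      filter_upwards [isClosed_closedBall.isOpen_compl.mem_nhds hx] with y hy using hη0 y hy
    rw [testDensity, (InnerProductSpace.laplacian_congr_nhds this).eq_of_nhds, hη0 x hx]
    simp
  have hc0 : ∀ {f : E3 → ℝ}, (∀ x, x ∉ closedBall τ d → f x = 0) → ∀ s, d < s →
      radialComponent (fun x => (f x : ℂ)) τ l m s = 0 := fun {f} hf s hs => by
    rw [radialComponent]
    refine (integral_congr_ae (.of_forall fun n => ?_)).trans (integral_zero _ _)
    rw [hf, Complex.ofReal_zero, zero_mul]
    rw [mem_closedBall_iff_norm, norm_add_smul_sub τ (hd.trans hs).le]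
    exact hs.not_ge
  set g := radialComponent (fun x => (testDensity lam η x : ℂ)) τ l m with hg
  obtain ⟨r, hdr, hrR⟩ := exists_between hdR
  have hr : r ∈ Ioc 0 R := ⟨hd.trans hdr, hrR.le⟩
  set q := besselK l (lam * R) / besselI l (lam * R) with hq
  have h1 := radialComponent_test hlam hR hη hηs hηR l m hr
  rw [hc0 hη0 r hdr] at h1
  have h2 : ∫ r' in (0 : ℝ)..R, (greenFun lam R l r r' : ℂ) * g r' * (r' : ℂ) ^ 2 =
      ((4 * Real.pi * lam * (besselK l (lam * r) - besselI l (lam * r) * q) : ℝ) : ℂ) *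
        ∫ r' in (0 : ℝ)..R, g r' * (besselI l (lam * r') : ℂ) * (r' : ℂ) ^ 2 := by
    rw [← intervalIntegral.integral_const_mul]
    refine intervalIntegral.integral_congr fun r' hr' => ?_
    by_cases h : r' ≤ r
    · rw [greenFun, ← hq, min_eq_right h, max_eq_left h]
      push_cast
      ring
    · rw [hg, hc0 hρ0 r' (hdr.trans (not_le.1 h))]
      simp
  rw [h2] at h1
  refine (mul_eq_zero.1 h1.symm).resolve_left ?_
  have hIR := besselI_pos l (mul_pos hlam hR)
  have hKR := besselK_pos l (mul_pos hlam hR)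
  have hlt : besselI l (lam * r) < besselI l (lam * R) := besselI_strictMonoOn l
    (mul_pos hlam hr.1).le (mul_pos hlam hR).le (mul_lt_mul_of_pos_left hrR hlam)
  have hle := besselK_mul_le l hlam hr.1 hr.2
  have : besselI l (lam * r) * q < besselK l (lam * R) := by
    rw [hq, mul_div_assoc', div_lt_iff₀ hIR, mul_comm]
    exact mul_lt_mul_of_pos_left hlt hKR
  have hπ := Real.pi_pos
  have : 0 < besselK l (lam * r) - besselI l (lam * r) * q := by linarith
  exact Complex.ofReal_ne_zero.2 (by positivity)

end TestFunction

/-! ### Completeness of the spherical harmonics -/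

lemma exists_conj_sphericalHarmonic_natCast (l k : ℕ) : ∃ c : ℂ, c ≠ 0 ∧ ∀ v : E3,
    conj (sphericalHarmonic l k v) = c * (conj ((v 0 : ℂ) + (v 1 : ℂ) * Complex.I) ^ k *
      (((Polynomial.derivative^[k] (legendreP l)).eval (v 2) : ℝ) : ℂ)) := by
  refine ⟨(-1) ^ k * (Real.sqrt ((2 * l + 1) / (4 * Real.pi) *
    (((l - k)! : ℝ) / ((l + k)! : ℝ))) : ℂ), ?_, fun v => ?_⟩
  · have h1 : (0 : ℝ) < ((l - k)! : ℝ) := Nat.cast_pos.2 (Nat.factorial_pos _)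
    have h2 : (0 : ℝ) < ((l + k)! : ℝ) := Nat.cast_pos.2 (Nat.factorial_pos _)
    have := Real.pi_pos
    refine mul_ne_zero (pow_ne_zero _ (by norm_num)) (Complex.ofReal_ne_zero.2 ?_)
    exact (Real.sqrt_pos.2 (by positivity)).ne'
  · rw [sphericalHarmonic, if_pos (Int.natCast_nonneg k), Int.natAbs_natCast,
      sphericalHarmonicNonneg]
    simp only [map_mul, map_pow, map_neg, map_one, Complex.conj_ofReal]
    ring

lemma sphericalHarmonic_neg_natCast (l k : ℕ) (v : E3) :
    sphericalHarmonic l (-k) v = (-1) ^ k * conj (sphericalHarmonic l k v) := by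
  -- For `k = 0` the definition takes the nonnegative branch, and the claim is that `Y_{ℓ0}` is
  -- real.
  rcases k.eq_zero_or_pos with rfl | hk
  · simp [sphericalHarmonic, sphericalHarmonicNonneg]
  · rw [sphericalHarmonic, if_neg (by omega), sphericalHarmonic, if_pos (by omega)]
    simp

/-- The function `v ↦ v₀ + i v₁` on the unit sphere. -/
noncomputable def sphereW : C(sphere (0 : E3) 1, ℂ) :=
  ⟨fun n => ((n : E3) 0 : ℂ) + ((n : E3) 1 : ℂ) * Complex.I, by fun_prop⟩

/-- The function `v ↦ q(v₂)` on the unit sphere. -/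
noncomputable def sphereZonal (q : Polynomial ℝ) : C(sphere (0 : E3) 1, ℂ) :=
  ⟨fun n => ((q.eval ((n : E3) 2) : ℝ) : ℂ), by
    have := q.continuous
    fun_prop⟩

/-- On the unit sphere `|v₀ + i v₁|² = 1 - v₂²`, so mixed powers of `v₀ + i v₁` and its conjugate
reduce to pure ones times polynomials in `v₂`. -/
lemma sphereW_mul_star : sphereW * star sphereW = sphereZonal (1 - Polynomial.X ^ 2) := by
  ext n
  have h : ((n : E3) 0) ^ 2 + ((n : E3) 1) ^ 2 + ((n : E3) 2) ^ 2 = 1 := by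
    have := EuclideanSpace.real_norm_sq_eq (n : E3)
    rw [norm_eq_of_mem_sphere, Fin.sum_univ_three] at this
    linarith
  have h' : ((n : E3) 0) ^ 2 + ((n : E3) 1) ^ 2 = 1 - ((n : E3) 2) ^ 2 := by linarith
  simp only [sphereW, sphereZonal, ContinuousMap.mul_apply, ContinuousMap.star_apply,
    ContinuousMap.coe_mk, Polynomial.eval_sub, Polynomial.eval_one, Polynomial.eval_pow,
    Polynomial.eval_X, ← h', RCLike.star_def, map_add, map_mul, Complex.conj_ofReal, Complex.conj_I]
  push_cast
  linear_combination (-((n : E3) 1 : ℂ) ^ 2) * Complex.I_sq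

lemma sphereZonal_mul (p q : Polynomial ℝ) :
    sphereZonal (p * q) = sphereZonal p * sphereZonal q := by
  ext n
  simp [sphereZonal]

lemma star_sphereZonal (q : Polynomial ℝ) : star (sphereZonal q) = sphereZonal q := by
  ext n
  simp [sphereZonal]

lemma integrable_continuousMap_mul (f g : C(sphere (0 : E3) 1, ℂ)) :
    Integrable (fun n => f n * g n) sphereMeasure :=
  (f * g).continuous.integrable_of_hasCompactSupport (HasCompactSupport.of_compactSpace _)

/-- The functional `g ↦ ∫ f g` on the continuous functions on the unit sphere. -/
noncomputable def sphereFunctional (f : C(sphere (0 : E3) 1, ℂ)) : C(sphere (0 : E3) 1, ℂ) →L[ℂ] ℂ :=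
  LinearMap.mkContinuous
    { toFun := fun g => ∫ n, f n * g n ∂sphereMeasure
      map_add' := fun g h => by
        simp only [ContinuousMap.add_apply, mul_add]
        exact integral_add (integrable_continuousMap_mul f g) (integrable_continuousMap_mul f h)
      map_smul' := fun c g => by
        simp only [ContinuousMap.smul_apply, smul_eq_mul, mul_left_comm _ c, RingHom.id_apply]
        exact integral_const_mul _ _ }
    (∫ n, ‖f n‖ ∂sphereMeasure) fun g => by
      rw [← integral_mul_const]
      refine norm_integral_le_of_norm_le (Integrable.mul_const ?_ _) (.of_forall fun n => ?_)
      · exact f.continuous.norm.integrable_of_hasCompactSupport (HasCompactSupport.of_compactSpace _)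
      · rw [norm_mul]
        exact mul_le_mul_of_nonneg_left (g.norm_coe_le_norm n) (norm_nonneg _)

lemma sphereFunctional_apply (f g : C(sphere (0 : E3) 1, ℂ)) :
    sphereFunctional f g = ∫ n, f n * g n ∂sphereMeasure := rfl

/-- The derivatives of order `m` of the Legendre polynomials `P_m, P_{m+1}, …`. -/
noncomputable def legendreSequence (m : ℕ) : Polynomial.Sequence ℝ where
  elems' i := Polynomial.derivative^[m] (legendreP (i + m))
  degree_eq' i := by
    rw [degree_iterate_derivative_legendreP _ _ (Nat.le_add_left m i), Nat.add_sub_cancel]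

/-- The `m`-th derivatives of `P_m, P_{m+1}, …` have degrees `0, 1, …` and hence span all
polynomials. -/
lemma apply_mul_sphereZonal_eq_zero {L : C(sphere (0 : E3) 1, ℂ) →L[ℂ] ℂ}
    {u : C(sphere (0 : E3) 1, ℂ)} {m : ℕ}
    (h : ∀ l, m ≤ l → L (u * sphereZonal (Polynomial.derivative^[m] (legendreP l))) = 0)
    (q : Polynomial ℝ) : L (u * sphereZonal q) = 0 := by
  have hq : q ∈ Submodule.span ℝ (range (legendreSequence m)) := by
    rw [(legendreSequence m).span fun i => (Polynomial.leadingCoeff_ne_zero.2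
      ((legendreSequence m).ne_zero i)).isUnit]
    trivial
  induction hq using Submodule.span_induction with
  | mem x hx =>
    obtain ⟨i, rfl⟩ := hx
    exact h _ (Nat.le_add_left m i)
  | zero =>
    rw [show u * sphereZonal 0 = 0 by ext n; simp [sphereZonal], map_zero]
  | add p q _ _ hp hq =>
    rw [show u * sphereZonal (p + q) = u * sphereZonal p + u * sphereZonal q by
      ext n; simp [sphereZonal, mul_add], map_add, hp, hq, add_zero]
  | smul c p _ hp =>
    rw [show u * sphereZonal (c • p) = (c : ℂ) • (u * sphereZonal p) by
      ext n; simp [sphereZonal]; ring, map_smul, hp, smul_zero]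

/-- A continuous function on the unit sphere all of whose spherical-harmonic coefficients vanish
is zero. -/
theorem eq_zero_of_forall_integral_mul_conj_sphericalHarmonic_eq_zero
    (f : C(sphere (0 : E3) 1, ℂ))
    (h : ∀ (l : ℕ) (m : ℤ), |m| ≤ l →
      ∫ n, f n * conj (sphericalHarmonic l m (n : E3)) ∂sphereMeasure = 0) : f = 0 := by
  set L := sphereFunctional f with hL
  have hminus : ∀ m q, L (star sphereW ^ m * sphereZonal q) = 0 := fun m =>
    apply_mul_sphereZonal_eq_zero fun l hl => by
      obtain ⟨c, hc, hY⟩ := exists_conj_sphericalHarmonic_natCast l m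
      have := h l m (by simpa using hl)
      simp only [hY, mul_left_comm _ c] at this
      rw [integral_const_mul] at this
      exact (mul_eq_zero.1 this).resolve_left hc
  have hplus : ∀ m q, L (sphereW ^ m * sphereZonal q) = 0 := fun m =>
    apply_mul_sphereZonal_eq_zero fun l hl => by
      obtain ⟨c, hc, hY⟩ := exists_conj_sphericalHarmonic_natCast l m
      have := h l (-m) (by simpa using hl)
      simp only [sphericalHarmonic_neg_natCast, hY, map_mul, map_pow, map_neg, map_one,
        Complex.conj_conj, Complex.conj_ofReal] at this
      have he : ∀ n : sphere (0 : E3) 1, f n * ((-1) ^ m * (conj c *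
          ((((n : E3) 0 : ℂ) + ((n : E3) 1 : ℂ) * Complex.I) ^ m *
          (((Polynomial.derivative^[m] (legendreP l)).eval ((n : E3) 2) : ℝ) : ℂ)))) =
          ((-1) ^ m * conj c) * (f n * ((((n : E3) 0 : ℂ) + ((n : E3) 1 : ℂ) * Complex.I) ^ m *
          (((Polynomial.derivative^[m] (legendreP l)).eval ((n : E3) 2) : ℝ) : ℂ))) :=
        fun n => by ring
      simp only [he] at this
      rw [integral_const_mul] at this
      refine (mul_eq_zero.1 this).resolve_left (mul_ne_zero (pow_ne_zero _ (by norm_num)) ?_)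
      simpa using hc
  -- Each common factor of `sphereW` and `star sphereW` is absorbed into `q` until only a pure power
  -- is left, to which `hminus` or `hplus` applies.
  have hmono : ∀ a b q, L (sphereW ^ a * star sphereW ^ b * sphereZonal q) = 0 := by
    intro a
    induction a with
    | zero => intro b q; rw [pow_zero, one_mul]; exact hminus b q
    | succ a ih =>
      intro b q
      rcases b with _ | b
      · rw [pow_zero, mul_one]; exact hplus _ q
      · have := ih b ((1 - Polynomial.X ^ 2) * q)
        rw [sphereZonal_mul, ← sphereW_mul_star] at this
        rw [← this]
        congr 1
        ring
  set T : Set C(sphere (0 : E3) 1, ℂ) :=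
    {g | ∃ a b q, g = sphereW ^ a * star sphereW ^ b * sphereZonal q} with hT
  set A := StarAlgebra.adjoin ℂ {sphereW, sphereZonal Polynomial.X} with hA
  have h1 : (1 : C(sphere (0 : E3) 1, ℂ)) ∈ T := ⟨0, 0, 1, by ext n; simp [sphereZonal]⟩
  -- The set of monomials `T` is closed under products and conjugation and contains `1`, so its span
  -- contains the star algebra generated by `v₀ + i v₁` and `v₂`.
  have hAT : ∀ g ∈ A, g ∈ Submodule.span ℂ T := by
    intro g hg
    induction hg using StarAlgebra.adjoin_induction with
    | mem x hx =>
      refine Submodule.subset_span ?_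
      rcases hx with rfl | rfl
      · exact ⟨1, 0, 1, by ext n; simp [sphereZonal]⟩
      · exact ⟨0, 0, Polynomial.X, by simp⟩
    | algebraMap r =>
      rw [Algebra.algebraMap_eq_smul_one]
      exact Submodule.smul_mem _ _ (Submodule.subset_span h1)
    | add x y _ _ hx hy => exact add_mem hx hy
    | mul x y _ _ hx hy =>
      have := Submodule.mul_mem_mul hx hy
      rw [Submodule.span_mul_span] at this
      refine Submodule.span_mono ?_ this
      rintro _ ⟨_, ⟨a, b, q, rfl⟩, _, ⟨a', b', q', rfl⟩, rfl⟩
      refine ⟨a + a', b + b', q * q', ?_⟩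
      simp only [sphereZonal_mul]
      ring
    | star x hxA hx =>
      clear hxA
      induction hx using Submodule.span_induction with
      | mem x hx =>
        obtain ⟨a, b, q, rfl⟩ := hx
        refine Submodule.subset_span ⟨b, a, q, ?_⟩
        simp only [star_mul', star_pow, star_star, star_sphereZonal]
        ring
      | zero => simp
      | add x y _ _ hx hy => rw [star_add]; exact add_mem hx hy
      | smul c x _ hx => rw [star_smul]; exact Submodule.smul_mem _ _ hx
  have hLA : ∀ g ∈ A, L g = 0 := fun g hg => by
    have : Submodule.span ℂ T ≤ L.ker := Submodule.span_le.2 (by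
      rintro _ ⟨a, b, q, rfl⟩
      exact hmono a b q)
    exact this (hAT g hg)
  have hsep : A.SeparatesPoints := by
    intro x y hxy
    by_contra! hne
    have hw := hne _ ⟨sphereW, StarAlgebra.subset_adjoin ℂ _ (by simp), rfl⟩
    have hz := hne _ ⟨sphereZonal Polynomial.X, StarAlgebra.subset_adjoin ℂ _ (by simp), rfl⟩
    simp only [sphereW, sphereZonal, ContinuousMap.coe_mk, Polynomial.eval_X,
      Complex.ofReal_inj] at hw hz
    have hre := congrArg Complex.re hw
    have him := congrArg Complex.im hw
    simp at hre him
    refine hxy (Subtype.ext ?_)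
    ext i
    fin_cases i
    · exact hre
    · exact him
    · exact hz
  have hdense := ContinuousMap.starSubalgebra_topologicalClosure_eq_top_of_separatesPoints A hsep
  have hLall : ∀ g, L g = 0 := fun g => by
    have hg : g ∈ closure (A : Set C(sphere (0 : E3) 1, ℂ)) := by
      rw [← StarSubalgebra.topologicalClosure_coe, hdense]
      trivial
    exact closure_minimal (s := (A : Set C(sphere (0 : E3) 1, ℂ))) hLA
      (isClosed_singleton.preimage L.continuous) hg
  -- Pairing `f` with its own conjugate gives `∫ |f|² = 0`; a continuous function vanishing almost
  -- everywhere on the sphere is zero.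
  have h0 := hLall (star f)
  simp only [hL, sphereFunctional_apply, ContinuousMap.star_apply, RCLike.star_def,
    Complex.mul_conj, integral_complex_ofReal, Complex.ofReal_eq_zero] at h0
  have hcont : Continuous fun n => Complex.normSq (f n) :=
    Complex.continuous_normSq.comp f.continuous
  have hz := (hcont.ae_eq_iff_eq sphereMeasure continuous_zero).1
    ((integral_eq_zero_iff_of_nonneg (fun n => Complex.normSq_nonneg _)
      (hcont.integrable_of_hasCompactSupport (HasCompactSupport.of_compactSpace _))).1 h0)
  ext n
  simpa using congrFun hz n

/-! ### Solutions with finite angular-momentum expansions -/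

lemma integral_harmonicSum_mul {a : ℕ → ℤ → ℝ → ℂ} {N : ℕ} {F : E3 → ℝ} {τ : E3} {R : ℝ}
    (hR : 0 < R) (ha : ∀ l m, ContinuousOn (a l m) (Icc 0 R)) (hF : Continuous F) :
    ∫ x in ball τ R, harmonicSum a N τ x * (F x : ℂ) =
      ∑ l ∈ Finset.range (N + 1), ∑ m ∈ Finset.Icc (-(l : ℤ)) l, ∫ r in (0 : ℝ)..R,
        a l m r * conj (radialComponent (fun x => (F x : ℂ)) τ l m r) * (r : ℂ) ^ 2 := by
  have hi : ∀ l m, IntegrableOn (fun x => a l m ‖x - τ‖ * sphericalHarmonic l m (direction τ x) *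
      (F x : ℂ)) (ball τ R) := fun l m => by
    have ha' : ContinuousOn (fun x => a l m ‖x - τ‖ * (F x : ℂ)) (closedBall τ R) :=
      ((ha l m).comp (f := fun x => ‖x - τ‖) (by fun_prop) fun x hx =>
        ⟨norm_nonneg _, mem_closedBall_iff_norm.1 hx⟩).mul (by fun_prop)
    simp only [mul_right_comm (a l m _) (sphericalHarmonic _ _ _)]
    exact integrableOn_mul_sphericalHarmonic
      ((ha'.integrableOn_compact (isCompact_closedBall τ R)).mono_set ball_subset_closedBall) l m
  simp only [harmonicSum, Finset.sum_mul]
  rw [integral_finsetSum _ fun l _ => integrable_finsetSum _ fun m _ => hi l m]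
  refine Finset.sum_congr rfl fun l _ => ?_
  rw [integral_finsetSum _ fun m _ => hi l m]
  exact Finset.sum_congr rfl fun m _ => integral_mul_sphericalHarmonic_mul hR (ha l m) hF l m

section Expansion

variable {lam R : ℝ} {τ : E3} {ρ VI V : E3 → ℂ}

/-- The kernel is real and symmetric, so it can be moved to the test density, where it reproduces
`η_L` by `radialComponent_test`. The boundary term is a multiple of `i_ℓ(λr)`, to which the test
density is orthogonal. -/
lemma integral_radialPotential_mul_testDensity (hlam : 0 < lam) (hR : 0 < R) {g : ℝ → ℂ}
    (hg : ContinuousOn g (Icc 0 R)) (b : ℂ) {η : E3 → ℝ} (hη : ContDiff ℝ ∞ η)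
    (hηs : HasCompactSupport η) (hηR : tsupport η ⊆ ball τ R) (l : ℕ) (m : ℤ) :
    ∫ r in (0 : ℝ)..R, radialPotential lam R l g b r *
        conj (radialComponent (fun x => (testDensity lam η x : ℂ)) τ l m r) * (r : ℂ) ^ 2 =
      ∫ r in (0 : ℝ)..R, g r * conj (radialComponent (fun x => (η x : ℂ)) τ l m r) *
        (r : ℂ) ^ 2 := by
  set σ := radialComponent (fun x => (testDensity lam η x : ℂ)) τ l m with hσ
  have hσc : ContinuousOn σ (Icc 0 R) := continuousOn_radialComponent_testDensity hη l m
  have hσc' : ContinuousOn (fun r => conj (σ r)) (Icc 0 R) :=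
    Complex.continuous_conj.comp_continuousOn hσc
  have hconj : ∀ f : ℝ → ℂ, conj (∫ r in (0 : ℝ)..R, f r) = ∫ r in (0 : ℝ)..R, conj (f r) :=
    fun f => by
      rw [intervalIntegral.integral_of_le hR.le, intervalIntegral.integral_of_le hR.le,
        integral_conj]
  have hzero : ∫ r in (0 : ℝ)..R, conj (σ r) * (besselI l (lam * r) : ℂ) * (r : ℂ) ^ 2 = 0 := by
    have := congrArg conj (integral_besselI_mul_testDensity hlam hR hη hηs hηR l m)
    rw [hconj, map_zero] at this
    simpa using this
  have hright : ∫ r in (0 : ℝ)..R, g r * conj (radialComponent (fun x => (η x : ℂ)) τ l m r) *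
      (r : ℂ) ^ 2 = ∫ r in (0 : ℝ)..R, g r * (∫ r' in (0 : ℝ)..R, (greenFun lam R l r r' : ℂ) *
        conj (σ r') * (r' : ℂ) ^ 2) * (r : ℂ) ^ 2 := by
    refine intervalIntegral.integral_congr_ae (.of_forall fun r hr => ?_)
    rw [uIoc_of_le hR.le] at hr
    rw [radialComponent_test hlam hR hη hηs hηR l m hr, hconj]
    simp [hσ]
  rw [hright, ← integral_greenFun_mul_symm l hlam hR hg hσc']
  have hcP := (continuousOn_radialPotential l hlam hR hg 0)
  have hcI := continuous_besselI_mul lam l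
  have i1 : IntervalIntegrable (fun r => radialPotential lam R l g 0 r * conj (σ r) *
      (r : ℂ) ^ 2) volume 0 R := intervalIntegrable_mul_sq hR (hcP.mul hσc')
  have i2 : IntervalIntegrable (fun r => conj (σ r) * (besselI l (lam * r) : ℂ) * (r : ℂ) ^ 2)
      volume 0 R :=
    intervalIntegrable_mul_sq hR (hσc'.mul (Complex.continuous_ofReal.comp hcI).continuousOn)
  have e : ∀ r, radialPotential lam R l g b r * conj (σ r) * (r : ℂ) ^ 2 =
      radialPotential lam R l g 0 r * conj (σ r) * (r : ℂ) ^ 2 +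
        b / besselI l (lam * R) * (conj (σ r) * (besselI l (lam * r) : ℂ) * (r : ℂ) ^ 2) :=
    fun r => by
      simp only [radialPotential]
      push_cast
      ring
  simp only [e]
  rw [intervalIntegral.integral_add i1 (i2.const_mul _), intervalIntegral.integral_const_mul, hzero,
    mul_zero, add_zero]
  simp only [radialPotential, zero_mul, add_zero]

/-- Paired with a test function, the equation splits into finitely many radial identities, all
supplied by `integral_radialPotential_mul_testDensity`; no derivative of the candidate is taken. -/
theorem isDirichletSolution_harmonicSum (hlam : 0 < lam) (hR : 0 < R) {N : ℕ}
    (hρ : ContinuousOn ρ (closedBall τ R))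
    (hρN : ∀ x ∈ ball τ R, ρ x = harmonicSum (radialComponent ρ τ) N τ x)
    (hVI : ∀ x ∈ sphere τ R, VI x = harmonicSum (radialComponent VI τ) N τ x) :
    IsDirichletSolution lam τ R ρ VI (harmonicSum (fun l m => radialPotential lam R l
      (radialComponent ρ τ l m) (radialComponent VI τ l m R)) N τ) where
  continuousOn := continuousOn_harmonicSum
    (fun l m => continuousOn_radialPotential l hlam hR (continuousOn_radialComponent hρ l m) _)
    fun l m hl => radialPotential_zero hl hR _
  boundary x hx := by
    rw [hVI x hx]
    simp only [harmonicSum, mem_sphere_iff_norm.1 hx]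
    refine Finset.sum_congr rfl fun l _ => Finset.sum_congr rfl fun m _ => ?_
    rw [radialPotential_boundary l hlam hR]
  equation η h1 h2 h3 := by
    have hπ : (Real.pi : ℂ) ≠ 0 := Complex.ofReal_ne_zero.2 Real.pi_ne_zero
    set W := harmonicSum (fun l m => radialPotential lam R l
      (radialComponent ρ τ l m) (radialComponent VI τ l m R)) N τ
    have e1 : ∀ x, W x * ((Δ η x - lam ^ 2 * η x : ℝ) : ℂ) =
        -(4 * Real.pi) * (W x * (testDensity lam η x : ℂ)) := fun x => by
      rw [testDensity]
      push_cast
      field_simp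
    simp only [e1]
    rw [integral_const_mul]
    congr 1
    rw [setIntegral_congr_fun (f := fun x => ρ x * (η x : ℂ)) measurableSet_ball
      (g := fun x => harmonicSum (radialComponent ρ τ) N τ x * (η x : ℂ))
      fun x hx => by simp only [hρN x hx]]
    rw [integral_harmonicSum_mul hR (continuousOn_radialComponent hρ) h1.continuous]
    refine (integral_harmonicSum_mul hR (fun l m => continuousOn_radialPotential l hlam hR
        (continuousOn_radialComponent hρ l m) _) (continuous_testDensity h1)).trans ?_
    exact Finset.sum_congr rfl fun l _ => Finset.sum_congr rfl fun m _ =>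
      integral_radialPotential_mul_testDensity hlam hR (continuousOn_radialComponent hρ l m) _
        h1 h2 h3 l m

/-- The Dirichlet problem has at most one solution. -/
theorem IsDirichletSolution.eqOn {V W : E3 → ℂ} (hlam : 0 < lam) (hR : 0 < R)
    (hρ : IntegrableOn ρ (ball τ R)) (hV : IsDirichletSolution lam τ R ρ VI V)
    (hW : IsDirichletSolution lam τ R ρ VI W) : EqOn V W (closedBall τ R) := by
  have hsphere : ∀ r ∈ Ioc 0 R, ∀ n : sphere (0 : E3) 1,
      V (τ + r • (n : E3)) = W (τ + r • (n : E3)) := by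
    intro r hr
    have hc : ∀ {U : E3 → ℂ}, ContinuousOn U (closedBall τ R) →
        Continuous fun n : sphere (0 : E3) 1 => U (τ + r • (n : E3)) := fun hU =>
      hU.comp_continuous (by fun_prop) fun n => add_smul_mem_closedBall τ (Ioc_subset_Icc_self hr) n
    set f : C(sphere (0 : E3) 1, ℂ) := ⟨_, hc hV.continuousOn⟩ - ⟨_, hc hW.continuousOn⟩ with hf
    -- All components of both solutions at radius `r` are given by the same formula in the data, and
    -- the harmonics are complete.
    have h0 : f = 0 := by
      refine eq_zero_of_forall_integral_mul_conj_sphericalHarmonic_eq_zero f fun l m _ => ?_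
      have hY : Continuous fun n : sphere (0 : E3) 1 => conj (sphericalHarmonic l m (n : E3)) :=
        Complex.continuous_conj.comp
          ((continuous_sphericalHarmonic l m).comp continuous_subtype_val)
      have hi : ∀ {U : E3 → ℂ}, ContinuousOn U (closedBall τ R) →
          Integrable (fun n : sphere (0 : E3) 1 => U (τ + r • (n : E3)) *
            conj (sphericalHarmonic l m (n : E3))) sphereMeasure := fun hU =>
        ((hc hU).mul hY).integrable_of_hasCompactSupport (HasCompactSupport.of_compactSpace _)
      simp only [hf, ContinuousMap.sub_apply, ContinuousMap.coe_mk, sub_mul]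
      rw [integral_sub (hi hV.continuousOn) (hi hW.continuousOn), sub_eq_zero]
      exact (hV.radialComponent_eq hlam hR hρ l m hr).trans
        (hW.radialComponent_eq hlam hR hρ l m hr).symm
    exact fun n => sub_eq_zero.1 (DFunLike.congr_fun h0 n)
  have hne : EqOn V W (ball τ R ∩ {τ}ᶜ) := by
    rintro x ⟨hx, hxt⟩
    have hpos : 0 < ‖x - τ‖ := norm_pos_iff.2 (sub_ne_zero.2 hxt)
    have h := hsphere ‖x - τ‖ ⟨hpos, (mem_ball_iff_norm.1 hx).le⟩
      ⟨direction τ x, by simp [direction, norm_smul, hpos.ne']⟩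
    have hx' : τ + ‖x - τ‖ • direction τ x = x := by
      rw [direction, smul_smul, mul_inv_cancel₀ hpos.ne', one_smul, add_sub_cancel]
    simpa only [hx'] using h
  -- The punctured open ball is dense in the closed ball, so continuity adds the centre and the
  -- boundary sphere.
  refine hne.of_subset_closure hV.continuousOn hW.continuousOn
    (inter_subset_left.trans ball_subset_closedBall) ?_
  rw [← closure_ball τ hR.ne']
  exact closure_minimal ((dense_compl_singleton τ).open_subset_closure_inter isOpen_ball)
    isClosed_closure

lemma IsDirichletSolution.congr {V W : E3 → ℂ} (hW : IsDirichletSolution lam τ R ρ VI W)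
    (h : EqOn V W (closedBall τ R)) : IsDirichletSolution lam τ R ρ VI V where
  continuousOn := hW.continuousOn.congr h
  boundary x hx := (h (sphere_subset_closedBall hx)).trans (hW.boundary x hx)
  equation η h1 h2 h3 := by
    rw [← hW.equation η h1 h2 h3]
    exact setIntegral_congr_fun measurableSet_ball fun x hx => by
      simp only [h (ball_subset_closedBall hx)]

/-- For data with finite angular-momentum expansions the Dirichlet problem has exactly one
solution. -/
theorem isDirichletSolution_iff (hlam : 0 < lam) (hR : 0 < R) {N : ℕ}
    (hρ : ContinuousOn ρ (closedBall τ R))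
    (hρN : ∀ x ∈ ball τ R, ρ x = harmonicSum (radialComponent ρ τ) N τ x)
    (hVI : ∀ x ∈ sphere τ R, VI x = harmonicSum (radialComponent VI τ) N τ x) :
    IsDirichletSolution lam τ R ρ VI V ↔ ∀ x ∈ closedBall τ R, V x = harmonicSum
      (fun l m => radialPotential lam R l (radialComponent ρ τ l m)
        (radialComponent VI τ l m R)) N τ x := by
  have hW := isDirichletSolution_harmonicSum hlam hR hρ hρN hVI
  exact ⟨fun hV => hV.eqOn hlam hR ((hρ.integrableOn_compact
    (isCompact_closedBall τ R)).mono_set ball_subset_closedBall) hW, fun h => hW.congr h⟩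

end Expansion

end MuffinTin

/-! ### The main theorem -/

theorem mainTheorem5 (lam R : ℝ) (hlam : 0 < lam) (hR : 0 < R) :
    -- the radial Dirichlet Green function
    (∀ (l : ℕ) (G : ℝ → ℝ → ℝ),
      MuffinTin.IsRadialDirichletGreen lam R l G ↔
        ∀ r ∈ Icc 0 R, ∀ r' ∈ Icc 0 R, (r, r') ≠ (0, 0) →
          G r r' = MuffinTin.greenFun lam R l r r') ∧
    -- the radial components of a solution of the Dirichlet problem
    (∀ (τ : MuffinTin.E3) (ρ VI V : MuffinTin.E3 → ℂ),
      IntegrableOn ρ (ball τ R) →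
      MuffinTin.IsDirichletSolution lam τ R ρ VI V →
      ∀ (l : ℕ) (m : ℤ), |m| ≤ (l : ℤ) → ∀ r ∈ Ioc 0 R,
        IntervalIntegrable (fun r' : ℝ => (MuffinTin.greenFun lam R l r r' : ℂ) *
          MuffinTin.radialComponent ρ τ l m r' * (r' : ℂ) ^ 2) volume 0 R ∧
        IntervalIntegrable (fun r' : ℝ => MuffinTin.radialComponent ρ τ l m r' *
          (MuffinTin.besselI l (lam * r') : ℂ) * (r' : ℂ) ^ 2) volume 0 R ∧
        IntervalIntegrable (fun r' : ℝ => MuffinTin.radialComponent ρ τ l m r' *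
          (MuffinTin.besselK l (lam * r') : ℂ) * (r' : ℂ) ^ 2) volume r R ∧
        MuffinTin.radialComponent V τ l m r =
          (∫ r' in (0 : ℝ)..R, (MuffinTin.greenFun lam R l r r' : ℂ) *
            MuffinTin.radialComponent ρ τ l m r' * (r' : ℂ) ^ 2)
          + MuffinTin.radialComponent VI τ l m R *
            ((MuffinTin.besselI l (lam * r) / MuffinTin.besselI l (lam * R) : ℝ) : ℂ) ∧
        MuffinTin.radialComponent V τ l m r =
          4 * (Real.pi : ℂ) * (lam : ℂ) *
            ((∫ r' in (0 : ℝ)..r, MuffinTin.radialComponent ρ τ l m r' *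
                (MuffinTin.besselI l (lam * r') : ℂ) * (r' : ℂ) ^ 2) *
                (MuffinTin.besselK l (lam * r) : ℂ)
              + (∫ r' in r..R, MuffinTin.radialComponent ρ τ l m r' *
                (MuffinTin.besselK l (lam * r') : ℂ) * (r' : ℂ) ^ 2) *
                (MuffinTin.besselI l (lam * r) : ℂ)
              - (∫ r' in (0 : ℝ)..R, MuffinTin.radialComponent ρ τ l m r' *
                (MuffinTin.besselI l (lam * r') : ℂ) * (r' : ℂ) ^ 2) *
                ((MuffinTin.besselI l (lam * r) *
                  (MuffinTin.besselK l (lam * R) / MuffinTin.besselI l (lam * R)) : ℝ) : ℂ))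
          + MuffinTin.radialComponent VI τ l m R *
            ((MuffinTin.besselI l (lam * r) / MuffinTin.besselI l (lam * R) : ℝ) : ℂ)) ∧
    -- for data with finite angular-momentum expansions, these components give the solution
    (∀ (τ : MuffinTin.E3) (ρ VI : MuffinTin.E3 → ℂ) (N : ℕ),
      ContinuousOn ρ (closedBall τ R) →
      (∀ x ∈ ball τ R, ρ x = MuffinTin.harmonicSum (MuffinTin.radialComponent ρ τ) N τ x) →
      (∀ x ∈ sphere τ R, VI x = MuffinTin.harmonicSum (MuffinTin.radialComponent VI τ) N τ x) →
      ∀ V : MuffinTin.E3 → ℂ,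
        MuffinTin.IsDirichletSolution lam τ R ρ VI V ↔
          ∀ x ∈ closedBall τ R, V x = MuffinTin.harmonicSum
            (fun l m => MuffinTin.radialPotential lam R l (MuffinTin.radialComponent ρ τ l m)
              (MuffinTin.radialComponent VI τ l m R)) N τ x) := by
  refine ⟨fun l G => MuffinTin.isRadialDirichletGreen_iff hlam hR l G,
    fun τ ρ VI V hρ hV l m _ r hr => ?_,
    fun τ ρ VI N hρ hρN hVI V => MuffinTin.isDirichletSolution_iff hlam hR hρ hρN hVI⟩
  have hg := (MuffinTin.polar_radialComponent hR hρ l m).1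
  have hG := MuffinTin.intervalIntegrable_greenFun_mul l hlam hR hg hr
  have hI := MuffinTin.intervalIntegrable_mul_besselI lam l hg
  have hK := MuffinTin.intervalIntegrable_mul_besselK hlam l hg hr
  have h := hV.radialComponent_eq hlam hR hρ l m hr
  rw [MuffinTin.radialPotential] at h
  refine ⟨hG, hI, hK, h, ?_⟩
  rw [h, MuffinTin.integral_greenFun_mul_eq l hr hI hK hG]
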